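/- **Setting.** Let $X_+$ and $X_-$ be real Hilbert spaces with scales of dense subspaces $X_\pm=X_\pm^0\supset X_\pm^1\supset X_\pm^2\supset\cdots$; each $X_\pm^r$ has its own norm and $|w|_{X_\pm^{r}}\le |w|_{X_\pm^{r+1}}$. Let $X^r=X_+^r\oplus X_-^r$ with $|v|_{X^r}=\max\{|v_+|_{X_+^r},|v_-|_{X_-^r}\}$, and let $X^r(R)$, $X_\pm^r(R)$ denote the open balls of radius $R$ centred at $0$. Let $k\ge 1$ be an integer, $R_0,C_f>0$, $C_0\ge1$, $\lambda_\pm\in\mathbb R$. Consider $$\partial_t v_+=\mathbf A_+(v)v_++f_+(v),\qquad \partial_t v_-=\mathbf A_-(v)v_-+f_-(v)\tag{1}$$ under the following assumptions. (C.1) $\mathbf L_\pm\in C^1\big(X^{k-1}(R_0),\mathbb L(X_\pm,X_\pm^*)\big)$ and, for all $v\in X^{k-1}(R_0)$ and $w\in X_\pm$: $\mathbf L_\pm(v)=\mathbf L_\pm(v)^*$, $\;C_0^{-1}|w|_{X_\pm}\le\sqrt{\langle \mathbf L_\pm(v)w,w\rangle}\le C_0|w|_{X_\pm}$, and $|\mathbf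 D\mathbf L_\pm(v)|_{\mathbb L(X^{k-1}\otimes X_\pm,X_\pm^*)}\le C_0$. (C.2) For $v\in X^{k-1}(R_0)$, $\mathbf A_\pm(v)$ is a linear operator with domain $X_\pm^1$, and $\mu\pm\mathbf A_\pm(v):X_\pm^1\to X_\pm$ is surjective for some $\mu>\mp\lambda_\pm$. With $\bar{\mathbf A}_\pm(v)=\mathbf A_\pm(v)-(\lambda_\pm\mp1)$, for every integer $1\le r\le k$ the operator $\mathbf A_\pm(v)$ restricts to a bounded operator $X_\pm^r\to X_\pm^{r-1}$, $\bar{\mathbf A}_\pm(v):X_\pm^r\to X_\pm^{r-1}$ is an isomorphism, and $\mathbf A_\pm$, $\bar{\mathbf A}_\pm$ (as maps into $\mathbb L(X_\pm^r,X_\pm^{r-1})$) and $\bar{\mathbf A}_\pm^{-1}$ (as a map into $\mathbb L(X_\pm^{r-1},X_\pm^r)$) are $C^1$ on $X^{k-1}(R_0)$, they and their first derivatives being bounded by $C_0$. Moreover, for $v\in X^{k-1}(R_0)$ and $w\in X_\pm^1$, $$\langle\mathbf L_\pm(v)w,\mp\mathbf A_\pm(v)w\rangle\le\mp\lambda_\pm\langle\mathbf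 L_\pm(v)w,w\rangle .$$ (C.3) $f_\pm\in C^0(X^k(R_0),X_\pm^k)$ and, for $v,v_1,v_2\in X^k(R_0)$, $|f_\pm(v)|_{X_\pm^k}\le C_f|v|_{X^k}$ and $|f_\pm(v_1)-f_\pm(v_2)|_{X_\pm^{k-1}}\le C_f|v_1-v_2|_{X^{k-1}}$. (C.4) The set $\Sigma_+=\{0\le\lambda\in(\lambda_-,\lambda_+)\mid L_1(\lambda)<1\}$ is non-empty, where $L_1(\lambda)=\frac{C_0^{2(k+1)}C_f}{\lambda-\lambda_-}+\frac{C_0^{2(k+1)}C_f}{\lambda_+-\lambda}$. A solution on a time interval $I$ is a $v\in C^0(I,X^k(R_0))\cap C^1(I,X^{k-1}(R_0))$ satisfying (1) in $X^{k-1}$ on $I$. **Theorem.** For any $\lambda\in\Sigma_+$, $M_0>\frac{2C_0^{2(k+1)}}{1-L_1(\lambda)}$ and $l\in(L_1(\lambda),1)$ there exists $\varepsilon\in(0,R_0/M_0)$, depending only on $k,R_0,\lambda_\pm,C_f,C_0$ and $\lambda,M_0,l$, such that for every system as above there exists $h_+:X_+^k(\varepsilon)\to X_-^k$ with the following properties.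 1. For any $v_{0+}\in X_+^k(\varepsilon)$ there is a solution $v$ of (1) on $(-\infty,0]$, unique in the category $$v_+(0)=v_{0+},\qquad |v(t)|_{X^k}\le M_0\varepsilon e^{\lambda t}\quad\forall t\le0.$$ Moreover $v_-(0)=h_+(v_{0+})$ and $|v(t)|_{X^k}\le\frac{2C_0^{2(k+1)}}{1-L_1(\lambda)}|v_{0+}|_{X_+^k}e^{\lambda t}$ for all $t\le0$. 2. For this solution, $h_+(v_+(t))=v_-(t)$ for every $t<0$ with $v_+(t)\in X_+^k(\varepsilon)$. 3. If this solution extends to a solution on $(-\infty,T_0)$ for some $T_0>0$, let $T=\sup\{t\in(0,T_0]\mid v_+(\tau)\in X_+^k(\varepsilon)\ \forall\tau\in[0,t)\}$. Then $T\in(0,T_0]$ and $h_+(v_+(t))=v_-(t)$ for all $t\in[0,T)$. 4. $h_+(0)=0$ and, for all $v_{0+},\tilde v_{0+}\in X_+^k(\varepsilon)$, $$|h_+(v_{0+})|_{X_-^k}\le\frac{2lC_0^{2(k+1)}}{1-L_1(\lambda)}|v_{0+}|_{X_+^k},\qquad |h_+(v_{0+})-h_+(\tilde v_{0+})|_{X_-^{k-1}}\le\frac{lC_0^{2k}}{1-l}|v_{0+}-\tilde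 v_{0+}|_{X_+^{k-1}},$$ and the corresponding solutions $v,\tilde v$ of part 1 satisfy, for $t\le0$, $|v(t)-\tilde v(t)|_{X^{k-1}}\le\frac{C_0^{2k}}{1-l}e^{\lambda t}|v_{0+}-\tilde v_{0+}|_{X_+^{k-1}}$. 5. If $0<\tilde\lambda\in\Sigma_+$ and $v$ is a solution of (1) on $(-\infty,0]$ with $\sup_{t\le0}e^{-\tilde\lambda t}|v(t)|_{X^k}<\infty$, then there is $t_0\le0$ such that $v_+(t)\in X_+^k(\varepsilon)$ and $v_-(t)=h_+(v_+(t))$ for all $t\le t_0$. -/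

import Mathlib

open Set Metric

/-- A scale of normed spaces `X 0 ⊇ X 1 ⊇ X 2 ⊇ ...` over a real Hilbert space `X 0`: the inclusions
`X (r + 1) → X r` are injective, do not increase norms, and each `X r` is dense in `X 0`.
That the norm of `X 0` comes from an inner product is expressed by the parallelogram law
(`InnerProductSpaceable`); the norms of the `X r`, `1 ≤ r`, need not be Hilbert norms. -/
structure HilbertScale (X : ℕ → Type*) [∀ r, NormedAddCommGroup (X r)]
    [∀ r, NormedSpace ℝ (X r)] where
  complete_zero : CompleteSpace (X 0)
  hilbert_zero : InnerProductSpaceable (X 0)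
  /-- the inclusion of `X (r + 1)` into `X r` -/
  incl : ∀ r, X (r + 1) →L[ℝ] X r
  incl_injective : ∀ r, Function.Injective (incl r)
  norm_incl_le : ∀ r (w : X (r + 1)), ‖incl r w‖ ≤ ‖w‖
  /-- the inclusion of `X r` into `X 0` -/
  toBase : ∀ r, X r →L[ℝ] X 0
  toBase_zero : toBase 0 = ContinuousLinearMap.id ℝ (X 0)
  toBase_succ : ∀ r, toBase (r + 1) = (toBase r).comp (incl r)
  dense_toBase : ∀ r, DenseRange (toBase r)

section Conditions

variable {E : Type*} [NormedAddCommGroup E] [NormedSpace ℝ E]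

/-- `L v`, for `v` in the ball of radius `R₀` of `E`, is a symmetric bounded form on the space `H`,
`C¹` in `v`, whose norm `√⟨L v w, w⟩` is equivalent to that of `H` with constant `C₀` and whose
derivative in `v` is bounded by `C₀`. -/
structure EnergyForm {H : Type*} [NormedAddCommGroup H] [NormedSpace ℝ H]
    (R₀ C₀ : ℝ) (L : E → H →L[ℝ] H →L[ℝ] ℝ) : Prop where
  contDiffOn : ContDiffOn ℝ 1 L (ball 0 R₀)
  symm : ∀ v ∈ ball (0 : E) R₀, ∀ w w', L v w w' = L v w' w
  lower : ∀ v ∈ ball (0 : E) R₀, ∀ w, C₀⁻¹ * ‖w‖ ≤ √(L v w w)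
  upper : ∀ v ∈ ball (0 : E) R₀, ∀ w, √(L v w w) ≤ C₀ * ‖w‖
  norm_fderiv_le : ∀ v ∈ ball (0 : E) R₀, ∀ z, ‖fderiv ℝ L v z‖ ≤ C₀ * ‖z‖

/-- `F` is `C¹` on the ball of radius `R₀`, with `F` and its derivative bounded by `C₀` there. -/
structure BoundedC1 {G : Type*} [NormedAddCommGroup G] [NormedSpace ℝ G]
    (R₀ C₀ : ℝ) (F : E → G) : Prop where
  contDiffOn : ContDiffOn ℝ 1 F (ball 0 R₀)
  norm_le : ∀ v ∈ ball (0 : E) R₀, ‖F v‖ ≤ C₀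
  norm_fderiv_le : ∀ v ∈ ball (0 : E) R₀, ‖fderiv ℝ F v‖ ≤ C₀

/-- The operator `A - (lam - s)` from `X (r + 1)` to `X r`. -/
def shiftedOp {X : ℕ → Type*} [∀ r, NormedAddCommGroup (X r)] [∀ r, NormedSpace ℝ (X r)]
    (S : HilbertScale X) (s lam : ℝ) (r : ℕ) (A : X (r + 1) →L[ℝ] X r) : X (r + 1) →L[ℝ] X r :=
  A - (lam - s) • S.incl r

/-- The assumptions on the operators `A v` with domain `X 1`, for `v` in the ball of radius `R₀`
of `E`; `A r v` is the restriction of `A v` to a bounded operator from `X (r + 1)` to `X r`, with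
`r + 1 ≤ m + 1`. The sign is `s = 1` for the component `+` (where `-A v` is dissipative up to the
shift `-lam`) and `s = -1` for the component `-` (where `A v` is dissipative up to the shift
`lam`). -/
structure DissipativeFamily {X : ℕ → Type*} [∀ r, NormedAddCommGroup (X r)]
    [∀ r, NormedSpace ℝ (X r)] (S : HilbertScale X) (m : ℕ) (s lam R₀ C₀ : ℝ)
    (L : E → X 0 →L[ℝ] X 0 →L[ℝ] ℝ) (A : ∀ r, E → X (r + 1) →L[ℝ] X r) : Prop where
  /-- the `A r v` are restrictions of one operator -/
  restrict : ∀ v ∈ ball (0 : E) R₀, ∀ r, r + 1 ≤ m → ∀ w : X (r + 2),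
    S.incl r (A (r + 1) v w) = A r v (S.incl (r + 1) w)
  surjective : ∀ v ∈ ball (0 : E) R₀, ∃ μ : ℝ, -s * lam < μ ∧
    Function.Surjective (fun w : X 1 => μ • S.incl 0 w + s • A 0 v w)
  bounded : ∀ r ≤ m, BoundedC1 R₀ C₀ (A r)
  shifted_bounded : ∀ r ≤ m, BoundedC1 R₀ C₀ (fun v => shiftedOp S s lam r (A r v))
  shifted_invertible : ∀ r ≤ m, ∀ v ∈ ball (0 : E) R₀,
    (shiftedOp S s lam r (A r v)).IsInvertible
  inverse_bounded : ∀ r ≤ m,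
    BoundedC1 R₀ C₀ (fun v => (shiftedOp S s lam r (A r v)).inverse)
  dissipative : ∀ v ∈ ball (0 : E) R₀, ∀ w : X 1,
    L v (S.incl 0 w) (-s • A 0 v w) ≤ -s * lam * L v (S.incl 0 w) (S.incl 0 w)

end Conditions

section System

variable {Xp Xm : ℕ → Type*}
  [∀ r, NormedAddCommGroup (Xp r)] [∀ r, NormedSpace ℝ (Xp r)]
  [∀ r, NormedAddCommGroup (Xm r)] [∀ r, NormedSpace ℝ (Xm r)]

/-- The inclusion of `X^(r+1)` into `X^r`, where `X^r = X_+^r ⊕ X_-^r` carries the maximum norm,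
so that its balls are the products of the balls of `X_+^r` and `X_-^r`. -/
def pairIncl (Sp : HilbertScale Xp) (Sm : HilbertScale Xm) (r : ℕ) :
    Xp (r + 1) × Xm (r + 1) →L[ℝ] Xp r × Xm r :=
  (Sp.incl r).prodMap (Sm.incl r)

/-- The assumptions on a component `f` (with values in a scale `Y`) of the nonlinearity, with
`k = m + 1`: `f` is continuous from the ball of radius `R₀` of `X^k` to `Y^k`, bounded by
`Cf |v|` there, and Lipschitz with constant `Cf` in the norms of level `k - 1`. -/
structure SmallNonlinearity (Sp : HilbertScale Xp) (Sm : HilbertScale Xm)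
    {Y : ℕ → Type*} [∀ r, NormedAddCommGroup (Y r)] [∀ r, NormedSpace ℝ (Y r)]
    (S : HilbertScale Y) (m : ℕ) (R₀ Cf : ℝ) (f : Xp (m + 1) × Xm (m + 1) → Y (m + 1)) :
    Prop where
  continuousOn : ContinuousOn f (ball 0 R₀)
  norm_le : ∀ v ∈ ball (0 : Xp (m + 1) × Xm (m + 1)) R₀, ‖f v‖ ≤ Cf * ‖v‖
  lipschitz : ∀ v₁ ∈ ball (0 : Xp (m + 1) × Xm (m + 1)) R₀,
    ∀ v₂ ∈ ball (0 : Xp (m + 1) × Xm (m + 1)) R₀,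
    ‖S.incl m (f v₁ - f v₂)‖ ≤ Cf * ‖pairIncl Sp Sm m (v₁ - v₂)‖

variable (Xp Xm) in
/-- The coefficients of a quasilinear system at regularity `k = m + 1`: operators `A_±(v)` and
energy forms `L_±(v)` depending on `v ∈ X^(k-1)`, and nonlinearities `f_±` on `X^k`. -/
structure QLSystem (m : ℕ) where
  Ap : ∀ r, Xp m × Xm m → Xp (r + 1) →L[ℝ] Xp r
  Am : ∀ r, Xp m × Xm m → Xm (r + 1) →L[ℝ] Xm r
  Lp : Xp m × Xm m → Xp 0 →L[ℝ] Xp 0 →L[ℝ] ℝ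
  Lm : Xp m × Xm m → Xm 0 →L[ℝ] Xm 0 →L[ℝ] ℝ
  fp : Xp (m + 1) × Xm (m + 1) → Xp (m + 1)
  fm : Xp (m + 1) × Xm (m + 1) → Xm (m + 1)

/-- The standing assumptions on the system, with the constants `R₀, C₀, Cf, lamp, lamm`. -/
structure QLSystem.Admissible {m : ℕ} (D : QLSystem Xp Xm m) (Sp : HilbertScale Xp)
    (Sm : HilbertScale Xm) (R₀ C₀ Cf lamp lamm : ℝ) : Prop where
  energy_plus : EnergyForm R₀ C₀ D.Lp
  energy_minus : EnergyForm R₀ C₀ D.Lm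
  op_plus : DissipativeFamily Sp m 1 lamp R₀ C₀ D.Lp D.Ap
  op_minus : DissipativeFamily Sm m (-1) lamm R₀ C₀ D.Lm D.Am
  nonlin_plus : SmallNonlinearity Sp Sm Sp m R₀ Cf D.fp
  nonlin_minus : SmallNonlinearity Sp Sm Sm m R₀ Cf D.fm

/-- `v` solves `∂ₜ v_± = A_±(v) v_± + f_±(v)` on the time interval `I`, with
`v ∈ C⁰(I, X^k(R₀)) ∩ C¹(I, X^(k-1))`, `k = m + 1`; the equation holds in `X^(k-1)`. -/
structure QLSystem.IsSolutionOn {m : ℕ} (D : QLSystem Xp Xm m) (Sp : HilbertScale Xp)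
    (Sm : HilbertScale Xm) (R₀ : ℝ) (I : Set ℝ) (v : ℝ → Xp (m + 1) × Xm (m + 1)) : Prop where
  continuousOn : ContinuousOn v I
  mem_ball : ∀ t ∈ I, v t ∈ ball (0 : Xp (m + 1) × Xm (m + 1)) R₀
  contDiffOn : ContDiffOn ℝ 1 (fun t => pairIncl Sp Sm m (v t)) I
  eq_plus : ∀ t ∈ I, HasDerivWithinAt (fun τ => Sp.incl m (v τ).1)
    (D.Ap m (pairIncl Sp Sm m (v t)) (v t).1 + Sp.incl m (D.fp (v t))) I t
  eq_minus : ∀ t ∈ I, HasDerivWithinAt (fun τ => Sm.incl m (v τ).2)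
    (D.Am m (pairIncl Sp Sm m (v t)) (v t).2 + Sm.incl m (D.fm (v t))) I t

/-- `v` is a solution on `(-∞, 0]` with `v_+(0) = v₀` and `|v(t)|_{X^k} ≤ M e^{lam t}`. -/
def QLSystem.IsDecayingSolution {m : ℕ} (D : QLSystem Xp Xm m) (Sp : HilbertScale Xp)
    (Sm : HilbertScale Xm) (R₀ lam M : ℝ) (v₀ : Xp (m + 1))
    (v : ℝ → Xp (m + 1) × Xm (m + 1)) : Prop :=
  D.IsSolutionOn Sp Sm R₀ (Iic 0) v ∧ (v 0).1 = v₀ ∧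
    ∀ t ≤ 0, ‖v t‖ ≤ M * Real.exp (lam * t)

end System

/-- `L₁(lam) = C₀^{2(k+1)} Cf / (lam - lamm) + C₀^{2(k+1)} Cf / (lamp - lam)`. -/
noncomputable def gapRatio (k : ℕ) (C₀ Cf lamp lamm lam : ℝ) : ℝ :=
  C₀ ^ (2 * (k + 1)) * Cf / (lam - lamm) + C₀ ^ (2 * (k + 1)) * Cf / (lamp - lam)

/-- The set `Σ_+` of admissible exponential rates. -/
def sigmaPlus (k : ℕ) (C₀ Cf lamp lamm : ℝ) : Set ℝ :=
  {lam | 0 ≤ lam ∧ lamm < lam ∧ lam < lamp ∧ gapRatio k C₀ Cf lamp lamm lam < 1}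

/-!
The graph of `h` is the set of values at time `0` of the solutions which decay like `e^{λ t}` as
`t → -∞`. It is constructed by the Lyapunov-Perron method: a path on `[-T, 0]` is prescribed by its
`+` component at `0` and by a vanishing `-` component at `-T`; the `+` component is solved
backwards in time, the `-` component forwards. Since `λ` lies in the gap `(λ₋, λ₊)`, both problems
are dissipative relative to the weight `e^{λ t}`, and `λ ∈ Σ₊` is the condition under which the
energy estimates make the resulting map a contraction.

The equation is quasilinear, so that this map loses a derivative. With `Y = X^k` and `X = X^{k-1}`,
the iterates remain bounded in `Y` but are contracted in the norm of `X` only, as in Kato's theory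
of quasilinear evolution equations. The two levels are the reason why the constants of the theorem
come in two forms. The form `L(v)(Λ ·, Λ ·)`, where `Λ` is the product of `k - 1` shifted operators
`Ā(v)`, is an inner product on `X` equivalent to its norm with constant `c = C₀^k`, and `A(v)` is
quasi-dissipative for it (`DissipativeFamily.katoFamily`). The energy of `w` in this form gives
estimates in `X` with the factor `c² = C₀^{2k}`; the energy of `Ā(v) w` gives estimates in `Y` with
`(c C₀)² = C₀^{2(k+1)}`. The dependence of the forms and operators on `v` costs terms of the order
of the size `M` of the paths. They are absorbed in a slack `κ` of the spectral gap, and this is what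
`ε` has to be small for.

The linear equations with coefficients frozen at a given path are not solved exactly. Replacing
`A` by its Yosida approximation `A (1 - h A)⁻¹` makes them ordinary differential equations in `Y`,
with the same bounds (`KatoFamily.norm_le_of_yosida`). Iteration then gives approximate solutions of
the nonlinear equation of any accuracy (`CoupledSystem.exists_approxSolution`), and their accuracy,
being measured in `X`, is controlled by an energy argument which needs a defect `η` to be small only
in `X`, at the price of an error `√η` (`CoupledSystem.norm_sub_le`). For `μ` slightly below `λ` the
boundary values at `-T` contribute to the difference of two approximate solutions a term of order
`e^{-(λ - μ) T}`, so that the approximate solutions are Cauchy in `X` as `T → ∞`. The spaces of the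
scale are Hilbertian, hence balls of `Y` are weakly closed in `X`: the limit is bounded in `Y`, and
the right sides converge weakly, so that the limit solves the integrated equation. A solution bounded
in `Y` and Lipschitz in `X` is continuous in `Y`, by comparison with the mollified paths
`(1 - h A)⁻¹ Ā v` (`KatoFamily.continuousOn_of_ae_hasDerivAt`).

The same difference estimate, now with `T → ∞` for exact solutions, yields uniqueness and the
Lipschitz bounds. Invariance of the graph follows from uniqueness and invariance under translation
in time: forwards, the bound `|v(t)| ≤ q |v₊(0)| e^{λ t}` with `q ε < M₀ ε` leaves room to continue
the decay estimate as long as `v₊` stays in the ball (`CoupledSystem.norm_le_of_continuation`). A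
solution which decays at another rate `λ̃ ∈ Σ₊` becomes small after translation, and uniqueness at
the smaller of the two rates puts it on the graph (`CoupledSystem.eventually_snd_eq`).
-/

namespace QuasilinearManifold

open Filter Topology MeasureTheory

-- the normed structures on nested spaces of continuous linear maps need deeper instance search
set_option maxSynthPendingDepth 3

/-! ### Comparison and linear differential equations -/

/-- Comparison principle for the square of a norm. The error term `η` need not be multiplied by
`√E`; it enters the bound of `√E` linearly, which is how an error `√h` of an approximation with
step `h` appears. -/
theorem sqrt_le_of_deriv_le {E E' : ℝ → ℝ} {a b ω μ g η A : ℝ}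
    (hder : ∀ t ∈ Icc a b, HasDerivWithinAt E (E' t) (Icc a b) t)
    (hE : ∀ t ∈ Icc a b, E' t ≤ 2 * ω * E t + 2 * √(E t) * (g * Real.exp (μ * t))
      + η ^ 2 * Real.exp (μ * t) ^ 2)
    (hμ : ω < μ) (hg : 0 ≤ g) (hη : 0 ≤ η) (hA : 0 ≤ A) (h0 : √(E a) ≤ A) :
    ∀ t ∈ Icc a b, √(E t) ≤ A * Real.exp (ω * (t - a))
      + ((g + η) / (μ - ω) + η) * Real.exp (μ * t) := by
  have hgap : 0 < μ - ω := sub_pos.2 hμ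
  -- a strict version, with `η` replaced by some larger `θ > 0`
  have key : ∀ θ, η < θ → ∀ t ∈ Icc a b, √(E t) ≤ A * Real.exp (ω * (t - a))
      + ((g + θ) / (μ - ω) + θ) * Real.exp (μ * t) := by
    intro θ hθ
    have hθ0 : 0 < θ := hη.trans_lt hθ
    set B : ℝ := (g + θ) / (μ - ω) + θ with hB
    have hBθ : θ ≤ B := by
      have : 0 ≤ (g + θ) / (μ - ω) := by positivity
      linarith
    have hB0 : 0 < B := hθ0.trans_le hBθ
    have hBeq : (μ - ω) * B = g + θ + (μ - ω) * θ := by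
      rw [hB]; field_simp
    set ψ : ℝ → ℝ := fun t => A * Real.exp (ω * (t - a)) + B * Real.exp (μ * t) with hψ
    have hψ0 : ∀ t, B * Real.exp (μ * t) ≤ ψ t := fun t => by
      have : 0 ≤ A * Real.exp (ω * (t - a)) := by positivity
      simp only [hψ]; linarith
    have hψpos : ∀ t, 0 < ψ t := fun t => lt_of_lt_of_le (by positivity) (hψ0 t)
    have hψd : ∀ t, HasDerivAt ψ (ω * ψ t + (μ - ω) * B * Real.exp (μ * t)) t := by
      intro t
      have h1 : HasDerivAt (fun t => Real.exp (ω * (t - a)))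
          (Real.exp (ω * (t - a)) * (ω * 1)) t :=
        (((hasDerivAt_id t).sub_const a).const_mul ω).exp
      have h2 : HasDerivAt (fun t => Real.exp (μ * t)) (Real.exp (μ * t) * (μ * 1)) t :=
        ((hasDerivAt_id t).const_mul μ).exp
      refine ((h1.const_mul A).add (h2.const_mul B)).congr_deriv ?_
      simp only [hψ]; ring
    have hmain : ∀ ⦃t⦄, t ∈ Icc a b → E t ≤ ψ t ^ 2 := by
      refine image_le_of_deriv_right_lt_deriv_boundary'
        (f' := E') (B' := fun t => 2 * ψ t * (ω * ψ t + (μ - ω) * B * Real.exp (μ * t)))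
        (fun t ht => (hder t ht).continuousWithinAt)
        (fun t ht => (hder t (Ico_subset_Icc_self ht)).mono_of_mem_nhdsWithin
          (Icc_mem_nhdsGE_of_mem ht)) ?_ ?_ ?_ ?_
      · have : A ≤ ψ a := by
          simp only [hψ, sub_self, mul_zero, Real.exp_zero, mul_one]
          have : 0 < B * Real.exp (μ * a) := by positivity
          linarith
        exact (Real.sqrt_le_left (hψpos a).le).1 (h0.trans this)
      · exact fun t _ => ((hψd t).continuousAt.pow 2).continuousWithinAt
      · intro t _
        refine (((hψd t).pow 2).congr_deriv ?_).hasDerivWithinAt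
        push_cast; ring
      · intro t ht heq
        have h1 := hE t (Ico_subset_Icc_self ht)
        rw [heq, Real.sqrt_sq (hψpos t).le] at h1
        refine h1.trans_lt ?_
        have hx := Real.exp_pos (μ * t)
        set x := Real.exp (μ * t)
        have h2 : η ^ 2 * x ^ 2 < 2 * ψ t * (((μ - ω) * B - g) * x) := by
          have h3 : η ^ 2 * x ^ 2 < 2 * (B * x) * (θ * x) := by
            have h4 : η ^ 2 < 2 * B * θ := by nlinarith
            calc η ^ 2 * x ^ 2 < 2 * B * θ * x ^ 2 := by gcongr
              _ = _ := by ring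
          refine h3.trans_le ?_
          have h5 : θ ≤ (μ - ω) * B - g := by rw [hBeq]; nlinarith
          have := hψ0 t
          gcongr
        nlinarith [h2]
    intro t ht
    exact (Real.sqrt_le_left (hψpos t).le).2 (hmain ht)
  intro t ht
  have hlim : Tendsto (fun θ => A * Real.exp (ω * (t - a))
      + ((g + θ) / (μ - ω) + θ) * Real.exp (μ * t)) (𝓝[>] η)
      (𝓝 (A * Real.exp (ω * (t - a)) + ((g + η) / (μ - ω) + η) * Real.exp (μ * t))) := by
    refine (Continuous.tendsto ?_ η).mono_left nhdsWithin_le_nhds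
    fun_prop
  exact ge_of_tendsto hlim (by filter_upwards [self_mem_nhdsWithin] with θ hθ using key θ hθ t ht)

section LinearODE

variable {Y : Type*} [NormedAddCommGroup Y] [NormedSpace ℝ Y] [CompleteSpace Y]

/-- On an interval so short that the Picard map is a contraction, a linear differential equation
has a solution with any initial value. -/
theorem exists_linear_ode_short {B : ℝ → Y →L[ℝ] Y} {g : ℝ → Y} {a b K G : ℝ} (hab : a ≤ b)
    (hB : ContinuousOn B (Icc a b)) (hg : ContinuousOn g (Icc a b)) (hK0 : 0 ≤ K) (hG0 : 0 ≤ G)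
    (hK : ∀ t ∈ Icc a b, ‖B t‖ ≤ K) (hG : ∀ t ∈ Icc a b, ‖g t‖ ≤ G) (hshort : K * (b - a) ≤ 1 / 2)
    (w₀ : Y) :
    ∃ w : ℝ → Y, w a = w₀ ∧
      ∀ t ∈ Icc a b, HasDerivWithinAt w (B t (w t) + g t) (Icc a b) t := by
  have hba : 0 ≤ b - a := sub_nonneg.2 hab
  set r : ℝ := ‖w₀‖ + 2 * G * (b - a) with hr
  have hr0 : 0 ≤ r := by positivity
  have hL0 : 0 ≤ K * (‖w₀‖ + r) + G := by positivity
  have hP : IsPicardLindelof (fun t w => B t w + g t) (⟨a, left_mem_Icc.2 hab⟩ : Icc a b) w₀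
      ⟨r, hr0⟩ 0 ⟨K * (‖w₀‖ + r) + G, hL0⟩ ⟨K, hK0⟩ := by
    refine ⟨fun t ht => ?_, fun x _ => ?_, fun t ht x hx => ?_, ?_⟩
    · refine LipschitzOnWith.of_dist_le_mul fun x _ y _ => ?_
      rw [dist_add_right, dist_eq_norm, dist_eq_norm, ← map_sub]
      exact (B t).le_of_opNorm_le (hK t ht) _
    · exact (hB.clm_apply continuousOn_const).add hg
    · have hx' : ‖x‖ ≤ ‖w₀‖ + r := by
        have : ‖x - w₀‖ ≤ r := mem_closedBall_iff_norm.1 hx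
        calc ‖x‖ = ‖w₀ + (x - w₀)‖ := by congr 1; abel
          _ ≤ _ := (norm_add_le _ _).trans (by linarith)
      calc ‖B t x + g t‖ ≤ ‖B t x‖ + ‖g t‖ := norm_add_le _ _
        _ ≤ K * (‖w₀‖ + r) + G := by
          refine add_le_add (((B t).le_of_opNorm_le (hK t ht) _).trans ?_) (hG t ht)
          gcongr
    · have : (K * (‖w₀‖ + r) + G) * (b - a) ≤ r := by
        have h1 : K * (b - a) * (‖w₀‖ + r) ≤ 1 / 2 * (‖w₀‖ + r) := by gcongr
        have h2 : (K * (‖w₀‖ + r) + G) * (b - a) = K * (b - a) * (‖w₀‖ + r) + G * (b - a) := by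
          ring
        rw [h2]; linarith
      change (K * (‖w₀‖ + r) + G) * max (b - a) (a - a) ≤ r - 0
      rw [sub_self, max_eq_left hba, sub_zero]
      exact this
  obtain ⟨w, hw, hw'⟩ := hP.exists_eq_forall_mem_Icc_hasDerivWithinAt₀
  exact ⟨w, hw, hw'⟩

/-- A linear differential equation with continuous coefficients has a solution on any compact
interval: halve the interval until the contraction principle applies. -/
theorem exists_linear_ode {B : ℝ → Y →L[ℝ] Y} {g : ℝ → Y} {a b : ℝ} (hab : a ≤ b)
    (hB : ContinuousOn B (Icc a b)) (hg : ContinuousOn g (Icc a b)) (w₀ : Y) :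
    ∃ w : ℝ → Y, w a = w₀ ∧
      ∀ t ∈ Icc a b, HasDerivWithinAt w (B t (w t) + g t) (Icc a b) t := by
  obtain ⟨K, hK⟩ := isCompact_Icc.exists_bound_of_continuousOn hB
  obtain ⟨G, hG⟩ := isCompact_Icc.exists_bound_of_continuousOn hg
  have hK0 : 0 ≤ K := (norm_nonneg _).trans (hK a (left_mem_Icc.2 hab))
  have hG0 : 0 ≤ G := (norm_nonneg _).trans (hG a (left_mem_Icc.2 hab))
  have main : ∀ n : ℕ, ∀ a' b', a ≤ a' → a' ≤ b' → b' ≤ b → K * (b' - a') ≤ 2 ^ n / 2 →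
      ∀ w₀ : Y, ∃ w : ℝ → Y, w a' = w₀ ∧
        ∀ t ∈ Icc a' b', HasDerivWithinAt w (B t (w t) + g t) (Icc a' b') t := by
    intro n
    induction n with
    | zero =>
      intro a' b' h1 h2 h3 h4 w₀
      have hsub : Icc a' b' ⊆ Icc a b := Icc_subset_Icc h1 h3
      exact exists_linear_ode_short h2 (hB.mono hsub) (hg.mono hsub) hK0 hG0
        (fun t ht => hK t (hsub ht)) (fun t ht => hG t (hsub ht)) (by simpa using h4) w₀
    | succ n ih =>
      intro a' b' h1 h2 h3 h4 w₀
      set m := (a' + b') / 2 with hm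
      have hm1 : a' ≤ m := by rw [hm]; linarith
      have hm2 : m ≤ b' := by rw [hm]; linarith
      rw [pow_succ] at h4
      obtain ⟨w₁, hw₁, hd₁⟩ := ih a' m h1 hm1 (hm2.trans h3)
        (by rw [hm]; linarith) w₀
      obtain ⟨w₂, hw₂, hd₂⟩ := ih m b' (h1.trans hm1) hm2 h3
        (by rw [hm]; linarith) (w₁ m)
      set w : ℝ → Y := fun t => if t ≤ m then w₁ t else w₂ t with hw
      have e1 : EqOn w w₁ (Icc a' m) := fun t ht => if_pos ht.2
      have e2 : EqOn w w₂ (Icc m b') := by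
        intro t ht
        rcases ht.1.eq_or_lt with h | h
        · simp [hw, ← h, hw₂]
        · exact if_neg (not_le.2 h)
      have D1 : ∀ t ∈ Icc a' m, HasDerivWithinAt w (B t (w t) + g t) (Icc a' m) t := by
        intro t ht
        rw [e1 ht]
        exact (hd₁ t ht).congr e1 (e1 ht)
      have D2 : ∀ t ∈ Icc m b', HasDerivWithinAt w (B t (w t) + g t) (Icc m b') t := by
        intro t ht
        rw [e2 ht]
        exact (hd₂ t ht).congr e2 (e2 ht)
      refine ⟨w, by rw [e1 (left_mem_Icc.2 hm1), hw₁], fun t ht => ?_⟩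
      rcases lt_trichotomy t m with h | h | h
      · refine (D1 t ⟨ht.1, h.le⟩).mono_of_mem_nhdsWithin ?_
        have : Iio m ∩ Icc a' b' ∈ 𝓝[Icc a' b'] t :=
          inter_mem (mem_nhdsWithin_of_mem_nhds (Iio_mem_nhds h)) self_mem_nhdsWithin
        exact mem_of_superset this fun s hs => ⟨hs.2.1, (mem_Iio.1 hs.1).le⟩
      · have hu := (D1 t ⟨ht.1, h.le⟩).union (D2 t ⟨h.ge, ht.2⟩)
        rwa [Icc_union_Icc_eq_Icc hm1 hm2] at hu
      · refine (D2 t ⟨h.le, ht.2⟩).mono_of_mem_nhdsWithin ?_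
        have : Ioi m ∩ Icc a' b' ∈ 𝓝[Icc a' b'] t :=
          inter_mem (mem_nhdsWithin_of_mem_nhds (Ioi_mem_nhds h)) self_mem_nhdsWithin
        exact mem_of_superset this fun s hs => ⟨(mem_Ioi.1 hs.1).le, hs.2.2⟩
  obtain ⟨n, hn⟩ := pow_unbounded_of_one_lt (2 * (K * (b - a))) (one_lt_two (α := ℝ))
  exact main n a b le_rfl hab le_rfl (by linarith) w₀

end LinearODE

/-! ### Families of quasi-dissipative operators on a pair of spaces -/

/-- The Cauchy-Schwarz inequality for a nonnegative symmetric form. -/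
theorem abs_le_sqrt_mul_sqrt {X : Type*} [NormedAddCommGroup X] [NormedSpace ℝ X]
    {β : X →L[ℝ] X →L[ℝ] ℝ} (hs : ∀ x x', β x x' = β x' x) (h0 : ∀ x, 0 ≤ β x x) (x x' : X) :
    |β x x'| ≤ √(β x x) * √(β x' x') := by
  rw [← Real.sqrt_mul (h0 x)]
  refine Real.abs_le_sqrt ?_
  -- the discriminant of `s ↦ β (x + s x') (x + s x')` is nonpositive
  have h : ∀ s : ℝ, 0 ≤ β x' x' * (s * s) + 2 * β x x' * s + β x x := by
    intro s
    have h1 := h0 (x + s • x')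
    simp only [map_add, map_smul, add_apply, smul_apply, smul_eq_mul, hs x' x] at h1
    linarith
  have h2 := discrim_le_zero h
  rw [discrim] at h2
  linarith

section Family

variable {E X Y : Type*} [NormedAddCommGroup E] [NormedSpace ℝ E]
  [NormedAddCommGroup X] [NormedSpace ℝ X] [NormedAddCommGroup Y] [NormedSpace ℝ Y]

/-- A quasi-dissipative family on a pair `Y → X` of spaces, in the sense of Kato's theory of
quasilinear equations. For `v` in a ball of the parameter space `E`, `A v : Y → X` is a bounded
operator with `b v (A v y) y ≤ ω b v y y` for an inner product `b v` on `X` whose norm is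
equivalent to that of `X` with constant `c`, and `A v - (ω + 1)` is an isomorphism of `Y` onto `X`
with constant `C`; `A` and `b` are differentiable in `v`, with derivatives bounded by `C` and `K`.
-/
structure KatoFamily (ι : Y →L[ℝ] X) (R ω c C K : ℝ) (b : E → X →L[ℝ] X →L[ℝ] ℝ)
    (A : E → Y →L[ℝ] X) : Prop where
  one_le_c : 1 ≤ c
  one_le_C : 1 ≤ C
  zero_le_K : 0 ≤ K
  norm_incl_le : ∀ y, ‖ι y‖ ≤ ‖y‖
  differentiableAt_form : ∀ v ∈ ball (0 : E) R, DifferentiableAt ℝ b v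
  norm_fderiv_form_le : ∀ v ∈ ball (0 : E) R, ‖fderiv ℝ b v‖ ≤ K
  symm : ∀ v ∈ ball (0 : E) R, ∀ x x', b v x x' = b v x' x
  lower : ∀ v ∈ ball (0 : E) R, ∀ x, ‖x‖ ≤ c * √(b v x x)
  upper : ∀ v ∈ ball (0 : E) R, ∀ x, √(b v x x) ≤ c * ‖x‖
  contDiffOn : ContDiffOn ℝ 1 A (ball 0 R)
  norm_le : ∀ v ∈ ball (0 : E) R, ‖A v‖ ≤ C
  norm_fderiv_le : ∀ v ∈ ball (0 : E) R, ‖fderiv ℝ A v‖ ≤ C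
  norm_shift_le : ∀ v ∈ ball (0 : E) R, ‖A v - (ω + 1) • ι‖ ≤ C
  shift_invertible : ∀ v ∈ ball (0 : E) R, (A v - (ω + 1) • ι).IsInvertible
  norm_shift_inverse_le : ∀ v ∈ ball (0 : E) R, ‖(A v - (ω + 1) • ι).inverse‖ ≤ C
  dissipative : ∀ v ∈ ball (0 : E) R, ∀ y, b v (A v y) (ι y) ≤ ω * b v (ι y) (ι y)

namespace KatoFamily

variable {ι : Y →L[ℝ] X} {R ω c C K : ℝ} {b : E → X →L[ℝ] X →L[ℝ] ℝ} {A : E → Y →L[ℝ] X}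
  (k : KatoFamily ι R ω c C K b A) {v : E}

include k

theorem c_pos : 0 < c := zero_lt_one.trans_le k.one_le_c

theorem C_pos : 0 < C := zero_lt_one.trans_le k.one_le_C

theorem form_nonneg (hv : v ∈ ball (0 : E) R) (x : X) : 0 ≤ b v x x := by
  by_cases hx : x = 0
  · simp [hx]
  · have h1 := (norm_pos_iff.2 hx).trans_le (k.lower v hv x)
    exact (Real.sqrt_pos.1 (pos_of_mul_pos_right h1 k.c_pos.le)).le

theorem sq_sqrt_form (hv : v ∈ ball (0 : E) R) (x : X) : √(b v x x) ^ 2 = b v x x :=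
  Real.sq_sqrt (k.form_nonneg hv x)

theorem norm_sq_le (hv : v ∈ ball (0 : E) R) (x : X) : ‖x‖ ^ 2 ≤ c ^ 2 * b v x x := by
  have h := pow_le_pow_left₀ (norm_nonneg x) (k.lower v hv x) 2
  rwa [mul_pow, k.sq_sqrt_form hv] at h

theorem abs_form_le_sqrt (hv : v ∈ ball (0 : E) R) (x x' : X) :
    |b v x x'| ≤ √(b v x x) * √(b v x' x') :=
  abs_le_sqrt_mul_sqrt (k.symm v hv) (k.form_nonneg hv) x x'

theorem abs_form_le (hv : v ∈ ball (0 : E) R) (x x' : X) :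
    |b v x x'| ≤ c ^ 2 * ‖x‖ * ‖x'‖ := by
  refine (k.abs_form_le_sqrt hv x x').trans ?_
  calc √(b v x x) * √(b v x' x') ≤ (c * ‖x‖) * (c * ‖x'‖) :=
        mul_le_mul (k.upper v hv x) (k.upper v hv x') (Real.sqrt_nonneg _)
          (mul_nonneg k.c_pos.le (norm_nonneg _))
    _ = _ := by ring

theorem norm_op_sub_le {v' : E} (hv : v ∈ ball (0 : E) R) (hv' : v' ∈ ball (0 : E) R) :
    ‖A v - A v'‖ ≤ C * ‖v - v'‖ :=
  (convex_ball (0 : E) R).norm_image_sub_le_of_norm_fderiv_le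
    (fun _ hx => (k.contDiffOn.differentiableOn one_ne_zero).differentiableAt
      (isOpen_ball.mem_nhds hx)) k.norm_fderiv_le hv' hv

theorem differentiableAt (hv : v ∈ ball (0 : E) R) : DifferentiableAt ℝ A v :=
  (k.contDiffOn.differentiableOn one_ne_zero).differentiableAt (isOpen_ball.mem_nhds hv)

/-- The energy of a path `W` in `X`, measured by the form of a moving parameter `u`. -/
theorem hasDerivWithinAt_energy {u : ℝ → E} {W : ℝ → X} {u' : E} {W' : X} {s : Set ℝ} {t : ℝ}
    (hut : u t ∈ ball (0 : E) R) (hu : HasDerivWithinAt u u' s t)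
    (hW : HasDerivWithinAt W W' s t) :
    HasDerivWithinAt (fun t => b (u t) (W t) (W t))
      (fderiv ℝ b (u t) u' (W t) (W t) + 2 * b (u t) W' (W t)) s t := by
  have hb := (k.differentiableAt_form _ hut).hasFDerivAt.comp_hasDerivWithinAt t hu
  refine ((hb.clm_apply hW).clm_apply hW).congr_deriv ?_
  simp only [add_apply, Function.comp_apply, k.symm _ hut (W t) W']
  ring

theorem abs_fderiv_form_le (hv : v ∈ ball (0 : E) R) {z : E} {U : ℝ} (hz : ‖z‖ ≤ U) (x : X) :
    |fderiv ℝ b v z x x| ≤ K * U * c ^ 2 * b v x x := by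
  have h1 : ‖fderiv ℝ b v z x x‖ ≤ ‖fderiv ℝ b v‖ * ‖z‖ * ‖x‖ * ‖x‖ :=
    (ContinuousLinearMap.le_opNorm₂ _ _ _).trans (by
      gcongr; exact ContinuousLinearMap.le_opNorm _ _)
  have hU : 0 ≤ U := (norm_nonneg _).trans hz
  have hK := k.zero_le_K
  calc |fderiv ℝ b v z x x| ≤ ‖fderiv ℝ b v‖ * ‖z‖ * ‖x‖ * ‖x‖ := h1
    _ ≤ K * U * ‖x‖ * ‖x‖ := by gcongr; exact k.norm_fderiv_form_le v hv
    _ = K * U * ‖x‖ ^ 2 := by ring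
    _ ≤ K * U * (c ^ 2 * b v x x) := by
        gcongr
        exact k.norm_sq_le hv x
    _ = _ := by ring

/-- Energy estimate for a path `W` whose derivative satisfies a one-sided bound in the form of the
moving parameter `u`. The drift of the form costs `K U c² / 2` in the exponential rate. -/
theorem norm_le_of_energy {u u' : ℝ → E} {W W' : ℝ → X} {a e U ω₁ ω' μ g η : ℝ}
    (hu : ∀ t ∈ Icc a e, u t ∈ ball (0 : E) R)
    (hud : ∀ t ∈ Icc a e, HasDerivWithinAt u (u' t) (Icc a e) t)
    (hU : ∀ t ∈ Icc a e, ‖u' t‖ ≤ U)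
    (hWd : ∀ t ∈ Icc a e, HasDerivWithinAt W (W' t) (Icc a e) t)
    (hW' : ∀ t ∈ Icc a e, 2 * b (u t) (W' t) (W t) ≤ 2 * ω₁ * b (u t) (W t) (W t)
      + 2 * √(b (u t) (W t) (W t)) * (g * Real.exp (μ * t)) + η ^ 2 * Real.exp (μ * t) ^ 2)
    (hω : ω₁ + K * U * c ^ 2 / 2 ≤ ω') (hμ : ω' < μ) (hg : 0 ≤ g) (hη : 0 ≤ η) :
    ∀ t ∈ Icc a e, ‖W t‖ ≤ c * (c * ‖W a‖ * Real.exp (ω' * (t - a))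
      + ((g + η) / (μ - ω') + η) * Real.exp (μ * t)) := by
  intro t ht
  have ha : a ∈ Icc a e := left_mem_Icc.2 (ht.1.trans ht.2)
  refine (k.lower _ (hu t ht) _).trans ?_
  refine mul_le_mul_of_nonneg_left ?_ k.c_pos.le
  refine sqrt_le_of_deriv_le (E := fun t => b (u t) (W t) (W t)) (A := c * ‖W a‖)
    (fun t ht => k.hasDerivWithinAt_energy (hu t ht) (hud t ht) (hWd t ht)) (fun s hs => ?_)
    hμ hg hη (mul_nonneg k.c_pos.le (norm_nonneg _)) (k.upper _ (hu a ha) _) t ht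
  have h1 := (abs_le.1 (k.abs_fderiv_form_le (hu s hs) (hU s hs) (W s))).2
  have h2 := hW' s hs
  have h3 := mul_le_mul_of_nonneg_right hω (k.form_nonneg (hu s hs) (W s))
  linarith

/-- Energy estimate for `W' = A(u) y + r` where `y` is close to `W` in `X`. The discrepancy `η`
between `W` and `y` contributes only through `√η`. -/
theorem norm_le_of_hasDerivWithinAt {u u' : ℝ → E} {W r : ℝ → X} {y : ℝ → Y}
    {a e U ω' μ g η N : ℝ}
    (hu : ∀ t ∈ Icc a e, u t ∈ ball (0 : E) R)
    (hud : ∀ t ∈ Icc a e, HasDerivWithinAt u (u' t) (Icc a e) t)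
    (hU : ∀ t ∈ Icc a e, ‖u' t‖ ≤ U)
    (hWd : ∀ t ∈ Icc a e, HasDerivWithinAt W (A (u t) (y t) + r t) (Icc a e) t)
    (hy : ∀ t ∈ Icc a e, ‖y t‖ ≤ N * Real.exp (μ * t))
    (hWy : ∀ t ∈ Icc a e, ‖W t - ι (y t)‖ ≤ η * Real.exp (μ * t))
    (hr : ∀ t ∈ Icc a e, ‖r t‖ ≤ g * Real.exp (μ * t))
    (hω : ω + K * U * c ^ 2 / 2 ≤ ω') (hμ : ω' < μ) (hg : 0 ≤ g) (hη : 0 ≤ η) (hN : 0 ≤ N) :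
    ∀ t ∈ Icc a e, ‖W t‖ ≤ c * (c * ‖W a‖ * Real.exp (ω' * (t - a))
      + ((c * g + √((2 * C + 6 * |ω|) * c ^ 2 * (N + η) * η)) / (μ - ω')
        + √((2 * C + 6 * |ω|) * c ^ 2 * (N + η) * η)) * Real.exp (μ * t)) := by
  have hC := k.C_pos
  have hc := k.c_pos
  refine k.norm_le_of_energy hu hud hU hWd (fun t ht => ?_) hω hμ (by positivity)
    (Real.sqrt_nonneg _)
  have hv := hu t ht
  rw [Real.sq_sqrt (by positivity)]
  set x := Real.exp (μ * t)
  have hx : 0 < x := Real.exp_pos _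
  set β := b (u t)
  set d := W t - ι (y t) with hd
  have hWt : W t = ι (y t) + d := by rw [hd]; abel
  have hιy : ‖ι (y t)‖ ≤ N * x := (k.norm_incl_le _).trans (hy t ht)
  have hdx := hWy t ht
  -- the operator term
  have h1 : β (A (u t) (y t)) (W t) ≤ ω * β (ι (y t)) (ι (y t)) + C * c ^ 2 * N * η * x ^ 2 := by
    have e1 : β (A (u t) (y t)) (W t)
        = β (A (u t) (y t)) (ι (y t)) + β (A (u t) (y t)) d := by
      rw [hWt, map_add]
    have e2 : |β (A (u t) (y t)) d| ≤ C * c ^ 2 * N * η * x ^ 2 := by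
      refine (k.abs_form_le hv _ _).trans ?_
      have : ‖A (u t) (y t)‖ ≤ C * (N * x) :=
        ((A (u t)).le_of_opNorm_le (k.norm_le _ hv) _).trans (by gcongr; exact hy t ht)
      calc c ^ 2 * ‖A (u t) (y t)‖ * ‖d‖ ≤ c ^ 2 * (C * (N * x)) * (η * x) := by gcongr
        _ = _ := by ring
    have e3 := k.dissipative _ hv (y t)
    rw [e1]
    exact add_le_add e3 (le_of_abs_le e2)
  have h2 : ω * β (ι (y t)) (ι (y t)) ≤ ω * β (W t) (W t)
      + |ω| * (c ^ 2 * (3 * (N + η)) * η * x ^ 2) := by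
    have e1 : β (ι (y t)) (ι (y t)) - β (W t) (W t) = -(2 * β (ι (y t)) d + β d d) := by
      rw [hWt]
      simp only [map_add, add_apply, k.symm _ hv d (ι (y t)), β]
      ring
    have e2 : |β (ι (y t)) (ι (y t)) - β (W t) (W t)| ≤ c ^ 2 * (3 * (N + η)) * η * x ^ 2 := by
      rw [e1, abs_neg]
      have i1 : |β (ι (y t)) d| ≤ c ^ 2 * (N * x) * (η * x) :=
        (k.abs_form_le hv _ _).trans (by gcongr)
      have i2 : |β d d| ≤ c ^ 2 * (η * x) * (η * x) :=
        (k.abs_form_le hv _ _).trans (by gcongr)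
      calc |2 * β (ι (y t)) d + β d d| ≤ 2 * |β (ι (y t)) d| + |β d d| := by
            refine (abs_add_le _ _).trans ?_
            rw [abs_mul, abs_two]
        _ ≤ 2 * (c ^ 2 * (N * x) * (η * x)) + c ^ 2 * (η * x) * (η * x) := by gcongr
        _ ≤ _ := by
          have : 0 ≤ c ^ 2 * (N * x) * (η * x) := by positivity
          have : 0 ≤ c ^ 2 * (η * x) * (η * x) := by positivity
          nlinarith
    have e3 : ω * (β (ι (y t)) (ι (y t)) - β (W t) (W t))
        ≤ |ω| * (c ^ 2 * (3 * (N + η)) * η * x ^ 2) := by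
      refine (le_abs_self _).trans ?_
      rw [abs_mul]
      gcongr
    linarith
  have h3 : β (r t) (W t) ≤ √(β (W t) (W t)) * (c * g * x) := by
    refine (le_abs_self _).trans ((k.abs_form_le_sqrt hv _ _).trans ?_)
    rw [mul_comm]
    gcongr
    exact (k.upper _ hv _).trans (by rw [mul_assoc]; gcongr; exact hr t ht)
  have h4 : 0 ≤ C * c ^ 2 * η * η * x ^ 2 := by positivity
  rw [map_add, add_apply]
  nlinarith

end KatoFamily

end Family

/-! ### Resolvents and the Yosida approximation -/

section Resolvent

variable {E X Y : Type*} [NormedAddCommGroup E] [NormedSpace ℝ E]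
  [NormedAddCommGroup X] [NormedSpace ℝ X] [NormedAddCommGroup Y] [NormedSpace ℝ Y]

/-- The resolvent `(1 - h A)⁻¹ : X → Y` of an operator `A` with domain `Y ⊆ X`, the inclusion
being `ι`; it is `0` if `1 - h A` is not invertible. -/
noncomputable def resolvent (ι : Y →L[ℝ] X) (h : ℝ) (A : Y →L[ℝ] X) : X →L[ℝ] Y :=
  (ι - h • A).inverse

theorem one_sub_mul_pos {h ω : ℝ} (hh : 0 < h) (hω : h * |ω| ≤ 1 / 2) : 0 < 1 - h * ω := by
  have : h * ω ≤ 1 / 2 := (mul_le_mul_of_nonneg_left (le_abs_self ω) hh.le).trans hω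
  linarith

namespace KatoFamily

variable {ι : Y →L[ℝ] X} {R ω c C K : ℝ} {b : E → X →L[ℝ] X →L[ℝ] ℝ} {A : E → Y →L[ℝ] X}
  (k : KatoFamily ι R ω c C K b A) {v : E} {h : ℝ}

include k

/-- Quasi-dissipativity as a lower bound for `α - β A`, which makes the resolvents contractive up to
the shift by `ω`. -/
theorem mul_sqrt_form_le (hv : v ∈ ball (0 : E) R) {α β : ℝ} (hβ : 0 ≤ β) (y : Y) :
    (α - β * ω) * √(b v (ι y) (ι y)) ≤ √(b v (α • ι y - β • A v y) (α • ι y - β • A v y)) := by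
  set x := α • ι y - β • A v y with hx
  have h1 : b v x (ι y) ≤ √(b v x x) * √(b v (ι y) (ι y)) :=
    (le_abs_self _).trans (k.abs_form_le_sqrt hv _ _)
  have h2 : b v x (ι y) = α * b v (ι y) (ι y) - β * b v (A v y) (ι y) := by
    simp [hx]
  have h3 := mul_le_mul_of_nonneg_left (k.dissipative v hv y) hβ
  rcases (Real.sqrt_nonneg (b v (ι y) (ι y))).eq_or_lt with h0 | h0
  · rw [← h0, mul_zero]; exact Real.sqrt_nonneg _
  · refine le_of_mul_le_mul_right ?_ h0
    calc (α - β * ω) * √(b v (ι y) (ι y)) * √(b v (ι y) (ι y))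
        = α * b v (ι y) (ι y) - β * (ω * b v (ι y) (ι y)) := by
          rw [mul_assoc, Real.mul_self_sqrt (k.form_nonneg hv _)]; ring
      _ ≤ b v x (ι y) := by rw [h2]; linarith
      _ ≤ _ := h1

/-- Every `μ ≥ ω + 1` is in the resolvent set of `A v`: start from the isomorphism `A v - (ω + 1)`
and continue by Neumann series, whose radius is controlled by `mul_sqrt_form_le`. -/
theorem isInvertible_smul_sub [CompleteSpace X] (hv : v ∈ ball (0 : E) R) {μ : ℝ}
    (hμ : 1 ≤ μ - ω) : (μ • ι - A v).IsInvertible := by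
  have hc := k.c_pos
  set ρ : ℝ := 1 + 1 / (2 * c ^ 2) with hρ
  have hρ1 : 1 < ρ := by rw [hρ]; have : 0 < 1 / (2 * c ^ 2) := by positivity
                         linarith
  -- the resolvent set extends from `μ₁` to a ball of radius proportional to `μ₁ - ω`
  have main : ∀ n : ℕ, ∀ μ : ℝ, 1 ≤ μ - ω → μ - ω ≤ ρ ^ n → (μ • ι - A v).IsInvertible := by
    intro n
    induction n with
    | zero =>
      intro μ h1 h2
      have hμ' : μ = ω + 1 := by rw [pow_zero] at h2; linarith
      obtain ⟨M, hM⟩ := k.shift_invertible v hv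
      refine ⟨M.trans (ContinuousLinearEquiv.neg ℝ), ?_⟩
      ext y
      have : A v y - (ω + 1) • ι y = M y := by
        simpa using (DFunLike.congr_fun hM y).symm
      simp [hμ', ← this]
    | succ n ih =>
      intro μ h1 h2
      set μ₁ := ω + max 1 ((μ - ω) / ρ) with hμ₁
      have hm1 : 1 ≤ μ₁ - ω := by rw [hμ₁]; simp
      have hm2 : μ₁ - ω ≤ ρ ^ n := by
        rw [hμ₁, add_sub_cancel_left]
        refine max_le (one_le_pow₀ hρ1.le) ?_
        rw [div_le_iff₀ (by linarith), ← pow_succ]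
        exact h2
      have hm3 : μ₁ ≤ μ := by
        have : max 1 ((μ - ω) / ρ) ≤ μ - ω :=
          max_le h1 (div_le_self (by linarith) hρ1.le)
        linarith
      have hm4 : μ - ω ≤ (μ₁ - ω) * ρ := by
        rw [← div_le_iff₀ (by linarith), hμ₁, add_sub_cancel_left]
        exact le_max_right _ _
      obtain ⟨M, hM⟩ := ih μ₁ hm1 hm2
      have hMy : ∀ y, M y = μ₁ • ι y - A v y := fun y => by
        simpa using DFunLike.congr_fun hM y
      set S : X →L[ℝ] X := (μ₁ - μ) • (ι ∘L (M.symm : X →L[ℝ] Y)) with hS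
      have hSn : ‖S‖ ≤ 1 / 2 := by
        refine ContinuousLinearMap.opNorm_le_bound _ (by norm_num) fun x => ?_
        set y := M.symm x with hy
        have hxy : x = μ₁ • ι y - A v y := by rw [← hMy, hy, M.apply_symm_apply]
        have e1 := k.mul_sqrt_form_le hv (α := μ₁) (β := 1) zero_le_one y
        rw [one_mul, one_smul, ← hxy] at e1
        have e2 := k.upper v hv x
        have e3 := k.lower v hv (ι y)
        have e4 : (μ₁ - ω) * ‖ι y‖ ≤ c ^ 2 * ‖x‖ := by
          calc (μ₁ - ω) * ‖ι y‖ ≤ (μ₁ - ω) * (c * √(b v (ι y) (ι y))) := by gcongr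
            _ = c * ((μ₁ - ω) * √(b v (ι y) (ι y))) := by ring
            _ ≤ c * (c * ‖x‖) := mul_le_mul_of_nonneg_left (e1.trans e2) hc.le
            _ = _ := by ring
        have e5 : μ - μ₁ ≤ (μ₁ - ω) * (1 / (2 * c ^ 2)) := by
          rw [hρ] at hm4; linarith
        have e6 : S x = (μ₁ - μ) • ι y := by simp [hS, hy]
        rw [e6, norm_smul, Real.norm_eq_abs, abs_of_nonpos (by linarith)]
        calc -(μ₁ - μ) * ‖ι y‖ ≤ ((μ₁ - ω) * (1 / (2 * c ^ 2))) * ‖ι y‖ := by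
              gcongr; linarith
          _ = 1 / (2 * c ^ 2) * ((μ₁ - ω) * ‖ι y‖) := by ring
          _ ≤ 1 / (2 * c ^ 2) * (c ^ 2 * ‖x‖) := by gcongr
          _ = _ := by field_simp
      have hunit : IsUnit (1 - S) := isUnit_one_sub_of_norm_lt_one (hSn.trans_lt (by norm_num))
      obtain ⟨N, hN⟩ := hunit
      refine ⟨M.trans (ContinuousLinearEquiv.unitsEquiv ℝ X N), ?_⟩
      ext y
      have hNx : ∀ x, (ContinuousLinearEquiv.unitsEquiv ℝ X N) x = x - S x := fun x => by
        rw [ContinuousLinearEquiv.unitsEquiv_apply, hN]; simp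
      have hSM : S (M y) = (μ₁ - μ) • ι y := by simp [hS]
      simp only [ContinuousLinearEquiv.coe_coe, ContinuousLinearEquiv.trans_apply, hNx, hSM]
      rw [hMy, sub_apply, smul_apply, sub_smul]
      abel
  obtain ⟨n, hn⟩ := pow_unbounded_of_one_lt (μ - ω) hρ1
  exact main n μ hμ hn.le

variable [CompleteSpace X]

theorem isInvertible_sub_smul (hv : v ∈ ball (0 : E) R) (hh : 0 < h) (hω : h * |ω| ≤ 1 / 2)
    (hh' : h ≤ 1 / 2) : (ι - h • A v).IsInvertible := by
  have h1 : 1 ≤ h⁻¹ - ω := by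
    have h2 : h * ω ≤ 1 / 2 := (mul_le_mul_of_nonneg_left (le_abs_self ω) hh.le).trans hω
    rw [le_sub_iff_add_le, ← one_div, le_div_iff₀ hh]
    linarith
  obtain ⟨M, hM⟩ := k.isInvertible_smul_sub hv h1
  refine ⟨M.trans (ContinuousLinearEquiv.smulLeft (Units.mk0 h hh.ne')), ?_⟩
  ext y
  have := DFunLike.congr_fun hM y
  simp only [ContinuousLinearEquiv.coe_coe] at this
  simp [this, smul_sub, smul_smul, hh.ne', Units.smul_def]

section Step

variable (hv : v ∈ ball (0 : E) R) (hh : 0 < h) (hω : h * |ω| ≤ 1 / 2) (hh' : h ≤ 1 / 2)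

include hv hh hω hh'

theorem resolvent_left (y : Y) : resolvent ι h (A v) (ι y - h • A v y) = y := by
  obtain ⟨M, hM⟩ := k.isInvertible_sub_smul hv hh hω hh'
  have : ι y - h • A v y = M y := by simpa using (DFunLike.congr_fun hM y).symm
  rw [resolvent, ← hM, this, ContinuousLinearMap.inverse_equiv]
  simp

theorem resolvent_right (x : X) :
    ι (resolvent ι h (A v) x) - h • A v (resolvent ι h (A v) x) = x := by
  obtain ⟨M, hM⟩ := k.isInvertible_sub_smul hv hh hω hh'
  have (y : Y) : ι y - h • A v y = M y := by simpa using (DFunLike.congr_fun hM y).symm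
  rw [this, resolvent, ← hM, ContinuousLinearMap.inverse_equiv]
  simp

theorem smul_op_resolvent (x : X) :
    h • A v (resolvent ι h (A v) x) = ι (resolvent ι h (A v) x) - x :=
  (sub_eq_iff_eq_add'.1 (k.resolvent_right hv hh hω hh' x) ▸ by abel)

theorem op_resolvent (x : X) :
    A v (resolvent ι h (A v) x) = h⁻¹ • (ι (resolvent ι h (A v) x) - x) := by
  rw [← k.smul_op_resolvent hv hh hω hh', smul_smul, inv_mul_cancel₀ hh.ne', one_smul]

theorem resolvent_op (y : Y) :
    resolvent ι h (A v) (A v y) = h⁻¹ • (resolvent ι h (A v) (ι y) - y) := by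
  have := k.resolvent_left hv hh hω hh' y
  rw [map_sub, map_smul, sub_eq_iff_eq_add] at this
  rw [this, add_sub_cancel_left, smul_smul, inv_mul_cancel₀ hh.ne', one_smul]

/-- The resolvent commutes with `A - (ω + 1)`. -/
theorem shift_resolvent (y : Y) :
    (A v - (ω + 1) • ι) (resolvent ι h (A v) (ι y))
      = ι (resolvent ι h (A v) ((A v - (ω + 1) • ι) y)) := by
  simp only [sub_apply, smul_apply, map_sub, map_smul, k.resolvent_op hv hh hω hh',
    k.op_resolvent hv hh hω hh']

theorem sqrt_form_resolvent_le (x : X) :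
    √(b v (ι (resolvent ι h (A v) x)) (ι (resolvent ι h (A v) x)))
      ≤ (1 - h * ω)⁻¹ * √(b v x x) := by
  have h1 := k.mul_sqrt_form_le hv (α := 1) hh.le (resolvent ι h (A v) x)
  rw [one_smul, k.resolvent_right hv hh hω hh'] at h1
  rwa [inv_mul_eq_div, le_div_iff₀ (one_sub_mul_pos hh hω), mul_comm]

theorem norm_incl_resolvent_le (x : X) : ‖ι (resolvent ι h (A v) x)‖ ≤ 2 * c ^ 2 * ‖x‖ := by
  have hc := k.c_pos
  have h1 : h * ω ≤ 1 / 2 := (mul_le_mul_of_nonneg_left (le_abs_self ω) hh.le).trans hω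
  have h2 : (1 - h * ω)⁻¹ ≤ 2 := by
    rw [inv_le_comm₀ (by linarith) two_pos]; linarith
  calc ‖ι (resolvent ι h (A v) x)‖
      ≤ c * ((1 - h * ω)⁻¹ * √(b v x x)) := (k.lower v hv _).trans (by
        gcongr; exact k.sqrt_form_resolvent_le hv hh hω hh' x)
    _ ≤ c * (2 * (c * ‖x‖)) := by
        gcongr
        exact k.upper v hv x
    _ = _ := by ring

end Step

omit [CompleteSpace X] in
/-- The norm of `Y` is controlled by that of `(A v - (ω + 1)) y` in `X`; estimates in `Y` are
obtained as estimates of this element of `X`. -/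
theorem norm_le_norm_shift (hv : v ∈ ball (0 : E) R) (y : Y) :
    ‖y‖ ≤ C * ‖(A v - (ω + 1) • ι) y‖ := by
  have h1 := (A v - (ω + 1) • ι).inverse.le_of_opNorm_le (k.norm_shift_inverse_le v hv)
    ((A v - (ω + 1) • ι) y)
  obtain ⟨M, hM⟩ := k.shift_invertible v hv
  rw [← hM, ContinuousLinearMap.inverse_equiv] at h1
  rw [← hM]
  simpa using h1

section Step

variable (hv : v ∈ ball (0 : E) R) (hh : 0 < h) (hω : h * |ω| ≤ 1 / 2) (hh' : h ≤ 1 / 2)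

include hv hh hω hh'

theorem norm_resolvent_incl_le (y : Y) :
    ‖resolvent ι h (A v) (ι y)‖ ≤ 2 * c ^ 2 * C ^ 2 * ‖y‖ := by
  have hC := k.C_pos
  refine (k.norm_le_norm_shift hv _).trans ?_
  rw [k.shift_resolvent hv hh hω hh']
  calc C * ‖ι (resolvent ι h (A v) ((A v - (ω + 1) • ι) y))‖
      ≤ C * (2 * c ^ 2 * (C * ‖y‖)) := by
        refine mul_le_mul_of_nonneg_left ?_ hC.le
        refine (k.norm_incl_resolvent_le hv hh hω hh' _).trans ?_
        gcongr
        exact (A v - (ω + 1) • ι).le_of_opNorm_le (k.norm_shift_le v hv) y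
    _ = _ := by ring

theorem norm_resolvent_le (x : X) :
    ‖resolvent ι h (A v) x‖ ≤ C * (h⁻¹ * (2 * c ^ 2 + 1) + |ω + 1| * (2 * c ^ 2)) * ‖x‖ := by
  have hC := k.C_pos
  refine (k.norm_le_norm_shift hv _).trans ?_
  rw [mul_assoc]
  refine mul_le_mul_of_nonneg_left ?_ hC.le
  have h1 := k.norm_incl_resolvent_le hv hh hω hh' x
  rw [sub_apply, smul_apply, k.op_resolvent hv hh hω hh']
  calc ‖h⁻¹ • (ι (resolvent ι h (A v) x) - x) - (ω + 1) • ι (resolvent ι h (A v) x)‖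
      ≤ h⁻¹ * (2 * c ^ 2 * ‖x‖ + ‖x‖) + |ω + 1| * (2 * c ^ 2 * ‖x‖) := by
        refine (norm_sub_le _ _).trans (add_le_add ?_ ?_)
        · rw [norm_smul, Real.norm_eq_abs, abs_of_pos (inv_pos.2 hh)]
          gcongr
          exact (norm_sub_le _ _).trans (by gcongr)
        · rw [norm_smul, Real.norm_eq_abs]
          gcongr
    _ = _ := by ring

/-- On `Y` the resolvents approximate the identity to first order in the norm of `X`. -/
theorem norm_incl_resolvent_incl_sub_le (y : Y) :
    ‖ι y - ι (resolvent ι h (A v) (ι y))‖ ≤ h * (2 * c ^ 2 * C ^ 3 * ‖y‖) := by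
  have hC := k.C_pos
  have h1 := k.smul_op_resolvent hv hh hω hh' (ι y)
  rw [norm_sub_rev, ← h1, norm_smul, Real.norm_eq_abs, abs_of_pos hh]
  gcongr
  calc ‖A v (resolvent ι h (A v) (ι y))‖ ≤ C * (2 * c ^ 2 * C ^ 2 * ‖y‖) :=
        ((A v).le_of_opNorm_le (k.norm_le v hv) _).trans (by
          gcongr; exact k.norm_resolvent_incl_le hv hh hω hh' y)
    _ = _ := by ring

end Step

/-- Strong convergence of the resolvents to the identity on all of `X`, without a rate: `Y` is dense
and the resolvents are uniformly bounded. -/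
theorem tendsto_incl_resolvent (hdense : DenseRange ι) (hv : v ∈ ball (0 : E) R) (x : X) :
    Tendsto (fun h => ι (resolvent ι h (A v) x)) (𝓝[>] 0) (𝓝 x) := by
  have hc := k.c_pos
  have hsmall : ∀ᶠ h in 𝓝[>] (0 : ℝ), 0 < h ∧ h * |ω| ≤ 1 / 2 ∧ h ≤ 1 / 2 := by
    have h1 : ∀ᶠ h in 𝓝 (0 : ℝ), h * |ω| < 1 / 2 ∧ h < 1 / 2 := by
      refine Filter.Eventually.and ?_ (Iio_mem_nhds (by norm_num))
      have : Tendsto (fun h : ℝ => h * |ω|) (𝓝 0) (𝓝 (0 * |ω|)) := by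
        exact (continuous_id.mul continuous_const).tendsto 0
      exact this.eventually_lt_const (by norm_num)
    filter_upwards [self_mem_nhdsWithin, mem_nhdsWithin_of_mem_nhds h1] with h h2 h3
    exact ⟨h2, h3.1.le, h3.2.le⟩
  rw [Metric.tendsto_nhds]
  intro e he
  obtain ⟨y, hy⟩ := hdense.exists_dist_lt x (ε := e / (2 * (2 * c ^ 2 + 1))) (by positivity)
  have h0 : Tendsto (fun h : ℝ => h * (2 * c ^ 2 * C ^ 3 * ‖y‖)) (𝓝[>] 0) (𝓝 0) := by
    have : Tendsto (fun h : ℝ => h * (2 * c ^ 2 * C ^ 3 * ‖y‖)) (𝓝 0)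
        (𝓝 (0 * (2 * c ^ 2 * C ^ 3 * ‖y‖))) := (continuous_id.mul continuous_const).tendsto 0
    rw [zero_mul] at this
    exact this.mono_left nhdsWithin_le_nhds
  filter_upwards [hsmall, h0.eventually_lt_const (half_pos he)] with h hs h1
  obtain ⟨hh, hω, hh'⟩ := hs
  rw [dist_eq_norm] at hy ⊢
  have e1 : ι (resolvent ι h (A v) x) - x = ι (resolvent ι h (A v) (x - ι y))
      - (ι y - ι (resolvent ι h (A v) (ι y))) - (x - ι y) := by
    simp only [map_sub]; abel
  rw [e1]
  calc _ ≤ 2 * c ^ 2 * ‖x - ι y‖ + h * (2 * c ^ 2 * C ^ 3 * ‖y‖) + ‖x - ι y‖ := by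
        refine (norm_sub_le _ _).trans (add_le_add_left ((norm_sub_le _ _).trans
          (add_le_add ?_ ?_)) _)
        · exact k.norm_incl_resolvent_le hv hh hω hh' _
        · exact k.norm_incl_resolvent_incl_sub_le hv hh hω hh' y
    _ = (2 * c ^ 2 + 1) * ‖x - ι y‖ + h * (2 * c ^ 2 * C ^ 3 * ‖y‖) := by ring
    _ < (2 * c ^ 2 + 1) * (e / (2 * (2 * c ^ 2 + 1))) + e / 2 := by gcongr
    _ = e := by field_simp; ring

theorem contDiffOn_resolvent [CompleteSpace Y] (hh : 0 < h) (hω : h * |ω| ≤ 1 / 2)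
    (hh' : h ≤ 1 / 2) : ContDiffOn ℝ 1 (fun v => resolvent ι h (A v)) (ball 0 R) := by
  intro v hv
  have h1 : ContDiffAt ℝ 1 ContinuousLinearMap.inverse (ι - h • A v) :=
    (k.isInvertible_sub_smul hv hh hω hh').contDiffAt_map_inverse
  exact h1.comp_contDiffWithinAt v
    (contDiffWithinAt_const.sub ((k.contDiffOn v hv).const_smul h))

/-- Existence for the Yosida approximation `w' = A (1 - h A)⁻¹ w + r`, an equation in `Y` with
bounded operators. -/
theorem exists_yosida [CompleteSpace Y] (hh : 0 < h) (hω : h * |ω| ≤ 1 / 2)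
    (hh' : h ≤ 1 / 2) {u : ℝ → E} {r : ℝ → Y} {a e : ℝ} (hae : a ≤ e)
    (hu : ∀ t ∈ Icc a e, u t ∈ ball (0 : E) R) (huc : ContinuousOn u (Icc a e))
    (hr : ContinuousOn r (Icc a e)) (w₀ : Y) :
    ∃ w : ℝ → Y, w a = w₀ ∧ ∀ t ∈ Icc a e, HasDerivWithinAt w
      (h⁻¹ • (resolvent ι h (A (u t)) (ι (w t)) - w t) + r t) (Icc a e) t := by
  have hJ : ContinuousOn (fun t => resolvent ι h (A (u t))) (Icc a e) :=
    (k.contDiffOn_resolvent hh hω hh').continuousOn.comp huc hu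
  have hB : ContinuousOn (fun t => h⁻¹ • (resolvent ι h (A (u t)) ∘L ι
      - ContinuousLinearMap.id ℝ Y)) (Icc a e) :=
    ((hJ.clm_comp (continuousOn_const (c := ι))).sub
      (continuousOn_const (c := ContinuousLinearMap.id ℝ Y))).const_smul h⁻¹
  obtain ⟨w, hw, hw'⟩ := exists_linear_ode hae hB hr w₀
  exact ⟨w, hw, fun t ht => by simpa using hw' t ht⟩

/-- A priori bound in `Y` for the Yosida approximation: the energy of `(A(u) - (ω + 1)) w`. -/
theorem norm_le_of_yosida (hh : 0 < h) (hω : h * |ω| ≤ 1 / 2)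
    (hh' : h ≤ 1 / 2) {u u' : ℝ → E} {w r : ℝ → Y} {a e U ω' μ g : ℝ}
    (hu : ∀ t ∈ Icc a e, u t ∈ ball (0 : E) R)
    (hud : ∀ t ∈ Icc a e, HasDerivWithinAt u (u' t) (Icc a e) t)
    (hU : ∀ t ∈ Icc a e, ‖u' t‖ ≤ U)
    (hwd : ∀ t ∈ Icc a e, HasDerivWithinAt w
      (h⁻¹ • (resolvent ι h (A (u t)) (ι (w t)) - w t) + r t) (Icc a e) t)
    (hr : ∀ t ∈ Icc a e, ‖r t‖ ≤ g * Real.exp (μ * t))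
    (hω' : ω + 2 * h * ω ^ 2 + c ^ 4 * C ^ 2 * U + K * U * c ^ 2 / 2 ≤ ω') (hμ : ω' < μ)
    (hg : 0 ≤ g) :
    ∀ t ∈ Icc a e, ‖w t‖ ≤ (c * C) ^ 2 * (‖w a‖ * Real.exp (ω' * (t - a))
      + g / (μ - ω') * Real.exp (μ * t)) := by
  intro t ht
  have hc := k.c_pos
  have hC := k.C_pos
  have ha : a ∈ Icc a e := left_mem_Icc.2 (ht.1.trans ht.2)
  have hU0 : 0 ≤ U := (norm_nonneg _).trans (hU a ha)
  set W : ℝ → X := fun t => (A (u t) - (ω + 1) • ι) (w t) with hW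
  have hWd : ∀ s ∈ Icc a e, HasDerivWithinAt W
      (fderiv ℝ A (u s) (u' s) (w s) + (h⁻¹ • (ι (resolvent ι h (A (u s)) (W s)) - W s)
        + (A (u s) - (ω + 1) • ι) (r s))) (Icc a e) s := by
    intro s hs
    have h1 := ((k.differentiableAt (hu s hs)).hasFDerivAt.comp_hasDerivWithinAt s
      (hud s hs)).sub_const ((ω + 1) • ι)
    refine (h1.clm_apply (hwd s hs)).congr_deriv ?_
    simp only [Function.comp_apply, map_add, map_smul, map_sub, hW,
      k.shift_resolvent (hu s hs) hh hω hh']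
  have hmain := k.norm_le_of_energy (ω₁ := ω + 2 * h * ω ^ 2 + c ^ 4 * C ^ 2 * U) (η := 0)
    (g := c * C * g) hu hud hU hWd (fun s hs => ?_) hω' hμ (by positivity) le_rfl t ht
  · refine (k.norm_le_norm_shift (hu t ht) (w t)).trans ?_
    have hWa : ‖W a‖ ≤ C * ‖w a‖ :=
      (A (u a) - (ω + 1) • ι).le_of_opNorm_le (k.norm_shift_le _ (hu a ha)) _
    calc C * ‖W t‖ ≤ C * (c * (c * (C * ‖w a‖) * Real.exp (ω' * (t - a))
        + ((c * C * g + 0) / (μ - ω') + 0) * Real.exp (μ * t))) := by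
          refine mul_le_mul_of_nonneg_left (hmain.trans ?_) hC.le
          gcongr
      _ = _ := by ring
  · have hv := hu s hs
    have hE := k.form_nonneg hv (W s)
    have h1 : b (u s) (ι (resolvent ι h (A (u s)) (W s))) (W s)
        ≤ (1 - h * ω)⁻¹ * b (u s) (W s) (W s) := by
      refine (le_abs_self _).trans ((k.abs_form_le_sqrt hv _ _).trans ?_)
      calc _ ≤ (1 - h * ω)⁻¹ * √(b (u s) (W s) (W s)) * √(b (u s) (W s) (W s)) := by
            gcongr; exact k.sqrt_form_resolvent_le hv hh hω hh' _
        _ = _ := by rw [mul_assoc, Real.mul_self_sqrt hE]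
    have h2 : h⁻¹ * ((1 - h * ω)⁻¹ - 1) ≤ ω + 2 * h * ω ^ 2 := by
      have hp := one_sub_mul_pos hh hω
      have hq : 1 / 2 ≤ 1 - h * ω := by
        have : h * ω ≤ 1 / 2 := (mul_le_mul_of_nonneg_left (le_abs_self ω) hh.le).trans hω
        linarith
      have e1 : h⁻¹ * ((1 - h * ω)⁻¹ - 1) = ω / (1 - h * ω) := by
        field_simp
        ring
      rw [e1, div_le_iff₀ hp]
      have e2 : 0 ≤ h * ω ^ 2 := by positivity
      nlinarith
    have h3 : b (u s) (h⁻¹ • (ι (resolvent ι h (A (u s)) (W s)) - W s)) (W s)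
        ≤ (ω + 2 * h * ω ^ 2) * b (u s) (W s) (W s) := by
      rw [map_smul, map_sub, smul_apply, sub_apply, smul_eq_mul]
      calc _ ≤ h⁻¹ * ((1 - h * ω)⁻¹ * b (u s) (W s) (W s) - b (u s) (W s) (W s)) := by gcongr
        _ = h⁻¹ * ((1 - h * ω)⁻¹ - 1) * b (u s) (W s) (W s) := by ring
        _ ≤ _ := by gcongr
    have h4 : b (u s) (fderiv ℝ A (u s) (u' s) (w s)) (W s)
        ≤ c ^ 4 * C ^ 2 * U * b (u s) (W s) (W s) := by
      refine (le_abs_self _).trans ((k.abs_form_le hv _ _).trans ?_)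
      have e1 : ‖fderiv ℝ A (u s) (u' s) (w s)‖ ≤ C * U * (C * ‖W s‖) := by
        refine (ContinuousLinearMap.le_opNorm _ _).trans ?_
        gcongr
        · exact (ContinuousLinearMap.le_of_opNorm_le _ (k.norm_fderiv_le _ hv) _).trans
            (by gcongr; exact hU s hs)
        · exact k.norm_le_norm_shift hv (w s)
      calc c ^ 2 * ‖fderiv ℝ A (u s) (u' s) (w s)‖ * ‖W s‖
          ≤ c ^ 2 * (C * U * (C * ‖W s‖)) * ‖W s‖ := by gcongr
        _ = c ^ 2 * C ^ 2 * U * ‖W s‖ ^ 2 := by ring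
        _ ≤ c ^ 2 * C ^ 2 * U * (c ^ 2 * b (u s) (W s) (W s)) := by
            gcongr; exact k.norm_sq_le hv _
        _ = _ := by ring
    have h5 : b (u s) ((A (u s) - (ω + 1) • ι) (r s)) (W s)
        ≤ √(b (u s) (W s) (W s)) * (c * C * g * Real.exp (μ * s)) := by
      refine (le_abs_self _).trans ((k.abs_form_le_sqrt hv _ _).trans ?_)
      rw [mul_comm]
      gcongr
      refine (k.upper _ hv _).trans ?_
      calc c * ‖(A (u s) - (ω + 1) • ι) (r s)‖ ≤ c * (C * (g * Real.exp (μ * s))) := by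
            gcongr
            exact (ContinuousLinearMap.le_of_opNorm_le _ (k.norm_shift_le _ hv) _).trans
              (by gcongr; exact hr s hs)
        _ = _ := by ring
    rw [map_add, map_add, add_apply, add_apply]
    nlinarith

end KatoFamily

end Resolvent

/-! ### Continuity in the smaller space -/

/-- Gronwall's inequality for an absolutely continuous function, with an integrable forcing. -/
theorem le_of_ae_hasDerivAt_le {e G : ℝ → ℝ} {a a' κ : ℝ}
    (he : AbsolutelyContinuousOnInterval e a a') (hκ : 0 ≤ κ) (he0 : 0 ≤ e a)
    (hd : ∀ᵐ t, t ∈ Ioo a a' → ∃ d, HasDerivAt e d t ∧ d ≤ κ * e t + G t)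
    (hG0 : ∀ t, 0 ≤ G t) (hG : IntervalIntegrable G volume a a') :
    ∀ t ∈ Icc a a', e t ≤ Real.exp (κ * (a' - a)) * (e a + ∫ s in a..a', G s) := by
  intro t ht
  have hsub : uIcc a t ⊆ uIcc a a' := by
    rw [uIcc_of_le ht.1, uIcc_of_le (ht.1.trans ht.2)]; exact Icc_subset_Icc le_rfl ht.2
  set x : ℝ → ℝ := fun t => Real.exp (-κ * (t - a)) with hx
  have hxd : ∀ t, HasDerivAt x (Real.exp (-κ * (t - a)) * (-κ * 1)) t := fun t =>
    (((hasDerivAt_id t).sub_const a).const_mul (-κ)).exp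
  have hxac : AbsolutelyContinuousOnInterval x a t :=
    ContDiffOn.absolutelyContinuousOnInterval (by fun_prop)
  have hac : AbsolutelyContinuousOnInterval (x * e) a t := hxac.mul (he.mono hsub)
  have hint := hac.integral_deriv_eq_sub
  have hGt : IntervalIntegrable G volume a t := hG.mono_set hsub
  have hne : ∀ᵐ s : ℝ, s ≠ t := by simp [ae_iff, measure_singleton]
  have hne' : ∀ᵐ s : ℝ, s ≠ a := by simp [ae_iff, measure_singleton]
  have hle : ∫ s in a..t, deriv (x * e) s ≤ ∫ s in a..t, G s := by
    refine intervalIntegral.integral_mono_ae_restrict ht.1 hac.intervalIntegrable_deriv hGt ?_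
    rw [EventuallyLE, ae_restrict_iff' measurableSet_Icc]
    filter_upwards [hd, hne, hne'] with s hs h1 h2 hst
    obtain ⟨d, hd1, hd2⟩ := hs ⟨lt_of_le_of_ne hst.1 h2.symm,
      (lt_of_le_of_ne hst.2 h1).trans_le ht.2⟩
    rw [((hxd s).mul hd1).deriv]
    have hx0 : 0 < Real.exp (-κ * (s - a)) := Real.exp_pos _
    have hx1 : Real.exp (-κ * (s - a)) ≤ 1 := by
      rw [Real.exp_le_one_iff]; nlinarith [hst.1]
    have := hG0 s
    have e1 : Real.exp (-κ * (s - a)) * (-κ * 1) * e s + x s * d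
        = Real.exp (-κ * (s - a)) * (d - κ * e s) := by simp only [hx]; ring
    rw [e1]
    calc _ ≤ Real.exp (-κ * (s - a)) * G s := by gcongr; linarith
      _ ≤ 1 * G s := by gcongr
      _ = G s := one_mul _
  have hmono : ∫ s in a..t, G s ≤ ∫ s in a..a', G s :=
    intervalIntegral.integral_mono_interval le_rfl ht.1 ht.2
      (Eventually.of_forall hG0) hG
  have hxa : x a = 1 := by simp [hx]
  have hfin : x t * e t ≤ e a + ∫ s in a..a', G s := by
    have : x t * e t - x a * e a ≤ ∫ s in a..a', G s := by
      rw [hint] at hle; exact hle.trans hmono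
    rw [hxa] at this; linarith
  have hnn : 0 ≤ e a + ∫ s in a..a', G s :=
    add_nonneg he0 (intervalIntegral.integral_nonneg (ht.1.trans ht.2) fun s _ => hG0 s)
  have e2 : e t = Real.exp (κ * (t - a)) * (x t * e t) := by
    rw [hx, ← mul_assoc, ← Real.exp_add]; simp
  rw [e2]
  calc _ ≤ Real.exp (κ * (t - a)) * (e a + ∫ s in a..a', G s) := by gcongr
    _ ≤ _ := by gcongr; exact ht.2

section Mollifier

variable {E X Y : Type*} [NormedAddCommGroup E] [NormedSpace ℝ E]
  [NormedAddCommGroup X] [NormedSpace ℝ X] [NormedAddCommGroup Y] [NormedSpace ℝ Y]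

namespace KatoFamily

variable {ι : Y →L[ℝ] X} {R ω c C K : ℝ} {b : E → X →L[ℝ] X →L[ℝ] ℝ} {A : E → Y →L[ℝ] X}
  (k : KatoFamily ι R ω c C K b A) {v : E} {h : ℝ}

include k

variable [CompleteSpace X]

/-- The commutator identity behind the mollification: with `p = (1 - h A)⁻¹ y` and
`P = (1 - h A)⁻¹ (A - (ω + 1)) y`, the time derivative of `P` is `A P` up to terms that stay
bounded as `h → 0`. Here `D` is the time derivative of `A`. -/
theorem shift_resolvent_commutator (hv : v ∈ ball (0 : E) R) (hh : 0 < h)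
    (hω : h * |ω| ≤ 1 / 2) (hh' : h ≤ 1 / 2) (y φ p : Y) (D : Y →L[ℝ] X) :
    D p + (A v - (ω + 1) • ι) (resolvent ι h (A v) (A v y + ι φ + h • D p))
      = A v (resolvent ι h (A v) ((A v - (ω + 1) • ι) y))
        + (ι (resolvent ι h (A v) ((A v - (ω + 1) • ι) φ))
          + (1 - h * (ω + 1)) • ι (resolvent ι h (A v) (D p))) := by
  have e1 : (A v - (ω + 1) • ι) (resolvent ι h (A v) (A v y))
      = A v (resolvent ι h (A v) ((A v - (ω + 1) • ι) y)) := by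
    rw [k.resolvent_op hv hh hω hh', map_smul, map_sub, k.shift_resolvent hv hh hω hh',
      k.op_resolvent hv hh hω hh']
  have e2 : D p + h • (A v - (ω + 1) • ι) (resolvent ι h (A v) (D p))
      = (1 - h * (ω + 1)) • ι (resolvent ι h (A v) (D p)) := by
    rw [sub_apply, smul_sub, k.smul_op_resolvent hv hh hω hh', smul_apply, smul_smul, sub_smul,
      one_smul]
    abel
  rw [map_add, map_add, map_add, map_add, e1, k.shift_resolvent hv hh hω hh', map_smul, map_smul,
    ← e2]
  abel

/-- The derivative of `(1 - h A(u))⁻¹ x` along moving `u` and `x`, by differentiation of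
`p - h A(u) p = x`. -/
theorem hasDerivAt_resolvent [CompleteSpace Y] (hh : 0 < h) (hω : h * |ω| ≤ 1 / 2)
    (hh' : h ≤ 1 / 2) {u : ℝ → E} {x : ℝ → X} {u' : E} {x' : X} {t : ℝ}
    (hut : u t ∈ ball (0 : E) R) (hu : HasDerivAt u u' t) (hx : HasDerivAt x x' t) :
    HasDerivAt (fun s => resolvent ι h (A (u s)) (x s))
      (resolvent ι h (A (u t)) (x' + h • fderiv ℝ A (u t) u'
        (resolvent ι h (A (u t)) (x t)))) t := by
  set p : ℝ → Y := fun s => resolvent ι h (A (u s)) (x s) with hp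
  have hJ : DifferentiableAt ℝ (fun v => resolvent ι h (A v)) (u t) :=
    ((k.contDiffOn_resolvent hh hω hh').differentiableOn one_ne_zero).differentiableAt
      (isOpen_ball.mem_nhds hut)
  obtain ⟨p', hp'⟩ : ∃ p', HasDerivAt p p' t :=
    ⟨_, (hJ.hasFDerivAt.comp_hasDerivAt t hu).clm_apply hx⟩
  have hA := (k.differentiableAt hut).hasFDerivAt.comp_hasDerivAt t hu
  have h1 : HasDerivAt (fun s => ι (p s) - h • (A (u s)) (p s))
      (ι p' - h • (fderiv ℝ A (u t) u' (p t) + A (u t) p')) t :=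
    (ι.hasFDerivAt.comp_hasDerivAt t hp').sub ((hA.clm_apply hp').const_smul h)
  have h2 : x =ᶠ[𝓝 t] fun s => ι (p s) - h • (A (u s)) (p s) := by
    filter_upwards [hu.continuousAt.preimage_mem_nhds (isOpen_ball.mem_nhds hut)] with s hs
    exact (k.resolvent_right hs hh hω hh' (x s)).symm
  have h3 := (h1.congr_of_eventuallyEq h2).unique hx
  have h4 : ι p' - h • A (u t) p' = x' + h • fderiv ℝ A (u t) u' (p t) := by
    rw [← h3, smul_add]; abel
  rw [← h4, k.resolvent_left hut hh hω hh']
  exact hp'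

/-- Difference of two resolvents applied to different vectors. -/
theorem resolvent_sub_resolvent (hh : 0 < h) (hω : h * |ω| ≤ 1 / 2)
    (hh' : h ≤ 1 / 2) {v' : E} (hv : v ∈ ball (0 : E) R) (hv' : v' ∈ ball (0 : E) R) (x x' : X) :
    resolvent ι h (A v) x - resolvent ι h (A v') x'
      = resolvent ι h (A v) (x - x' + h • (A v - A v') (resolvent ι h (A v') x')) := by
  have e1 := k.resolvent_right hv hh hω hh' x
  have e2 := k.resolvent_right hv' hh hω hh' x'
  rw [← k.resolvent_left hv hh hω hh'
    (resolvent ι h (A v) x - resolvent ι h (A v') x')]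
  congr 1
  rw [map_sub, map_sub, sub_apply]
  generalize resolvent ι h (A v) x = p at e1 ⊢
  generalize resolvent ι h (A v') x' = p' at e2 ⊢
  rw [← e1, ← e2]
  simp only [smul_sub]
  abel

end KatoFamily

end Mollifier

section Mollifier

variable {E X Y : Type*} [NormedAddCommGroup E] [NormedSpace ℝ E]
  [NormedAddCommGroup X] [NormedSpace ℝ X] [NormedAddCommGroup Y] [NormedSpace ℝ Y]

namespace KatoFamily

variable {ι : Y →L[ℝ] X} {R ω c C K : ℝ} {b : E → X →L[ℝ] X →L[ℝ] ℝ} {A : E → Y →L[ℝ] X}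
  (k : KatoFamily ι R ω c C K b A) {v : E} {h : ℝ}

include k

variable [CompleteSpace X]

theorem resolvent_path_lipschitz (hh : 0 < h) (hω : h * |ω| ≤ 1 / 2)
    (hh' : h ≤ 1 / 2) {u : ℝ → E} {y : ℝ → Y} {a e U V M : ℝ}
    (hu : ∀ t ∈ Icc a e, u t ∈ ball (0 : E) R)
    (huL : ∀ s ∈ Icc a e, ∀ t ∈ Icc a e, ‖u s - u t‖ ≤ U * |s - t|)
    (hyL : ∀ s ∈ Icc a e, ∀ t ∈ Icc a e, ‖ι (y s) - ι (y t)‖ ≤ V * |s - t|)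
    (hy : ∀ t ∈ Icc a e, ‖y t‖ ≤ M) :
    ∃ L, ∀ s ∈ Icc a e, ∀ t ∈ Icc a e, ‖resolvent ι h (A (u s)) (ι (y s))
      - resolvent ι h (A (u t)) (ι (y t))‖ ≤ L * |s - t| := by
  have hC := k.C_pos
  set B := C * (h⁻¹ * (2 * c ^ 2 + 1) + |ω + 1| * (2 * c ^ 2)) with hB
  have hB0 : 0 ≤ B := by positivity
  refine ⟨B * (V + h * (C * U * (2 * c ^ 2 * C ^ 2 * M))), fun s hs t ht => ?_⟩
  rw [k.resolvent_sub_resolvent hh hω hh' (hu s hs) (hu t ht)]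
  refine (k.norm_resolvent_le (hu s hs) hh hω hh' _).trans ?_
  rw [mul_assoc B]
  refine mul_le_mul_of_nonneg_left ?_ hB0
  have hM0 : 0 ≤ M := (norm_nonneg _).trans (hy t ht)
  calc _ ≤ V * |s - t| + h * ((C * (U * |s - t|)) * (2 * c ^ 2 * C ^ 2 * M)) := by
        refine (norm_add_le _ _).trans (add_le_add (hyL s hs t ht) ?_)
        rw [norm_smul, Real.norm_eq_abs, abs_of_pos hh]
        refine mul_le_mul_of_nonneg_left ?_ hh.le
        have h1 : ‖A (u s) - A (u t)‖ ≤ C * (U * |s - t|) :=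
          (k.norm_op_sub_le (hu s hs) (hu t ht)).trans (by gcongr; exact huL s hs t ht)
        refine (ContinuousLinearMap.le_of_opNorm_le _ h1 _).trans ?_
        refine mul_le_mul_of_nonneg_left ?_ ((norm_nonneg _).trans h1)
        exact (k.norm_resolvent_incl_le (hu t ht) hh hω hh' _).trans (by gcongr; exact hy t ht)
    _ = _ := by ring

omit [CompleteSpace X] in
theorem shift_path_lipschitz {u : ℝ → E} {y : ℝ → Y} {a e U V M : ℝ}
    (hu : ∀ t ∈ Icc a e, u t ∈ ball (0 : E) R)
    (huL : ∀ s ∈ Icc a e, ∀ t ∈ Icc a e, ‖u s - u t‖ ≤ U * |s - t|)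
    (hyL : ∀ s ∈ Icc a e, ∀ t ∈ Icc a e, ‖y s - y t‖ ≤ V * |s - t|)
    (hy : ∀ t ∈ Icc a e, ‖y t‖ ≤ M) :
    ∃ L, ∀ s ∈ Icc a e, ∀ t ∈ Icc a e, ‖(A (u s) - (ω + 1) • ι) (y s)
      - (A (u t) - (ω + 1) • ι) (y t)‖ ≤ L * |s - t| := by
  have hC := k.C_pos
  refine ⟨C * V + C * U * M, fun s hs t ht => ?_⟩
  have h1 : ‖A (u s) - A (u t)‖ ≤ C * (U * |s - t|) :=
    (k.norm_op_sub_le (hu s hs) (hu t ht)).trans (by gcongr; exact huL s hs t ht)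
  have e1 : (A (u s) - (ω + 1) • ι) (y s) - (A (u t) - (ω + 1) • ι) (y t)
      = (A (u s) - (ω + 1) • ι) (y s - y t) + (A (u s) - A (u t)) (y t) := by
    simp only [sub_apply, map_sub]; abel
  rw [e1]
  calc _ ≤ C * (V * |s - t|) + C * (U * |s - t|) * M := by
        refine (norm_add_le _ _).trans (add_le_add ?_ ?_)
        · exact (ContinuousLinearMap.le_of_opNorm_le _ (k.norm_shift_le _ (hu s hs)) _).trans
            (by gcongr; exact hyL s hs t ht)
        · refine (ContinuousLinearMap.le_of_opNorm_le _ h1 _).trans ?_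
          exact mul_le_mul_of_nonneg_left (hy t ht) ((norm_nonneg _).trans h1)
    _ = _ := by ring

omit [CompleteSpace X] in
theorem energy_absolutelyContinuous {u : ℝ → E} {q : ℝ → X} {a e U L M : ℝ} (hae : a ≤ e)
    (hu : ∀ t ∈ Icc a e, u t ∈ ball (0 : E) R)
    (huL : ∀ s ∈ Icc a e, ∀ t ∈ Icc a e, ‖u s - u t‖ ≤ U * |s - t|)
    (hqL : ∀ s ∈ Icc a e, ∀ t ∈ Icc a e, ‖q s - q t‖ ≤ L * |s - t|)
    (hq : ∀ t ∈ Icc a e, ‖q t‖ ≤ M) :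
    AbsolutelyContinuousOnInterval (fun t => b (u t) (q t) (q t)) a e := by
  have hc := k.c_pos
  have hK := k.zero_le_K
  have hM : 0 ≤ M := (norm_nonneg _).trans (hq a (left_mem_Icc.2 hae))
  refine LipschitzOnWith.absolutelyContinuousOnInterval
    (K := Real.toNNReal (K * U * M * M + 2 * (c ^ 2 * L * M))) ?_
  rw [uIcc_of_le hae]
  refine LipschitzOnWith.of_dist_le_mul fun s hs t ht => ?_
  rw [dist_eq_norm, dist_eq_norm]
  have hU : ‖b (u s) - b (u t)‖ ≤ K * ‖u s - u t‖ :=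
    (convex_ball (0 : E) R).norm_image_sub_le_of_norm_fderiv_le
      (fun _ hx => k.differentiableAt_form _ hx) k.norm_fderiv_form_le (hu t ht) (hu s hs)
  have e1 : b (u s) (q s) (q s) - b (u t) (q t) (q t)
      = (b (u s) - b (u t)) (q s) (q s) + (b (u t) (q s - q t) (q s)
        + b (u t) (q t) (q s - q t)) := by
    simp only [sub_apply, map_sub]; ring
  rw [e1, Real.norm_eq_abs, Real.norm_eq_abs]
  calc _ ≤ K * (U * |s - t|) * M * M + (c ^ 2 * (L * |s - t|) * M
        + c ^ 2 * M * (L * |s - t|)) := by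
        refine (abs_add_le _ _).trans (add_le_add ?_ ((abs_add_le _ _).trans (add_le_add ?_ ?_)))
        · refine ((b (u s) - b (u t)).le_opNorm₂ (q s) (q s)).trans ?_
          have : ‖b (u s) - b (u t)‖ ≤ K * (U * |s - t|) :=
            hU.trans (by gcongr; exact huL s hs t ht)
          have := (norm_nonneg _).trans this
          gcongr <;> exact hq s hs
        · refine (k.abs_form_le (hu t ht) _ _).trans ?_
          have := (norm_nonneg _).trans (hqL s hs t ht)
          gcongr
          · exact hqL s hs t ht
          · exact hq s hs
        · refine (k.abs_form_le (hu t ht) _ _).trans ?_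
          gcongr
          · exact hq t ht
          · exact hqL s hs t ht
    _ = (K * U * M * M + 2 * (c ^ 2 * L * M)) * |s - t| := by ring
    _ ≤ _ := by gcongr; exact Real.le_coe_toNNReal _

theorem tendsto_resolvent_incl (hdense : DenseRange ι) (hv : v ∈ ball (0 : E) R) {s : ℕ → ℝ}
    (hs : Tendsto s atTop (𝓝[>] 0)) (hs' : ∀ n, s n * |ω| ≤ 1 / 2 ∧ s n ≤ 1 / 2 ∧ 0 < s n)
    (y : Y) : Tendsto (fun n => resolvent ι (s n) (A v) (ι y)) atTop (𝓝 y) := by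
  rw [tendsto_iff_norm_sub_tendsto_zero]
  have h1 : Tendsto (fun n => C * ‖ι (resolvent ι (s n) (A v) ((A v - (ω + 1) • ι) y))
      - (A v - (ω + 1) • ι) y‖) atTop (𝓝 (C * 0)) :=
    (tendsto_iff_norm_sub_tendsto_zero.1
      ((k.tendsto_incl_resolvent hdense hv ((A v - (ω + 1) • ι) y)).comp hs)).const_mul C
  rw [mul_zero] at h1
  refine squeeze_zero (fun _ => norm_nonneg _) (fun n => ?_) h1
  refine (k.norm_le_norm_shift hv _).trans (le_of_eq ?_)
  rw [map_sub, k.shift_resolvent hv (hs' n).2.2 (hs' n).1 (hs' n).2.1]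

end KatoFamily

end Mollifier

theorem continuousOn_of_norm_sub_le {Z : Type*} [SeminormedAddCommGroup Z] {f : ℝ → Z} {s : Set ℝ}
    {L : ℝ} (h : ∀ x ∈ s, ∀ y ∈ s, ‖f x - f y‖ ≤ L * |x - y|) : ContinuousOn f s := by
  refine (LipschitzOnWith.of_dist_le_mul (K := Real.toNNReal L) fun x hx y hy => ?_).continuousOn
  rw [dist_eq_norm, dist_eq_norm, Real.norm_eq_abs]
  exact (h x hx y hy).trans (by gcongr; exact Real.le_coe_toNNReal _)

section Mollifier

variable {E X Y : Type*} [NormedAddCommGroup E] [NormedSpace ℝ E]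
  [NormedAddCommGroup X] [NormedSpace ℝ X] [NormedAddCommGroup Y] [NormedSpace ℝ Y]

namespace KatoFamily

variable {ι : Y →L[ℝ] X} {R ω c C K : ℝ} {b : E → X →L[ℝ] X →L[ℝ] ℝ} {A : E → Y →L[ℝ] X}
  (k : KatoFamily ι R ω c C K b A)

include k

variable [CompleteSpace X]

/-- A path `y` that is bounded in `Y`, Lipschitz in `X` and satisfies `y' = A(u) y + φ` almost
everywhere is continuous in `Y`. The mollified paths `(1 - h A(u))⁻¹ (A(u) - (ω + 1)) y` satisfy
the same equation up to commutators which converge pointwise as `h → 0`; so the energy estimate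
and dominated convergence make them converge uniformly in `X`. -/
theorem continuousOn_of_ae_hasDerivAt [CompleteSpace Y] (hdense : DenseRange ι)
    {u u' : ℝ → E} {y φ : ℝ → Y} {a e U V M F : ℝ} (hae : a ≤ e)
    (hu : ∀ t ∈ Icc a e, u t ∈ ball (0 : E) R)
    (huL : ∀ s ∈ Icc a e, ∀ t ∈ Icc a e, ‖u s - u t‖ ≤ U * |s - t|)
    (hud : ∀ᵐ t, t ∈ Ioo a e → HasDerivAt u (u' t) t)
    (hU : ∀ t ∈ Icc a e, ‖u' t‖ ≤ U)
    (hum : AEStronglyMeasurable u' (volume.restrict (Icc a e)))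
    (hyL : ∀ s ∈ Icc a e, ∀ t ∈ Icc a e, ‖ι (y s) - ι (y t)‖ ≤ V * |s - t|)
    (hy : ∀ t ∈ Icc a e, ‖y t‖ ≤ M)
    (hyd : ∀ᵐ t, t ∈ Ioo a e → HasDerivAt (fun s => ι (y s)) (A (u t) (y t) + ι (φ t)) t)
    (hφ : ∀ t ∈ Icc a e, ‖φ t‖ ≤ F) (hφc : ContinuousOn (fun t => ι (φ t)) (Icc a e)) :
    ContinuousOn y (Icc a e) := by
  have hc := k.c_pos
  have hC := k.C_pos
  have hK := k.zero_le_K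
  have ha : a ∈ Icc a e := left_mem_Icc.2 hae
  have hU0 : 0 ≤ U := (norm_nonneg _).trans (hU a ha)
  have hM0 : 0 ≤ M := (norm_nonneg _).trans (hy a ha)
  have hF0 : 0 ≤ F := (norm_nonneg _).trans (hφ a ha)
  -- the mollification parameters
  set σ : ℕ → ℝ := fun n => 1 / (2 * (|ω| + 1)) * (1 / ((n : ℝ) + 1)) with hσ
  have hσ0 : ∀ n, 0 < σ n := fun n => by positivity
  have hσle : ∀ n, σ n ≤ 1 / (2 * (|ω| + 1)) := fun n => by
    refine mul_le_of_le_one_right (by positivity) ?_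
    rw [div_le_one (by positivity)]
    have : (0 : ℝ) ≤ n := n.cast_nonneg
    linarith
  have hσω : ∀ n, σ n * (|ω| + 1) ≤ 1 / 2 := fun n => by
    calc σ n * (|ω| + 1) ≤ 1 / (2 * (|ω| + 1)) * (|ω| + 1) := by gcongr; exact hσle n
      _ = 1 / 2 := by field_simp
  have hσ1 : ∀ n, σ n * |ω| ≤ 1 / 2 := fun n =>
    (mul_le_mul_of_nonneg_left (by linarith) (hσ0 n).le).trans (hσω n)
  have hσ2 : ∀ n, σ n ≤ 1 / 2 := fun n => by
    refine le_trans ?_ (hσω n)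
    exact le_mul_of_one_le_right (hσ0 n).le (by linarith [abs_nonneg ω])
  have hσlim : Tendsto σ atTop (𝓝 0) := by
    have := (tendsto_one_div_add_atTop_nhds_zero_nat (𝕜 := ℝ)).const_mul (1 / (2 * (|ω| + 1)))
    rwa [mul_zero] at this
  have hσlim' : Tendsto σ atTop (𝓝[>] 0) :=
    tendsto_nhdsWithin_iff.2 ⟨hσlim, Eventually.of_forall hσ0⟩
  have hσ3 : ∀ n, |1 - σ n * (ω + 1)| ≤ 2 := fun n => by
    have : |σ n * (ω + 1)| ≤ 1 := by
      rw [abs_mul, abs_of_pos (hσ0 n)]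
      have := mul_le_mul_of_nonneg_left (abs_add_le ω 1) (hσ0 n).le
      rw [abs_one] at this
      linarith [hσω n]
    rw [abs_le] at this ⊢
    constructor <;> linarith
  set J : ℕ → ℝ → X →L[ℝ] Y := fun n t => resolvent ι (σ n) (A (u t)) with hJ
  set Sh : ℝ → Y →L[ℝ] X := fun t => A (u t) - (ω + 1) • ι with hSh
  set p : ℕ → ℝ → Y := fun n t => J n t (ι (y t)) with hp
  set q : ℕ → ℝ → X := fun n t => Sh t (p n t) with hq
  set D : ℝ → Y →L[ℝ] X := fun t => fderiv ℝ A (u t) (u' t) with hD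
  set Γ : ℕ → ℝ → X := fun n t =>
    Sh t (J n t (ι (φ t))) + (1 - σ n * (ω + 1)) • ι (J n t (D t (p n t))) with hΓ
  set Γ' : ℝ → X := fun t => Sh t (φ t) + D t (y t) with hΓ'
  have huc : ContinuousOn u (Icc a e) := continuousOn_of_norm_sub_le huL
  have hιyc : ContinuousOn (fun t => ι (y t)) (Icc a e) := continuousOn_of_norm_sub_le hyL
  have hSn : ∀ t ∈ Icc a e, ‖Sh t‖ ≤ C := fun t ht => k.norm_shift_le _ (hu t ht)
  have hDn : ∀ t ∈ Icc a e, ‖D t‖ ≤ C * U := fun t ht =>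
    (ContinuousLinearMap.le_of_opNorm_le _ (k.norm_fderiv_le _ (hu t ht)) _).trans
      (by gcongr; exact hU t ht)
  have hpn : ∀ n, ∀ t ∈ Icc a e, ‖p n t‖ ≤ 2 * c ^ 2 * C ^ 2 * M := fun n t ht =>
    (k.norm_resolvent_incl_le (hu t ht) (hσ0 n) (hσ1 n) (hσ2 n) _).trans
      (by gcongr; exact hy t ht)
  have hJx : ∀ n, ∀ t ∈ Icc a e, ∀ x, ‖ι (J n t x)‖ ≤ 2 * c ^ 2 * ‖x‖ := fun n t ht x =>
    k.norm_incl_resolvent_le (hu t ht) (hσ0 n) (hσ1 n) (hσ2 n) x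
  have hcomm : ∀ n, ∀ t ∈ Icc a e, ∀ z, Sh t (J n t (ι z)) = ι (J n t (Sh t z)) :=
    fun n t ht z => k.shift_resolvent (hu t ht) (hσ0 n) (hσ1 n) (hσ2 n) z
  have hqn : ∀ n, ∀ t ∈ Icc a e, ‖q n t‖ ≤ 2 * c ^ 2 * (C * M) := fun n t ht => by
    simp only [hq, hp]
    rw [hcomm n t ht]
    refine (hJx n t ht _).trans ?_
    gcongr
    exact ((Sh t).le_of_opNorm_le (hSn t ht) _).trans (by gcongr; exact hy t ht)
  -- pointwise convergence
  have hplim : ∀ t ∈ Icc a e, Tendsto (fun n => p n t) atTop (𝓝 (y t)) := fun t ht =>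
    k.tendsto_resolvent_incl hdense (hu t ht) hσlim' (fun n => ⟨hσ1 n, hσ2 n, hσ0 n⟩) (y t)
  have hqlim : ∀ t ∈ Icc a e, Tendsto (fun n => q n t) atTop (𝓝 (Sh t (y t))) := fun t ht =>
    ((Sh t).continuous.tendsto _).comp (hplim t ht)
  have hΓlim : ∀ t ∈ Icc a e, Tendsto (fun n => Γ n t) atTop (𝓝 (Γ' t)) := by
    intro t ht
    have h1 : Tendsto (fun n => Sh t (J n t (ι (φ t)))) atTop (𝓝 (Sh t (φ t))) :=
      ((Sh t).continuous.tendsto _).comp (k.tendsto_resolvent_incl hdense (hu t ht) hσlim'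
        (fun n => ⟨hσ1 n, hσ2 n, hσ0 n⟩) (φ t))
    have h2 : Tendsto (fun n => ι (J n t (D t (p n t - y t)))) atTop (𝓝 0) := by
      have h3 : Tendsto (fun n => 2 * c ^ 2 * ‖D t (p n t - y t)‖) atTop
          (𝓝 (2 * c ^ 2 * ‖D t (y t - y t)‖)) :=
        (((D t).continuous.tendsto _).comp ((hplim t ht).sub_const _)).norm.const_mul _
      rw [sub_self, map_zero, norm_zero, mul_zero] at h3
      exact squeeze_zero_norm (fun n => hJx n t ht _) h3
    have h4 : Tendsto (fun n => ι (J n t (D t (y t)))) atTop (𝓝 (D t (y t))) :=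
      (k.tendsto_incl_resolvent hdense (hu t ht) _).comp hσlim'
    have h5 : Tendsto (fun n => ι (J n t (D t (p n t)))) atTop (𝓝 (D t (y t))) := by
      have := h2.add h4
      rw [zero_add] at this
      refine this.congr fun n => ?_
      rw [← map_add, ← map_add, ← map_add, sub_add_cancel]
    have h6 : Tendsto (fun n => 1 - σ n * (ω + 1)) atTop (𝓝 1) := by
      have := (hσlim.mul_const (ω + 1)).const_sub 1
      rwa [zero_mul, sub_zero] at this
    have := h1.add (h6.smul h5)
    rwa [one_smul] at this
  have hΓn : ∀ n, ∀ t ∈ Icc a e, ‖Γ n t‖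
      ≤ 2 * c ^ 2 * (C * F) + 2 * (2 * c ^ 2 * (C * U * (2 * c ^ 2 * C ^ 2 * M))) := by
    intro n t ht
    refine (norm_add_le _ _).trans (add_le_add ?_ ?_)
    · rw [hcomm n t ht]
      refine (hJx n t ht _).trans ?_
      gcongr
      exact ((Sh t).le_of_opNorm_le (hSn t ht) _).trans (by gcongr; exact hφ t ht)
    · rw [norm_smul, Real.norm_eq_abs]
      gcongr
      · exact hσ3 n
      · refine (hJx n t ht _).trans ?_
        gcongr
        exact ((D t).le_of_opNorm_le (hDn t ht) _).trans (by gcongr; exact hpn n t ht)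
  set BΓ := 2 * c ^ 2 * (C * F) + 2 * (2 * c ^ 2 * (C * U * (2 * c ^ 2 * C ^ 2 * M))) with hBΓ
  have hΓ'n : ∀ t ∈ Icc a e, ‖Γ' t‖ ≤ BΓ := fun t ht =>
    le_of_tendsto (hΓlim t ht).norm (Eventually.of_forall fun n => hΓn n t ht)
  -- measurability
  have hJc : ∀ n, ContinuousOn (J n) (Icc a e) := fun n =>
    (k.contDiffOn_resolvent (hσ0 n) (hσ1 n) (hσ2 n)).continuousOn.comp huc hu
  have hShc : ContinuousOn Sh (Icc a e) :=
    (k.contDiffOn.continuousOn.comp huc hu).sub continuousOn_const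
  have hDm : AEStronglyMeasurable D (volume.restrict (Icc a e)) := by
    have h1 : ContinuousOn (fun t => fderiv ℝ A (u t)) (Icc a e) :=
      (k.contDiffOn.continuousOn_fderiv_of_isOpen isOpen_ball le_rfl).comp huc hu
    exact isBoundedBilinearMap_apply.continuous.comp_aestronglyMeasurable
      ((h1.aestronglyMeasurable measurableSet_Icc).prodMk hum)
  have hpc : ∀ n, ContinuousOn (p n) (Icc a e) := fun n => (hJc n).clm_apply hιyc
  have hqc : ∀ n, ContinuousOn (q n) (Icc a e) := fun n => hShc.clm_apply (hpc n)
  have hΓm : ∀ n, AEStronglyMeasurable (Γ n) (volume.restrict (Icc a e)) := by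
    intro n
    refine AEStronglyMeasurable.add ?_ (AEStronglyMeasurable.const_smul ?_ _)
    · exact (hShc.clm_apply ((hJc n).clm_apply hφc)).aestronglyMeasurable measurableSet_Icc
    · have h1 : AEStronglyMeasurable (fun t => D t (p n t)) (volume.restrict (Icc a e)) :=
        isBoundedBilinearMap_apply.continuous.comp_aestronglyMeasurable
          (hDm.prodMk ((hpc n).aestronglyMeasurable measurableSet_Icc))
      exact ι.continuous.comp_aestronglyMeasurable
        (isBoundedBilinearMap_apply.continuous.comp_aestronglyMeasurable
          (((hJc n).aestronglyMeasurable measurableSet_Icc).prodMk h1))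
  have hΓ'm : AEStronglyMeasurable Γ' (volume.restrict (Icc a e)) :=
    aestronglyMeasurable_of_tendsto_ae atTop hΓm
      ((ae_restrict_iff' measurableSet_Icc).2 (Eventually.of_forall hΓlim))
  set G : ℕ → ℝ → ℝ := fun n => (Icc a e).indicator fun t => ‖Γ n t - Γ' t‖ with hG
  have hG0 : ∀ n t, 0 ≤ G n t := fun n t => indicator_nonneg (fun _ _ => norm_nonneg _) t
  have hGeq : ∀ n, ∀ t ∈ Icc a e, G n t = ‖Γ n t - Γ' t‖ := fun n t ht => indicator_of_mem ht _
  have hGle : ∀ n t, ‖G n t‖ ≤ 2 * BΓ := by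
    intro n t
    rw [Real.norm_eq_abs, abs_of_nonneg (hG0 n t)]
    by_cases ht : t ∈ Icc a e
    · rw [hGeq n t ht]
      calc _ ≤ ‖Γ n t‖ + ‖Γ' t‖ := norm_sub_le _ _
        _ ≤ BΓ + BΓ := add_le_add (hΓn n t ht) (hΓ'n t ht)
        _ = _ := by ring
    · rw [hG]
      simp only [indicator_of_notMem ht]
      have : 0 ≤ BΓ := (norm_nonneg _).trans (hΓ'n a ha)
      positivity
  have hGm : ∀ n, AEStronglyMeasurable (G n) volume := fun n =>
    (aestronglyMeasurable_indicator_iff measurableSet_Icc).2 ((hΓm n).sub hΓ'm).norm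
  have hGi : ∀ n, IntervalIntegrable (G n) volume a e := fun n =>
    (intervalIntegrable_const (c := 2 * BΓ)).mono_fun (hGm n).restrict
      (Eventually.of_forall fun t => (hGle n t).trans (le_abs_self _))
  have hGlim : Tendsto (fun n => ∫ t in a..e, G n t) atTop (𝓝 0) := by
    have := intervalIntegral.tendsto_integral_filter_of_dominated_convergence
      (F := G) (f := fun _ => (0 : ℝ)) (μ := volume) (a := a) (b := e) (l := atTop)
      (fun _ => 2 * BΓ) (Eventually.of_forall fun n => (hGm n).restrict)
      (Eventually.of_forall fun n => Eventually.of_forall fun t _ => hGle n t)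
      intervalIntegrable_const (Eventually.of_forall fun t ht => ?_)
    · simpa using this
    · rw [uIoc_of_le hae] at ht
      have ht' := Ioc_subset_Icc_self ht
      have h1 := tendsto_iff_norm_sub_tendsto_zero.1 (hΓlim t ht')
      exact h1.congr fun n => (hGeq n t ht').symm
  -- the equation of the mollified path
  have hqd : ∀ n, ∀ᵐ t, t ∈ Ioo a e →
      HasDerivAt (q n) (A (u t) (J n t (Sh t (y t))) + Γ n t) t := by
    intro n
    filter_upwards [hud, hyd] with t h1 h2 ht
    have ht' := Ioo_subset_Icc_self ht
    have hp' := k.hasDerivAt_resolvent (hσ0 n) (hσ1 n) (hσ2 n) (hu t ht') (h1 ht) (h2 ht)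
    have hS' := ((k.differentiableAt (hu t ht')).hasFDerivAt.comp_hasDerivAt t (h1 ht)).sub_const
      ((ω + 1) • ι)
    refine (hS'.clm_apply hp').congr_deriv ?_
    have := k.shift_resolvent_commutator (hu t ht') (hσ0 n) (hσ1 n) (hσ2 n) (y t) (φ t) (p n t)
      (D t)
    simp only [hΓ]
    rw [hcomm n t ht']
    exact this
  -- the energy estimate for the difference of two mollified paths
  set κ := K * U * c ^ 2 + 2 * |ω| with hκ
  set B := 8 * c ^ 4 * (C * M) with hB
  have hen : ∀ n m, ∀ t ∈ Icc a e, b (u t) (q n t - q m t) (q n t - q m t)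
      ≤ Real.exp (κ * (e - a)) * (b (u a) (q n a - q m a) (q n a - q m a)
        + ∫ s in a..e, B * (G n s + G m s)) := by
    intro n m
    obtain ⟨L₁, hL₁⟩ := k.resolvent_path_lipschitz (hσ0 n) (hσ1 n) (hσ2 n) hu huL hyL hy
    obtain ⟨L₂, hL₂⟩ := k.resolvent_path_lipschitz (hσ0 m) (hσ1 m) (hσ2 m) hu huL hyL hy
    obtain ⟨L₁', hL₁'⟩ := k.shift_path_lipschitz (y := p n) hu huL hL₁ (hpn n)
    obtain ⟨L₂', hL₂'⟩ := k.shift_path_lipschitz (y := p m) hu huL hL₂ (hpn m)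
    refine le_of_ae_hasDerivAt_le (e := fun t => b (u t) (q n t - q m t) (q n t - q m t))
      (k.energy_absolutelyContinuous (L := L₁' + L₂') (M := 2 * (2 * c ^ 2 * (C * M)))
        hae hu huL (fun s hs t ht => ?_) (fun t ht => ?_)) (by positivity)
      (k.form_nonneg (hu a ha) _) ?_ (fun t => ?_) ?_
    · have e1 : q n s - q m s - (q n t - q m t) = (q n s - q n t) - (q m s - q m t) := by abel
      rw [e1, add_mul]
      exact (norm_sub_le _ _).trans (add_le_add (hL₁' s hs t ht) (hL₂' s hs t ht))
    · rw [two_mul]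
      exact (norm_sub_le _ _).trans (add_le_add (hqn n t ht) (hqn m t ht))
    · filter_upwards [hud, hqd n, hqd m] with t h1 h2 h3 ht
      have ht' := Ioo_subset_Icc_self ht
      have hv := hu t ht'
      have hd := k.hasDerivWithinAt_energy hv (h1 ht).hasDerivWithinAt (s := univ)
        (W := fun t => q n t - q m t) ((h2 ht).sub (h3 ht)).hasDerivWithinAt
      refine ⟨_, hd.hasDerivAt univ_mem, ?_⟩
      have i1 := (abs_le.1 (k.abs_fderiv_form_le hv (hU t ht') (q n t - q m t))).2
      set z := J n t (Sh t (y t)) - J m t (Sh t (y t)) with hz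
      have hzq : q n t - q m t = ι z := by
        simp only [hq, hp, hz]
        rw [hcomm n t ht', hcomm m t ht', map_sub]
      have e1 : A (u t) (J n t (Sh t (y t))) + Γ n t - (A (u t) (J m t (Sh t (y t))) + Γ m t)
          = A (u t) z + ((Γ n t - Γ' t) - (Γ m t - Γ' t)) := by
        rw [hz, map_sub]; abel
      have hE0 := k.form_nonneg hv (q n t - q m t)
      have i2 : b (u t) (A (u t) z) (q n t - q m t)
          ≤ |ω| * b (u t) (q n t - q m t) (q n t - q m t) := by
        have := k.dissipative _ hv z
        rw [← hzq] at this
        exact this.trans (by gcongr; exact le_abs_self ω)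
      have i3 : b (u t) ((Γ n t - Γ' t) - (Γ m t - Γ' t)) (q n t - q m t)
          ≤ c ^ 2 * (G n t + G m t) * (2 * (2 * c ^ 2 * (C * M))) := by
        refine (le_abs_self _).trans ((k.abs_form_le hv _ _).trans ?_)
        rw [hGeq n t ht', hGeq m t ht']
        gcongr
        · exact norm_sub_le _ _
        · rw [two_mul]
          exact (norm_sub_le _ _).trans (add_le_add (hqn n t ht') (hqn m t ht'))
      rw [e1, map_add, add_apply]
      simp only [hκ, hB]
      linarith
    · have := hG0 n t
      have := hG0 m t
      positivity
    · exact ((hGi n).add (hGi m)).const_mul B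
  -- let `m → ∞`
  set β : ℕ → ℝ := fun n => c ^ 2 * (Real.exp (κ * (e - a))
    * (c ^ 2 * ‖q n a - Sh a (y a)‖ ^ 2 + B * ∫ s in a..e, G n s)) with hβ
  have hβlim : Tendsto β atTop (𝓝 0) := by
    have h1 := tendsto_iff_norm_sub_tendsto_zero.1 (hqlim a ha)
    have h2 := ((((h1.pow 2).const_mul (c ^ 2)).add (hGlim.const_mul B)).const_mul
      (Real.exp (κ * (e - a)))).const_mul (c ^ 2)
    simpa using h2
  have hqle : ∀ n, ∀ t ∈ Icc a e, ‖q n t - Sh t (y t)‖ ^ 2 ≤ β n := by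
    intro n t ht
    have h1 : Tendsto (fun m => ‖q n t - q m t‖ ^ 2) atTop (𝓝 (‖q n t - Sh t (y t)‖ ^ 2)) :=
      ((hqlim t ht).const_sub _).norm.pow 2
    have h2 : Tendsto (fun m => c ^ 2 * (Real.exp (κ * (e - a))
        * (c ^ 2 * ‖q n a - q m a‖ ^ 2 + B * ((∫ s in a..e, G n s) + ∫ s in a..e, G m s))))
        atTop (𝓝 (β n)) := by
      have := (((((((hqlim a ha).const_sub (q n a)).norm.pow 2).const_mul (c ^ 2)).add
        ((hGlim.const_add (∫ s in a..e, G n s)).const_mul B)).const_mul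
          (Real.exp (κ * (e - a)))).const_mul (c ^ 2))
      simpa [hβ] using this
    refine le_of_tendsto_of_tendsto' h1 h2 fun m => ?_
    refine (k.norm_sq_le (hu t ht) _).trans ?_
    refine mul_le_mul_of_nonneg_left ((hen n m t ht).trans ?_) (by positivity)
    refine mul_le_mul_of_nonneg_left (add_le_add ?_ (le_of_eq ?_)) (Real.exp_pos _).le
    · refine (le_abs_self _).trans ((k.abs_form_le (hu a ha) _ _).trans (le_of_eq ?_))
      ring
    · rw [intervalIntegral.integral_const_mul, intervalIntegral.integral_add (hGi n) (hGi m)]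
  have hunif : TendstoUniformlyOn q (fun t => Sh t (y t)) atTop (Icc a e) := by
    rw [Metric.tendstoUniformlyOn_iff]
    intro r hr
    filter_upwards [hβlim.eventually_lt_const (pow_pos hr 2)] with n hn t ht
    rw [dist_eq_norm, norm_sub_rev]
    exact lt_of_pow_lt_pow_left₀ 2 hr.le ((hqle n t ht).trans_lt hn)
  have hwc : ContinuousOn (fun t => Sh t (y t)) (Icc a e) :=
    hunif.continuousOn (Eventually.of_forall hqc).frequently
  -- recover `y` from its image under the isomorphism
  intro t ht
  rw [ContinuousWithinAt, tendsto_iff_norm_sub_tendsto_zero]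
  have hb : Tendsto (fun s => C * (‖Sh s (y s) - Sh t (y t)‖ + C * ‖u s - u t‖ * M))
      (𝓝[Icc a e] t) (𝓝 (C * (‖Sh t (y t) - Sh t (y t)‖ + C * ‖u t - u t‖ * M))) :=
    ((((hwc t ht).tendsto.sub_const _).norm).add
      ((((huc t ht).tendsto.sub_const _).norm.const_mul C).mul_const M)).const_mul C
  rw [sub_self, sub_self, norm_zero, norm_zero, mul_zero, zero_mul, add_zero, mul_zero] at hb
  refine squeeze_zero' (Eventually.of_forall fun _ => norm_nonneg _) ?_ hb
  filter_upwards [self_mem_nhdsWithin] with s hs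
  refine (k.norm_le_norm_shift (hu s hs) _).trans ?_
  gcongr
  have e1 : (A (u s) - (ω + 1) • ι) (y s - y t) = (Sh s (y s) - Sh t (y t))
      - (A (u s) - A (u t)) (y t) := by
    simp only [hSh, sub_apply, map_sub]; abel
  rw [e1]
  refine (norm_sub_le _ _).trans (add_le_add le_rfl ?_)
  refine (ContinuousLinearMap.le_of_opNorm_le _ (k.norm_op_sub_le (hu s hs) (hu t ht)) _).trans ?_
  gcongr
  exact hy t ht

end KatoFamily

end Mollifier

/-! ### Weak closedness of balls -/

/-- A complete normed space with the parallelogram law is reflexive. -/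
theorem exists_eq_of_bidual {H : Type*} [NormedAddCommGroup H] [NormedSpace ℝ H] [CompleteSpace H]
    (hH : InnerProductSpaceable H) (Φ : (H →L[ℝ] ℝ) →L[ℝ] ℝ) : ∃ z, ∀ f, Φ f = f z := by
  let _ : InnerProductSpace ℝ H := InnerProductSpace.ofNorm ℝ hH.parallelogram_identity
  let D : H →L[ℝ] (H →L[ℝ] ℝ) := innerSL ℝ
  refine ⟨(InnerProductSpace.toDual ℝ H).symm (Φ ∘L D), fun f => ?_⟩
  set w := (InnerProductSpace.toDual ℝ H).symm f with hw
  have hf : f = D w := by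
    ext x
    exact (InnerProductSpace.toDual_symm_apply (x := x) (y := f)).symm
  set z := (InnerProductSpace.toDual ℝ H).symm (Φ ∘L D) with hz
  have h1 : inner ℝ z w = (Φ ∘L D) w := InnerProductSpace.toDual_symm_apply
  rw [hf]
  change (Φ ∘L D) w = inner ℝ w z
  rw [← h1, real_inner_comm]

/-- The inclusion `ι : Y → X` has weakly closed balls: if a sequence is bounded in `Y` and
converges in `X`, its limit lies in `Y`, satisfies the same bound, and is the weak limit in `Y`. -/
def HasWeaklyClosedBalls {X Y : Type*} [NormedAddCommGroup X] [NormedSpace ℝ X]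
    [NormedAddCommGroup Y] [NormedSpace ℝ Y] (ι : Y →L[ℝ] X) : Prop :=
  ∀ (y : ℕ → Y) (x : X) (M : ℝ), (∀ n, ‖y n‖ ≤ M) → Tendsto (fun n => ι (y n)) atTop (𝓝 x) →
    ∃ y₀, ι y₀ = x ∧ ‖y₀‖ ≤ M ∧
      ∀ f : Y →L[ℝ] ℝ, Tendsto (fun n => f (y n)) atTop (𝓝 (f y₀))

/-- Balls are weakly closed if `Y` is isomorphic to a Hilbert space: by Banach-Alaoglu and
reflexivity the sequence has a weak limit along every ultrafilter, and the limits agree because `ι`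
is injective. -/
theorem hasWeaklyClosedBalls {X Y H : Type*} [NormedAddCommGroup X] [NormedSpace ℝ X]
    [NormedAddCommGroup Y] [NormedSpace ℝ Y] [NormedAddCommGroup H] [NormedSpace ℝ H]
    [CompleteSpace H] (hH : InnerProductSpaceable H) (e : Y ≃L[ℝ] H) {ι : Y →L[ℝ] X}
    (hι : Function.Injective ι) : HasWeaklyClosedBalls ι := by
  intro y x M hy hx
  -- every ultrafilter has a weak limit
  have key : ∀ u : Ultrafilter ℕ, (u : Filter ℕ) ≤ atTop → ∃ y₀, ι y₀ = x ∧
      ∀ f : Y →L[ℝ] ℝ, Tendsto (fun n => f (y n)) u (𝓝 (f y₀)) := by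
    intro u hu
    let ev : ℕ → WeakDual ℝ (Y →L[ℝ] ℝ) := fun n =>
      StrongDual.toWeakDual (NormedSpace.inclusionInDoubleDual ℝ Y (y n))
    have hev : ∀ n, ev n ∈ WeakDual.toStrongDual ⁻¹'
        closedBall (0 : StrongDual ℝ (Y →L[ℝ] ℝ)) M := fun n => by
      rw [mem_preimage, mem_closedBall_zero_iff]
      exact (NormedSpace.double_dual_bound ℝ Y (y n)).trans (hy n)
    obtain ⟨Φ, -, hΦ⟩ := (WeakDual.isCompact_closedBall (𝕜 := ℝ)
      (0 : StrongDual ℝ (Y →L[ℝ] ℝ)) M).ultrafilter_le_nhds (u.map ev)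
      (le_principal_iff.2 (Filter.Eventually.of_forall (f := (u : Filter ℕ)) hev))
    have hΦ' : Tendsto ev u (𝓝 Φ) := hΦ
    have hlim : ∀ f : Y →L[ℝ] ℝ, Tendsto (fun n => f (y n)) u (𝓝 (Φ f)) := fun f =>
      ((WeakDual.eval_continuous f).tendsto Φ).comp hΦ'
    let T : (H →L[ℝ] ℝ) →L[ℝ] (Y →L[ℝ] ℝ) :=
      (ContinuousLinearMap.compL ℝ Y H ℝ).flip (e : Y →L[ℝ] H)
    obtain ⟨z, hz⟩ := exists_eq_of_bidual hH ((WeakDual.toStrongDual Φ).comp T)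
    have hz' : ∀ f : Y →L[ℝ] ℝ, Φ f = f (e.symm z) := by
      intro f
      have h1 := hz (f ∘L (e.symm : H →L[ℝ] Y))
      have h2 : T (f ∘L (e.symm : H →L[ℝ] Y)) = f := by
        ext w; simp [T]
      rw [ContinuousLinearMap.comp_apply, h2] at h1
      exact h1
    refine ⟨e.symm z, ?_, fun f => ?_⟩
    · refine (SeparatingDual.eq_iff_forall_dual_eq (R := ℝ)).2 fun ℓ => ?_
      have h1 := hlim (ℓ ∘L ι)
      rw [hz'] at h1
      exact tendsto_nhds_unique h1 (((ℓ.continuous.tendsto x).comp hx).mono_left hu)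
    · rw [← hz']; exact hlim f
  obtain ⟨y₀, hy₀, -⟩ := key (Ultrafilter.of atTop) (Ultrafilter.of_le atTop)
  have hconv : ∀ f : Y →L[ℝ] ℝ, Tendsto (fun n => f (y n)) atTop (𝓝 (f y₀)) := by
    intro f
    rw [tendsto_iff_ultrafilter]
    intro u hu
    obtain ⟨y₁, hy₁, h⟩ := key u hu
    rw [hι (hy₀.trans hy₁.symm)]
    exact h f
  refine ⟨y₀, hy₀, ?_, hconv⟩
  have hM : 0 ≤ M := (norm_nonneg _).trans (hy 0)
  refine NormedSpace.norm_le_dual_bound ℝ y₀ hM fun f => ?_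
  refine le_of_tendsto (hconv f).norm (Eventually.of_forall fun n => ?_)
  rw [mul_comm]
  exact (f.le_opNorm _).trans (by gcongr; exact hy n)

/-! ### From scales of spaces to pairs of spaces -/

section Product

variable {E F G H : Type*} [NormedAddCommGroup E] [NormedSpace ℝ E]
  [NormedAddCommGroup F] [NormedSpace ℝ F] [NormedAddCommGroup G] [NormedSpace ℝ G]
  [NormedAddCommGroup H] [NormedSpace ℝ H]

theorem norm_fderiv_comp_le {S : E → G →L[ℝ] H} {T : E → F →L[ℝ] G} {v : E}
    (hS : DifferentiableAt ℝ S v) (hT : DifferentiableAt ℝ T v) {a a' e e' : ℝ}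
    (hSn : ‖S v‖ ≤ a) (hSn' : ‖fderiv ℝ S v‖ ≤ a') (hTn : ‖T v‖ ≤ e)
    (hTn' : ‖fderiv ℝ T v‖ ≤ e') :
    ‖fderiv ℝ (fun v => (S v).comp (T v)) v‖ ≤ a * e' + a' * e := by
  have ha := (norm_nonneg _).trans hSn
  have ha' := (norm_nonneg _).trans hSn'
  have he := (norm_nonneg _).trans hTn
  have he' := (norm_nonneg _).trans hTn'
  rw [fderiv_clm_comp hS hT]
  refine ContinuousLinearMap.opNorm_le_bound _ (by positivity) fun z => ?_
  have e1 : ‖(fderiv ℝ T v) z‖ ≤ e' * ‖z‖ := (fderiv ℝ T v).le_of_opNorm_le hTn' z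
  have e2 : ‖(fderiv ℝ S v) z‖ ≤ a' * ‖z‖ := (fderiv ℝ S v).le_of_opNorm_le hSn' z
  calc _ = ‖(S v).comp (fderiv ℝ T v z) + (fderiv ℝ S v z).comp (T v)‖ := rfl
    _ ≤ a * (e' * ‖z‖) + (a' * ‖z‖) * e := by
        refine (norm_add_le _ _).trans (add_le_add ?_ ?_)
        · exact (ContinuousLinearMap.opNorm_comp_le _ _).trans (by gcongr)
        · exact (ContinuousLinearMap.opNorm_comp_le _ _).trans (by gcongr)
    _ = _ := by ring

end Product

section Scale

variable {E : Type*} [NormedAddCommGroup E] [NormedSpace ℝ E]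
  {X : ℕ → Type*} [∀ r, NormedAddCommGroup (X r)] [∀ r, NormedSpace ℝ (X r)]

/-- The product `Λ_r = (A - c) ⋯ (A - c) : X r → X 0` of `r` factors, `c = lam - s`, which
transports the form on `X 0` to `X r`. -/
def toBaseOp (S : HilbertScale X) (s lam : ℝ) (A : ∀ r, X (r + 1) →L[ℝ] X r) :
    ∀ r, X r →L[ℝ] X 0
  | 0 => ContinuousLinearMap.id ℝ (X 0)
  | r + 1 => (toBaseOp S s lam A r).comp (shiftedOp S s lam r (A r))

/-- The restriction of `toBaseOp` to an operator `X (r + 1) → X 1`. -/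
def toDomainOp (S : HilbertScale X) (s lam : ℝ) (A : ∀ r, X (r + 1) →L[ℝ] X r) :
    ∀ r, X (r + 1) →L[ℝ] X 1
  | 0 => ContinuousLinearMap.id ℝ (X 1)
  | r + 1 => (toDomainOp S s lam A r).comp (shiftedOp S s lam (r + 1) (A (r + 1)))

/-- The products `Λ_r` commute with the inclusion and with `A`. -/
theorem incl_toDomainOp (S : HilbertScale X) (s lam : ℝ) (A : ∀ r, X (r + 1) →L[ℝ] X r) {m : ℕ}
    (hA : ∀ r, r + 1 ≤ m → ∀ w : X (r + 2), S.incl r (A (r + 1) w) = A r (S.incl (r + 1) w)) :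
    ∀ r, r ≤ m → ∀ w, S.incl 0 (toDomainOp S s lam A r w) = toBaseOp S s lam A r (S.incl r w) ∧
      A 0 (toDomainOp S s lam A r w) = toBaseOp S s lam A r (A r w)
  | 0, _, w => ⟨rfl, rfl⟩
  | r + 1, hr, w => by
    have ih := incl_toDomainOp S s lam A hA r (by omega)
      (shiftedOp S s lam (r + 1) (A (r + 1)) w)
    have h1 := hA r hr w
    constructor
    · simp only [toDomainOp, toBaseOp, ContinuousLinearMap.comp_apply]
      rw [ih.1]
      simp only [shiftedOp, sub_apply, smul_apply, map_sub, map_smul, h1]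
    · simp only [toDomainOp, toBaseOp, ContinuousLinearMap.comp_apply]
      rw [ih.2]
      simp only [shiftedOp, sub_apply, smul_apply, map_sub, map_smul, h1]

/-- The form `(x, y) ↦ L v (Λ x) (Λ y)` on `X m`, where `Λ = Λ_m` depends on `v` through `A v`. -/
noncomputable def scaleForm (S : HilbertScale X) (s lam : ℝ) (m : ℕ)
    (L : E → X 0 →L[ℝ] X 0 →L[ℝ] ℝ) (A : ∀ r, E → X (r + 1) →L[ℝ] X r) (v : E) :
    X m →L[ℝ] X m →L[ℝ] ℝ :=
  ((L v).comp (toBaseOp S s lam (fun r => A r v) m)).flip.comp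
    (toBaseOp S s lam (fun r => A r v) m)

/-- A bound for the derivative of `scaleForm` in `v`. -/
noncomputable def scaleFormConst (m : ℕ) (C₀ : ℝ) : ℝ :=
  C₀ ^ 2 * C₀ ^ m * (m * C₀ ^ m) + (C₀ ^ 2 * (m * C₀ ^ m) + C₀ * C₀ ^ m) * C₀ ^ m

variable {S : HilbertScale X} {m : ℕ} {s lam R₀ C₀ : ℝ} {L : E → X 0 →L[ℝ] X 0 →L[ℝ] ℝ}
  {A : ∀ r, E → X (r + 1) →L[ℝ] X r}

section

variable (hC₀ : 1 ≤ C₀) (hA : DissipativeFamily S m s lam R₀ C₀ L A) {v : E}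
  (hv : v ∈ ball (0 : E) R₀)

include hC₀ hA hv

theorem toBaseOp_differentiableAt : ∀ r, r ≤ m + 1 →
    DifferentiableAt ℝ (fun v => toBaseOp S s lam (fun r => A r v) r) v ∧
      ‖toBaseOp S s lam (fun r => A r v) r‖ ≤ C₀ ^ r ∧
      ‖fderiv ℝ (fun v => toBaseOp S s lam (fun r => A r v) r) v‖ ≤ r * C₀ ^ r
  | 0, _ => by
    refine ⟨differentiableAt_const _, ?_, ?_⟩
    · rw [pow_zero]; exact ContinuousLinearMap.norm_id_le
    · simp only [toBaseOp]
      rw [fderiv_fun_const]; simp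
  | r + 1, hr => by
    obtain ⟨h1, h2, h3⟩ := toBaseOp_differentiableAt r (by omega)
    have hb := hA.shifted_bounded r (by omega)
    have hd : DifferentiableAt ℝ (fun v => shiftedOp S s lam r (A r v)) v :=
      (hb.contDiffOn.differentiableOn one_ne_zero).differentiableAt (isOpen_ball.mem_nhds hv)
    refine ⟨h1.clm_comp hd, ?_, ?_⟩
    · rw [pow_succ]
      exact (ContinuousLinearMap.opNorm_comp_le _ _).trans
        (mul_le_mul h2 (hb.norm_le v hv) (norm_nonneg _) (by positivity))
    · refine (norm_fderiv_comp_le h1 hd h2 h3 (hb.norm_le v hv) (hb.norm_fderiv_le v hv)).trans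
        (le_of_eq ?_)
      push_cast; ring

theorem toBaseOp_isInvertible : ∀ r, r ≤ m + 1 →
    (toBaseOp S s lam (fun r => A r v) r).IsInvertible ∧
      ∀ x, ‖x‖ ≤ C₀ ^ r * ‖toBaseOp S s lam (fun r => A r v) r x‖
  | 0, _ => ⟨⟨ContinuousLinearEquiv.refl ℝ (X 0), rfl⟩, fun x => by simp [toBaseOp]⟩
  | r + 1, hr => by
    obtain ⟨⟨M, hM⟩, h2⟩ := toBaseOp_isInvertible r (by omega)
    obtain ⟨N, hN⟩ := hA.shifted_invertible r (by omega) v hv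
    refine ⟨⟨N.trans M, ?_⟩, fun x => ?_⟩
    · ext x; simp [toBaseOp, ← hM, ← hN]
    · have h3 := (hA.inverse_bounded r (by omega)).norm_le v hv
      rw [← hN, ContinuousLinearMap.inverse_equiv] at h3
      have h4 := (N.symm : X r →L[ℝ] X (r + 1)).le_of_opNorm_le h3 (N x)
      simp only [ContinuousLinearEquiv.coe_coe, ContinuousLinearEquiv.symm_apply_apply] at h4
      have h5 := h2 (N x)
      have h6 : toBaseOp S s lam (fun r => A r v) (r + 1) x
          = toBaseOp S s lam (fun r => A r v) r (N x) := by
        simp [toBaseOp, ← hN]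
      rw [h6]
      calc ‖x‖ ≤ C₀ * (C₀ ^ r * ‖toBaseOp S s lam (fun r => A r v) r (N x)‖) :=
            h4.trans (by gcongr)
        _ = _ := by ring

omit hC₀ in
theorem toDomainOp_surjective : ∀ r, r ≤ m →
    Function.Surjective (toDomainOp S s lam (fun r => A r v) r)
  | 0, _ => fun x => ⟨x, rfl⟩
  | r + 1, hr => by
    obtain ⟨N, hN⟩ := hA.shifted_invertible (r + 1) hr v hv
    have h1 : Function.Surjective (shiftedOp S s lam (r + 1) (A (r + 1) v)) := by
      rw [← hN]; exact N.surjective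
    exact (toDomainOp_surjective r (by omega)).comp h1

theorem denseRange_incl (m' : ℕ) (hm' : m' ≤ m) : DenseRange (S.incl m') := by
  obtain ⟨⟨M, hM⟩, -⟩ := toBaseOp_isInvertible hC₀ hA hv m' (by omega)
  have h0 : DenseRange (S.incl 0) := by
    have h1 := S.dense_toBase 1
    have h2 : S.toBase 1 = S.incl 0 := by
      rw [S.toBase_succ 0, S.toBase_zero, ContinuousLinearMap.id_comp]
    rwa [h2] at h1
  have h2 : DenseRange (M.symm ∘ (S.incl 0) ∘ toDomainOp S s lam (fun r => A r v) m') := by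
    refine M.symm.surjective.denseRange.comp ?_ M.symm.continuous
    exact h0.comp (toDomainOp_surjective hA hv m' hm').denseRange (S.incl 0).continuous
  convert h2 using 1
  ext w
  have := (incl_toDomainOp S s lam (fun r => A r v)
    (fun r hr w => hA.restrict v hv r hr w) m' hm' w).1
  simp only [Function.comp_apply]
  rw [this, ← hM]
  simp

theorem completeSpace_scale (r : ℕ) (hr : r ≤ m + 1) : CompleteSpace (X r) := by
  obtain ⟨⟨M, hM⟩, -⟩ := toBaseOp_isInvertible hC₀ hA hv r hr
  have := S.complete_zero
  exact (completeSpace_congr (e := M.toEquiv) M.isUniformEmbedding).2 S.complete_zero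

theorem hasWeaklyClosedBalls_incl (r : ℕ) (hr : r ≤ m) : HasWeaklyClosedBalls (S.incl r) := by
  obtain ⟨⟨M, hM⟩, -⟩ := toBaseOp_isInvertible hC₀ hA hv (r + 1) (by omega)
  have := S.complete_zero
  exact hasWeaklyClosedBalls S.hilbert_zero M (S.incl_injective r)

end

/-- The energy forms and operators of a scale make up a quasi-dissipative family on the pair
`X (m + 1) → X m`, for the operator `-s A` with rate `-s lam`. -/
theorem DissipativeFamily.katoFamily (hC₀ : 1 ≤ C₀) (hs : s * s = 1) (hL : EnergyForm R₀ C₀ L)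
    (hA : DissipativeFamily S m s lam R₀ C₀ L A) :
    KatoFamily (S.incl m) R₀ (-s * lam) (C₀ ^ (m + 1)) C₀ (scaleFormConst m C₀)
      (scaleForm S s lam m L A) (fun v => -s • A m v) := by
  have hC : 0 < C₀ := zero_lt_one.trans_le hC₀
  have hs1 : ‖-s‖ = 1 := by
    rw [norm_neg, Real.norm_eq_abs]
    have : |s| * |s| = 1 := by rw [← abs_mul, hs, abs_one]
    nlinarith [abs_nonneg s]
  have hform : ∀ v x y, scaleForm S s lam m L A v x y
      = L v (toBaseOp S s lam (fun r => A r v) m y) (toBaseOp S s lam (fun r => A r v) m x) :=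
    fun v x y => rfl
  have hshift : ∀ v, -s • A m v - (-s * lam + 1) • S.incl m = -s • shiftedOp S s lam m (A m v) := by
    intro v
    rw [shiftedOp, smul_sub, smul_smul]
    congr 2
    linear_combination -hs
  have hLpos : ∀ v ∈ ball (0 : E) R₀, ∀ w, 0 ≤ L v w w := by
    intro v hv w
    by_cases hw : w = 0
    · simp [hw]
    · have h1 := hL.lower v hv w
      have h2 : 0 < C₀⁻¹ * ‖w‖ := mul_pos (inv_pos.2 hC) (norm_pos_iff.2 hw)
      exact (Real.sqrt_pos.1 (h2.trans_le h1)).le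
  have hLn : ∀ v ∈ ball (0 : E) R₀, ‖L v‖ ≤ C₀ ^ 2 := by
    intro v hv
    refine ContinuousLinearMap.opNorm_le_bound₂ _ (by positivity) fun w w' => ?_
    refine (abs_le_sqrt_mul_sqrt (hL.symm v hv) (hLpos v hv) w w').trans ?_
    calc _ ≤ (C₀ * ‖w‖) * (C₀ * ‖w'‖) :=
          mul_le_mul (hL.upper v hv w) (hL.upper v hv w') (Real.sqrt_nonneg _) (by positivity)
      _ = _ := by ring
  have hLd : ∀ v ∈ ball (0 : E) R₀, DifferentiableAt ℝ L v := fun v hv =>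
    (hL.contDiffOn.differentiableOn one_ne_zero).differentiableAt (isOpen_ball.mem_nhds hv)
  have hLd' : ∀ v ∈ ball (0 : E) R₀, ‖fderiv ℝ L v‖ ≤ C₀ := fun v hv =>
    ContinuousLinearMap.opNorm_le_bound _ hC.le (hL.norm_fderiv_le v hv)
  -- the form as a composition of differentiable maps
  have hcomp : ∀ v ∈ ball (0 : E) R₀, DifferentiableAt ℝ (scaleForm S s lam m L A) v ∧
      ‖fderiv ℝ (scaleForm S s lam m L A) v‖ ≤ scaleFormConst m C₀ := by
    intro v hv
    obtain ⟨h1, h2, h3⟩ := toBaseOp_differentiableAt hC₀ hA hv m (by omega)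
    have d1 := (hLd v hv).clm_comp h1
    have n1 := norm_fderiv_comp_le (hLd v hv) h1 (hLn v hv) (hLd' v hv) h2 h3
    set T : E → X m →L[ℝ] X 0 →L[ℝ] ℝ :=
      fun v => (L v).comp (toBaseOp S s lam (fun r => A r v) m) with hT
    let fl : (X m →L[ℝ] X 0 →L[ℝ] ℝ) →L[ℝ] (X 0 →L[ℝ] X m →L[ℝ] ℝ) :=
      ((ContinuousLinearMap.flipₗᵢ ℝ (X m) (X 0) ℝ).toContinuousLinearEquiv :
        (X m →L[ℝ] X 0 →L[ℝ] ℝ) →L[ℝ] (X 0 →L[ℝ] X m →L[ℝ] ℝ))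
    have hfl : HasFDerivAt (fun v => (T v).flip) (fl.comp (fderiv ℝ T v)) v :=
      fl.hasFDerivAt.comp v d1.hasFDerivAt
    have d2 : DifferentiableAt ℝ (fun v => (T v).flip) v := hfl.differentiableAt
    have n2 : ‖fderiv ℝ (fun v => (T v).flip) v‖ ≤ C₀ ^ 2 * (m * C₀ ^ m) + C₀ * C₀ ^ m := by
      rw [hfl.fderiv]
      refine ContinuousLinearMap.opNorm_le_bound _ (by positivity) fun z => ?_
      have e2 : ‖fl.comp (fderiv ℝ T v) z‖ = ‖fderiv ℝ T v z‖ :=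
        (ContinuousLinearMap.flipₗᵢ ℝ (X m) (X 0) ℝ).norm_map _
      rw [e2]
      exact (fderiv ℝ T v).le_of_opNorm_le n1 z
    have n3 : ‖(T v).flip‖ ≤ C₀ ^ 2 * C₀ ^ m := by
      rw [ContinuousLinearMap.opNorm_flip]
      exact (ContinuousLinearMap.opNorm_comp_le _ _).trans
        (mul_le_mul (hLn v hv) h2 (norm_nonneg _) (by positivity))
    exact ⟨d2.clm_comp h1, norm_fderiv_comp_le d2 h1 n3 n2 h2 h3⟩
  refine
    { one_le_c := one_le_pow₀ hC₀
      one_le_C := hC₀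
      zero_le_K := by rw [scaleFormConst]; positivity
      norm_incl_le := S.norm_incl_le m
      differentiableAt_form := fun v hv => (hcomp v hv).1
      norm_fderiv_form_le := fun v hv => (hcomp v hv).2
      symm := fun v hv x x' => by rw [hform, hform, hL.symm v hv]
      lower := fun v hv x => ?_
      upper := fun v hv x => ?_
      contDiffOn := (hA.bounded m le_rfl).contDiffOn.const_smul (-s)
      norm_le := fun v hv => ?_
      norm_fderiv_le := fun v hv => ?_
      norm_shift_le := fun v hv => ?_
      shift_invertible := fun v hv => ?_
      norm_shift_inverse_le := fun v hv => ?_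
      dissipative := fun v hv y => ?_ }
  · rw [hform]
    set z := toBaseOp S s lam (fun r => A r v) m x with hz
    have h1 := (toBaseOp_isInvertible hC₀ hA hv m (by omega)).2 x
    have h2 := hL.lower v hv z
    rw [inv_mul_le_iff₀ hC] at h2
    calc ‖x‖ ≤ C₀ ^ m * (C₀ * √(L v z z)) := h1.trans (by gcongr)
      _ = _ := by ring
  · rw [hform]
    set z := toBaseOp S s lam (fun r => A r v) m x with hz
    have h1 : ‖z‖ ≤ C₀ ^ m * ‖x‖ := (toBaseOp S s lam (fun r => A r v) m).le_of_opNorm_le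
      (toBaseOp_differentiableAt hC₀ hA hv m (by omega)).2.1 x
    calc √(L v z z) ≤ C₀ * (C₀ ^ m * ‖x‖) := (hL.upper v hv z).trans (by gcongr)
      _ = _ := by ring
  · rw [norm_smul, hs1, one_mul]
    exact (hA.bounded m le_rfl).norm_le v hv
  · have hd : DifferentiableAt ℝ (A m) v :=
      ((hA.bounded m le_rfl).contDiffOn.differentiableOn one_ne_zero).differentiableAt
        (isOpen_ball.mem_nhds hv)
    have : fderiv ℝ (fun v => -s • A m v) v = -s • fderiv ℝ (A m) v :=
      (hd.hasFDerivAt.const_smul (-s)).fderiv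
    rw [this, norm_smul, hs1, one_mul]
    exact (hA.bounded m le_rfl).norm_fderiv_le v hv
  · rw [hshift, norm_smul, hs1, one_mul]
    exact (hA.shifted_bounded m le_rfl).norm_le v hv
  · rw [hshift]
    obtain ⟨N, hN⟩ := hA.shifted_invertible m le_rfl v hv
    have hs0 : -s ≠ 0 := fun h => by rw [h, norm_zero] at hs1; exact zero_ne_one hs1
    refine ⟨N.trans (ContinuousLinearEquiv.smulLeft (Units.mk0 (-s) hs0)), ?_⟩
    ext x
    simp [← hN, Units.smul_def]
  · rw [hshift]
    obtain ⟨N, hN⟩ := hA.shifted_invertible m le_rfl v hv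
    have h1 := (hA.inverse_bounded m le_rfl).norm_le v hv
    rw [← hN, ContinuousLinearMap.inverse_equiv] at h1
    have hs0 : -s ≠ 0 := fun h => by rw [h, norm_zero] at hs1; exact zero_ne_one hs1
    set P := N.trans (ContinuousLinearEquiv.smulLeft (Units.mk0 (-s) hs0)) with hP
    have e1 : -s • shiftedOp S s lam m (A m v) = (P : X (m + 1) →L[ℝ] X m) := by
      ext x
      simp [← hN, hP, Units.smul_def]
    rw [e1, ContinuousLinearMap.inverse_equiv]
    refine ContinuousLinearMap.opNorm_le_bound _ hC.le fun x => ?_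
    have e2 : P (N.symm (-s • x)) = x := by
      have : (-s) * (-s) = 1 := by linarith
      simp only [hP, ContinuousLinearEquiv.trans_apply, ContinuousLinearEquiv.apply_symm_apply]
      change (-s) • (-s) • x = x
      rw [smul_smul, this, one_smul]
    have e3 : P.symm x = N.symm (-s • x) := by
      rw [ContinuousLinearEquiv.symm_apply_eq, e2]
    have e4 := (N.symm : X m →L[ℝ] X (m + 1)).le_of_opNorm_le h1 (-s • x)
    rw [norm_smul, hs1, one_mul] at e4
    change ‖P.symm x‖ ≤ _
    rw [e3]
    exact e4
  · obtain ⟨e1, e2⟩ := incl_toDomainOp S s lam (fun r => A r v)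
      (fun r hr w => hA.restrict v hv r hr w) m le_rfl y
    have h1 := hA.dissipative v hv (toDomainOp S s lam (fun r => A r v) m y)
    rw [e1, e2] at h1
    rw [hform, hform]
    simp only [smul_apply, map_smul] at h1 ⊢
    exact h1

end Scale

/-! ### The coupled system -/

theorem hasDerivWithinAt_comp_neg {Z : Type*} [NormedAddCommGroup Z] [NormedSpace ℝ Z]
    {f : ℝ → Z} {f' : Z} {T s : ℝ} (h : HasDerivWithinAt f f' (Icc (-T) 0) (-s)) :
    HasDerivWithinAt (fun s => f (-s)) (-f') (Icc 0 T) s := by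
  have h1 := HasDerivWithinAt.scomp s h (hasDerivAt_neg s).hasDerivWithinAt
    fun x (hx : x ∈ Icc 0 T) => ⟨by linarith [hx.2], by linarith [hx.1]⟩
  simpa [Function.comp_def] using h1

section Family

variable {E X Y : Type*} [NormedAddCommGroup E] [NormedSpace ℝ E]
  [NormedAddCommGroup X] [NormedSpace ℝ X] [NormedAddCommGroup Y] [NormedSpace ℝ Y]

/-- The error which a discrepancy `η` between a path and its approximation in the domain of the
operator makes in the energy estimate; it is of order `√η`. -/
noncomputable def energyError (c C ω N η gap : ℝ) : ℝ :=
  c * (√((2 * C + 6 * |ω|) * c ^ 2 * (2 * N + 2 * η) * (2 * η)) / gap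
    + √((2 * C + 6 * |ω|) * c ^ 2 * (2 * N + 2 * η) * (2 * η)))

theorem energyError_zero (c C ω N gap : ℝ) : energyError c C ω N 0 gap = 0 := by
  simp [energyError]

theorem continuous_energyError (c C ω N gap : ℝ) :
    Continuous fun η => energyError c C ω N η gap := by
  unfold energyError
  fun_prop

/-- Difference of two paths with `w' = A(u) y + r`, `y` close to `w`, for different parameters
`u`: the difference of the operators is Lipschitz in `u` and acts on `y₂`, which is small. -/
theorem KatoFamily.norm_sub_le {ι : Y →L[ℝ] X} {R ω c C K : ℝ} {b : E → X →L[ℝ] X →L[ℝ] ℝ}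
    {A : E → Y →L[ℝ] X} (k : KatoFamily ι R ω c C K b A)
    {u₁ u₂ u₁' : ℝ → E} {w₁ w₂ r₁ r₂ : ℝ → X} {y₁ y₂ : ℝ → Y} {a e U μ N Y₀ η D Cf κ : ℝ}
    (hu₁ : ∀ t ∈ Icc a e, u₁ t ∈ ball (0 : E) R) (hu₂ : ∀ t ∈ Icc a e, u₂ t ∈ ball (0 : E) R)
    (hud : ∀ t ∈ Icc a e, HasDerivWithinAt u₁ (u₁' t) (Icc a e) t)
    (hU : ∀ t ∈ Icc a e, ‖u₁' t‖ ≤ U)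
    (hw₁ : ∀ t ∈ Icc a e, HasDerivWithinAt w₁ (A (u₁ t) (y₁ t) + r₁ t) (Icc a e) t)
    (hw₂ : ∀ t ∈ Icc a e, HasDerivWithinAt w₂ (A (u₂ t) (y₂ t) + r₂ t) (Icc a e) t)
    (hy₁ : ∀ t ∈ Icc a e, ‖y₁ t‖ ≤ N * Real.exp (μ * t))
    (hy₂ : ∀ t ∈ Icc a e, ‖y₂ t‖ ≤ N * Real.exp (μ * t))
    (hY : ∀ t ∈ Icc a e, ‖y₂ t‖ ≤ Y₀)
    (hη₁ : ∀ t ∈ Icc a e, ‖w₁ t - ι (y₁ t)‖ ≤ η * Real.exp (μ * t))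
    (hη₂ : ∀ t ∈ Icc a e, ‖w₂ t - ι (y₂ t)‖ ≤ η * Real.exp (μ * t))
    (hD : ∀ t ∈ Icc a e, ‖u₁ t - u₂ t‖ ≤ D * Real.exp (μ * t))
    (hr : ∀ t ∈ Icc a e, ‖r₁ t - r₂ t‖ ≤ Cf * D * Real.exp (μ * t))
    (hκ₁ : C * Y₀ ≤ κ) (hκ₂ : K * U * c ^ 2 / 2 ≤ κ) (hμ : ω + κ < μ)
    (hD0 : 0 ≤ D) (hCf : 0 ≤ Cf) (hN : 0 ≤ N) (hη : 0 ≤ η) (hκ : 0 ≤ κ) :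
    ∀ t ∈ Icc a e, ‖w₁ t - w₂ t‖ ≤ c ^ 2 * ‖w₁ a - w₂ a‖ * Real.exp ((ω + κ) * (t - a))
      + (c ^ 2 * (Cf + κ) / (μ - ω - κ) * D + energyError c C ω N η (μ - ω - κ))
        * Real.exp (μ * t) := by
  intro t ht
  have hC := k.C_pos
  have hmain := k.norm_le_of_hasDerivWithinAt (W := fun t => w₁ t - w₂ t)
    (y := fun t => y₁ t - y₂ t)
    (r := fun t => (A (u₁ t) - A (u₂ t)) (y₂ t) + (r₁ t - r₂ t)) (N := 2 * N) (η := 2 * η)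
    (g := (Cf + κ) * D) (ω' := ω + κ) (μ := μ)
    hu₁ hud hU (fun s hs => ?_) (fun s hs => ?_) (fun s hs => ?_) (fun s hs => ?_)
    (by linarith) hμ (by positivity) (by positivity) (by positivity) t ht
  · refine hmain.trans (le_of_eq ?_)
    rw [energyError, sub_sub]
    ring
  · refine ((hw₁ s hs).sub (hw₂ s hs)).congr_deriv ?_
    simp only [map_sub, sub_apply]; abel
  · calc _ ≤ N * Real.exp (μ * s) + N * Real.exp (μ * s) :=
          (_root_.norm_sub_le _ _).trans (add_le_add (hy₁ s hs) (hy₂ s hs))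
      _ = _ := by ring
  · have e1 : w₁ s - w₂ s - ι (y₁ s - y₂ s) = (w₁ s - ι (y₁ s)) - (w₂ s - ι (y₂ s)) := by
      rw [map_sub]; abel
    rw [e1]
    calc _ ≤ η * Real.exp (μ * s) + η * Real.exp (μ * s) :=
          (_root_.norm_sub_le _ _).trans (add_le_add (hη₁ s hs) (hη₂ s hs))
      _ = _ := by ring
  · have h1 : ‖(A (u₁ s) - A (u₂ s)) (y₂ s)‖ ≤ κ * D * Real.exp (μ * s) := by
      have h2 : ‖A (u₁ s) - A (u₂ s)‖ ≤ C * (D * Real.exp (μ * s)) :=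
        (k.norm_op_sub_le (hu₁ s hs) (hu₂ s hs)).trans (by gcongr; exact hD s hs)
      calc _ ≤ C * (D * Real.exp (μ * s)) * Y₀ :=
            ((A (u₁ s) - A (u₂ s)).le_of_opNorm_le h2 _).trans (by gcongr; exact hY s hs)
        _ = (C * Y₀) * (D * Real.exp (μ * s)) := by ring
        _ ≤ κ * (D * Real.exp (μ * s)) := by gcongr
        _ = _ := by ring
    calc _ ≤ κ * D * Real.exp (μ * s) + Cf * D * Real.exp (μ * s) :=
          (norm_add_le _ _).trans (add_le_add h1 (hr s hs))
      _ = _ := by ring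

end Family

section Coupled

variable {Xp Xm Yp Ym : Type*}
  [NormedAddCommGroup Xp] [NormedSpace ℝ Xp] [NormedAddCommGroup Xm] [NormedSpace ℝ Xm]
  [NormedAddCommGroup Yp] [NormedSpace ℝ Yp] [NormedAddCommGroup Ym] [NormedSpace ℝ Ym]

/-- A quasilinear system `v_±' = A_±(v) v_± + f_±(v)` on a pair of spaces
`Y_+ × Y_- → X_+ × X_-`, with inclusion `ι = ιp × ιm`. The family `A_-` is quasi-dissipative with
rate `lamm`, the family `-A_+` with rate `-lamp`. -/
structure CoupledSystem (ιp : Yp →L[ℝ] Xp) (ιm : Ym →L[ℝ] Xm) (R c C K Cf lamp lamm : ℝ)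
    (bp : Xp × Xm → Xp →L[ℝ] Xp →L[ℝ] ℝ) (bm : Xp × Xm → Xm →L[ℝ] Xm →L[ℝ] ℝ)
    (Ap : Xp × Xm → Yp →L[ℝ] Xp) (Am : Xp × Xm → Ym →L[ℝ] Xm)
    (fp : Yp × Ym → Yp) (fm : Yp × Ym → Ym) : Prop where
  plus : KatoFamily ιp R (-lamp) c C K bp (fun v => -Ap v)
  minus : KatoFamily ιm R lamm c C K bm Am
  zero_le_Cf : 0 ≤ Cf
  dense_plus : DenseRange ιp
  dense_minus : DenseRange ιm
  weak_plus : HasWeaklyClosedBalls ιp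
  weak_minus : HasWeaklyClosedBalls ιm
  injective_plus : Function.Injective ιp
  injective_minus : Function.Injective ιm
  continuousOn_plus : ContinuousOn fp (ball 0 R)
  continuousOn_minus : ContinuousOn fm (ball 0 R)
  norm_plus_le : ∀ v ∈ ball (0 : Yp × Ym) R, ‖fp v‖ ≤ Cf * ‖v‖
  norm_minus_le : ∀ v ∈ ball (0 : Yp × Ym) R, ‖fm v‖ ≤ Cf * ‖v‖
  lipschitz_plus : ∀ v ∈ ball (0 : Yp × Ym) R, ∀ w ∈ ball (0 : Yp × Ym) R,
    ‖ιp (fp v) - ιp (fp w)‖ ≤ Cf * ‖ιp.prodMap ιm v - ιp.prodMap ιm w‖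
  lipschitz_minus : ∀ v ∈ ball (0 : Yp × Ym) R, ∀ w ∈ ball (0 : Yp × Ym) R,
    ‖ιm (fm v) - ιm (fm w)‖ ≤ Cf * ‖ιp.prodMap ιm v - ιp.prodMap ιm w‖

/-- The contraction constant of the Lyapunov-Perron iteration at the exponential rate `μ`, with a
slack `κ`; for `κ = 0` it is the gap ratio. -/
noncomputable def gapSum (a Cf lamp lamm κ μ : ℝ) : ℝ :=
  a * (Cf + κ) / (lamp - μ - κ) + a * (Cf + κ) / (μ - lamm - κ)

/-- Bound for the velocity in `X` of a path of size `1` in `Y`. -/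
noncomputable def speedConst (c C Cf : ℝ) : ℝ := 2 * c ^ 2 * C ^ 3 + Cf

/-- The slack needed for paths of size `1` in `Y`: it covers the drift of the energy forms, the
commutators and the quasilinear difference terms. -/
noncomputable def slackConst (c C K Cf : ℝ) : ℝ :=
  2 * c ^ 2 * C ^ 3 + 2 * (c ^ 4 * C ^ 2 + K * c ^ 2 / 2) * speedConst c C Cf

variable {ιp : Yp →L[ℝ] Xp} {ιm : Ym →L[ℝ] Xm} {R c C K Cf lamp lamm : ℝ}
    {bp : Xp × Xm → Xp →L[ℝ] Xp →L[ℝ] ℝ} {bm : Xp × Xm → Xm →L[ℝ] Xm →L[ℝ] ℝ}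
    {Ap : Xp × Xm → Yp →L[ℝ] Xp} {Am : Xp × Xm → Ym →L[ℝ] Xm}
    {fp : Yp × Ym → Yp} {fm : Yp × Ym → Ym}

/-- Paths on `[-T, 0]` which can serve as coefficients: they decay in `Y` like `M e^{lam t}`, and
have velocity at most `speedConst * M` in `X`. -/
structure IsCoefficientPath (ιp : Yp →L[ℝ] Xp) (ιm : Ym →L[ℝ] Xm) (c C Cf T M lam : ℝ)
    (u : ℝ → Yp × Ym) : Prop where
  continuousOn : ContinuousOn u (Icc (-T) 0)
  norm_le : ∀ t ∈ Icc (-T) 0, ‖u t‖ ≤ M * Real.exp (lam * t)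
  hasDerivWithinAt : ∃ u' : ℝ → Xp × Xm, ∀ t ∈ Icc (-T) 0,
    HasDerivWithinAt (fun t => ιp.prodMap ιm (u t)) (u' t) (Icc (-T) 0) t ∧
      ‖u' t‖ ≤ speedConst c C Cf * M

/-- The right side `A(u) y + f(u)` of the equation, for coefficients frozen at `u`. -/
def velocity (ιp : Yp →L[ℝ] Xp) (ιm : Ym →L[ℝ] Xm)
    (Ap : Xp × Xm → Yp →L[ℝ] Xp) (Am : Xp × Xm → Ym →L[ℝ] Xm)
    (fp : Yp × Ym → Yp) (fm : Yp × Ym → Ym) (u y : Yp × Ym) : Xp × Xm :=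
  (Ap (ιp.prodMap ιm u)).prodMap (Am (ιp.prodMap ιm u)) y + ιp.prodMap ιm (fp u, fm u)

/-- Approximate solutions on `[-T, 0]`: `v' = A(u) y + f(u)`, where the coefficients are taken at
a path `u` and the operator acts on a path `y` close to `v` in `X`. All paths decay in `Y` like
`M e^{lam t}`. An exact solution has `u = y = v` and `η = 0`. -/
structure IsApproxSolution (ιp : Yp →L[ℝ] Xp) (ιm : Ym →L[ℝ] Xm) (c C Cf : ℝ)
    (Ap : Xp × Xm → Yp →L[ℝ] Xp) (Am : Xp × Xm → Ym →L[ℝ] Xm)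
    (fp : Yp × Ym → Yp) (fm : Yp × Ym → Ym) (T M η lam : ℝ) (u v y : ℝ → Yp × Ym) : Prop where
  coeff : IsCoefficientPath ιp ιm c C Cf T M lam u
  path : IsCoefficientPath ιp ιm c C Cf T M lam v
  continuousOn_y : ContinuousOn y (Icc (-T) 0)
  norm_y_le : ∀ t ∈ Icc (-T) 0, ‖y t‖ ≤ 2 * c ^ 2 * C ^ 2 * M * Real.exp (lam * t)
  norm_sub_le : ∀ t ∈ Icc (-T) 0,
    ‖ιp.prodMap ιm (v t) - ιp.prodMap ιm (y t)‖ ≤ η * Real.exp (lam * t)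
  hasDerivWithinAt : ∀ t ∈ Icc (-T) 0, HasDerivWithinAt (fun t => ιp.prodMap ιm (v t))
    (velocity ιp ιm Ap Am fp fm (u t) (y t)) (Icc (-T) 0) t

theorem HasDerivWithinAt.prod_fst {f : ℝ → Xp × Xm} {f' : Xp × Xm} {s : Set ℝ} {t : ℝ}
    (h : HasDerivWithinAt f f' s t) : HasDerivWithinAt (fun t => (f t).1) f'.1 s t :=
  (ContinuousLinearMap.fst ℝ Xp Xm).hasFDerivAt.comp_hasDerivWithinAt t h

theorem HasDerivWithinAt.prod_snd {f : ℝ → Xp × Xm} {f' : Xp × Xm} {s : Set ℝ} {t : ℝ}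
    (h : HasDerivWithinAt f f' s t) : HasDerivWithinAt (fun t => (f t).2) f'.2 s t :=
  (ContinuousLinearMap.snd ℝ Xp Xm).hasFDerivAt.comp_hasDerivWithinAt t h

theorem IsCoefficientPath.mono {T T' M lam : ℝ} {u : ℝ → Yp × Ym}
    (h : IsCoefficientPath ιp ιm c C Cf T M lam u) (hT : T' ≤ T) :
    IsCoefficientPath ιp ιm c C Cf T' M lam u := by
  have hs : Icc (-T') 0 ⊆ Icc (-T) 0 := Icc_subset_Icc (by linarith) le_rfl
  obtain ⟨u', hu'⟩ := h.hasDerivWithinAt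
  exact ⟨h.continuousOn.mono hs, fun t ht => h.norm_le t (hs ht),
    ⟨u', fun t ht => ⟨(hu' t (hs ht)).1.mono hs, (hu' t (hs ht)).2⟩⟩⟩

theorem IsApproxSolution.mono {T T' M η η' lam : ℝ} {u v y : ℝ → Yp × Ym}
    (h : IsApproxSolution ιp ιm c C Cf Ap Am fp fm T M η lam u v y) (hT : T' ≤ T) (hη : η ≤ η') :
    IsApproxSolution ιp ιm c C Cf Ap Am fp fm T' M η' lam u v y := by
  have hs : Icc (-T') 0 ⊆ Icc (-T) 0 := Icc_subset_Icc (by linarith) le_rfl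
  exact ⟨h.coeff.mono hT, h.path.mono hT, h.continuousOn_y.mono hs,
    fun t ht => h.norm_y_le t (hs ht), fun t ht => (h.norm_sub_le t (hs ht)).trans (by gcongr),
    fun t ht => (h.hasDerivWithinAt t (hs ht)).mono hs⟩

/-- The size `M` and the decay rate `lam` of the paths under consideration: `M` is so small that
the slack `κ` covers all quasilinear terms, and the spectral gap survives this slack. -/
structure SmallSize (R c C K Cf lamp lamm κ M lam : ℝ) : Prop where
  nonneg : 0 ≤ M
  lt_radius : M < R
  zero_le_rate : 0 ≤ lam
  slack : slackConst c C K Cf * M ≤ κ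
  gap_minus : lamm + κ < lam
  gap_plus : lam < lamp - κ

theorem SmallSize.norm_lt {κ M lam : ℝ} (hs : SmallSize R c C K Cf lamp lamm κ M lam)
    {t : ℝ} (ht : t ≤ 0) {x : ℝ} (hx : x ≤ M * Real.exp (lam * t)) : x < R :=
  (hx.trans (mul_le_of_le_one_right hs.nonneg (Real.exp_le_one_iff.2
    (mul_nonpos_of_nonneg_of_nonpos hs.zero_le_rate ht)))).trans_lt hs.lt_radius

namespace CoupledSystem

variable (S : CoupledSystem ιp ιm R c C K Cf lamp lamm bp bm Ap Am fp fm)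

include S

theorem norm_incl_le (v : Yp × Ym) : ‖ιp.prodMap ιm v‖ ≤ ‖v‖ :=
  max_le_max (S.plus.norm_incl_le v.1) (S.minus.norm_incl_le v.2)

theorem incl_mem_ball {v : Yp × Ym} (hv : ‖v‖ < R) :
    ιp.prodMap ιm v ∈ ball (0 : Xp × Xm) R := by
  rw [mem_ball_zero_iff]; exact (S.norm_incl_le v).trans_lt hv

theorem slack_le {M κ : ℝ} (hM : 0 ≤ M) (hκ : slackConst c C K Cf * M ≤ κ) :
    C * (2 * c ^ 2 * C ^ 2 * M) ≤ κ ∧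
      2 * (c ^ 4 * C ^ 2 + K * c ^ 2 / 2) * (speedConst c C Cf * M) ≤ κ := by
  have hc := S.plus.c_pos
  have hC := S.plus.C_pos
  have hK := S.plus.zero_le_K
  have hCf := S.zero_le_Cf
  rw [slackConst] at hκ
  have h1 : 0 ≤ 2 * (c ^ 4 * C ^ 2 + K * c ^ 2 / 2) * (speedConst c C Cf * M) := by
    rw [speedConst]; positivity
  have h2 : 0 ≤ C * (2 * c ^ 2 * C ^ 2 * M) := by positivity
  constructor <;> nlinarith

/-- Difference of two approximate solutions in the norm of `X`, at an exponential rate `μ` in the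
spectral gap: the `+` component is estimated backwards from `0`, the `-` component forwards from
`-T`. -/
theorem norm_sub_le {T M η lam μ κ D : ℝ} {u₁ v₁ y₁ u₂ v₂ y₂ : ℝ → Yp × Ym}
    (h₁ : IsApproxSolution ιp ιm c C Cf Ap Am fp fm T M η lam u₁ v₁ y₁)
    (h₂ : IsApproxSolution ιp ιm c C Cf Ap Am fp fm T M η lam u₂ v₂ y₂)
    (hs : SmallSize R c C K Cf lamp lamm κ M lam) (hμlam : μ ≤ lam) (hη : 0 ≤ η)
    (hμm : lamm + κ < μ) (hμp : μ < lamp - κ) (hD0 : 0 ≤ D)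
    (hD : ∀ t ∈ Icc (-T) 0,
      ‖ιp.prodMap ιm (u₁ t) - ιp.prodMap ιm (u₂ t)‖ ≤ D * Real.exp (μ * t)) :
    (∀ t ∈ Icc (-T) 0, ‖ιp (v₁ t).1 - ιp (v₂ t).1‖ ≤
      (c ^ 2 * ‖ιp (v₁ 0).1 - ιp (v₂ 0).1‖ + c ^ 2 * (Cf + κ) / (lamp - μ - κ) * D
        + energyError c C (-lamp) (2 * c ^ 2 * C ^ 2 * M) η (lamp - μ - κ))
        * Real.exp (μ * t)) ∧
    (∀ t ∈ Icc (-T) 0, ‖ιm (v₁ t).2 - ιm (v₂ t).2‖ ≤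
      c ^ 2 * ‖ιm (v₁ (-T)).2 - ιm (v₂ (-T)).2‖ * Real.exp ((lamm + κ) * (t + T))
      + (c ^ 2 * (Cf + κ) / (μ - lamm - κ) * D
        + energyError c C lamm (2 * c ^ 2 * C ^ 2 * M) η (μ - lamm - κ))
        * Real.exp (μ * t)) := by
  have hc := S.plus.c_pos
  have hC := S.plus.C_pos
  have hCf := S.zero_le_Cf
  have hK := S.plus.zero_le_K
  obtain ⟨hM, hMR, hlam, hκ, -, -⟩ := hs
  obtain ⟨hκ₁, hκ₂⟩ := S.slack_le hM hκ
  have hκ0 : 0 ≤ κ := le_trans (by positivity) hκ₁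
  have hκ₂' : K * (speedConst c C Cf * M) * c ^ 2 / 2 ≤ κ := by
    refine le_trans ?_ hκ₂
    have : 0 ≤ speedConst c C Cf * M := by rw [speedConst]; positivity
    have h1 : 0 ≤ c ^ 4 * C ^ 2 * (speedConst c C Cf * M) := by positivity
    have h2 : 0 ≤ K * c ^ 2 * (speedConst c C Cf * M) := by positivity
    nlinarith
  have hexp : ∀ t ∈ Icc (-T) 0, Real.exp (lam * t) ≤ Real.exp (μ * t) := fun t ht => by
    rw [Real.exp_le_exp]; nlinarith [ht.2]
  have hexp1 : ∀ t ∈ Icc (-T) 0, Real.exp (lam * t) ≤ 1 := fun t ht => by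
    rw [Real.exp_le_one_iff]; nlinarith [ht.2]
  have hb : ∀ {u : ℝ → Yp × Ym}, (∀ t ∈ Icc (-T) 0, ‖u t‖ ≤ M * Real.exp (lam * t)) →
      ∀ t ∈ Icc (-T) 0, ‖u t‖ < R := fun hu t ht =>
    ((hu t ht).trans (mul_le_of_le_one_right hM (hexp1 t ht))).trans_lt hMR
  have hu₁ := hb h₁.coeff.norm_le
  have hu₂ := hb h₂.coeff.norm_le
  have hy : ∀ {y : ℝ → Yp × Ym},
      (∀ t ∈ Icc (-T) 0, ‖y t‖ ≤ 2 * c ^ 2 * C ^ 2 * M * Real.exp (lam * t)) →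
      ∀ t ∈ Icc (-T) 0, ‖y t‖ ≤ 2 * c ^ 2 * C ^ 2 * M * Real.exp (μ * t) := fun hy t ht =>
    (hy t ht).trans (mul_le_mul_of_nonneg_left (hexp t ht) (by positivity))
  have hy₁ := hy h₁.norm_y_le
  have hy₂ := hy h₂.norm_y_le
  have hY : ∀ t ∈ Icc (-T) 0, ‖y₂ t‖ ≤ 2 * c ^ 2 * C ^ 2 * M := fun t ht =>
    (h₂.norm_y_le t ht).trans (mul_le_of_le_one_right (by positivity) (hexp1 t ht))
  have hn₁ : ∀ t ∈ Icc (-T) 0,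
      ‖ιp.prodMap ιm (v₁ t) - ιp.prodMap ιm (y₁ t)‖ ≤ η * Real.exp (μ * t) := fun t ht =>
    (h₁.norm_sub_le t ht).trans (mul_le_mul_of_nonneg_left (hexp t ht) hη)
  have hn₂ : ∀ t ∈ Icc (-T) 0,
      ‖ιp.prodMap ιm (v₂ t) - ιp.prodMap ιm (y₂ t)‖ ≤ η * Real.exp (μ * t) := fun t ht =>
    (h₂.norm_sub_le t ht).trans (mul_le_mul_of_nonneg_left (hexp t ht) hη)
  obtain ⟨u', hu'⟩ := h₁.coeff.hasDerivWithinAt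
  constructor
  · have hneg : ∀ s ∈ Icc 0 T, -s ∈ Icc (-T) 0 := fun s hs =>
      ⟨by linarith [hs.2], by linarith [hs.1]⟩
    have hmain := S.plus.norm_sub_le (a := 0) (e := T) (μ := -μ)
      (N := 2 * c ^ 2 * C ^ 2 * M) (Y₀ := 2 * c ^ 2 * C ^ 2 * M) (η := η) (D := D) (Cf := Cf)
      (κ := κ) (U := speedConst c C Cf * M)
      (u₁ := fun s => ιp.prodMap ιm (u₁ (-s))) (u₂ := fun s => ιp.prodMap ιm (u₂ (-s)))
      (u₁' := fun s => -u' (-s)) (w₁ := fun s => ιp (v₁ (-s)).1) (w₂ := fun s => ιp (v₂ (-s)).1)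
      (r₁ := fun s => -ιp (fp (u₁ (-s)))) (r₂ := fun s => -ιp (fp (u₂ (-s))))
      (y₁ := fun s => (y₁ (-s)).1) (y₂ := fun s => (y₂ (-s)).1)
      (fun s hs => S.incl_mem_ball (hu₁ _ (hneg s hs)))
      (fun s hs => S.incl_mem_ball (hu₂ _ (hneg s hs)))
      (fun s hs => hasDerivWithinAt_comp_neg (hu' _ (hneg s hs)).1)
      (fun s hs => by rw [norm_neg]; exact (hu' _ (hneg s hs)).2)
      (fun s hs => ?_) (fun s hs => ?_) (fun s hs => ?_) (fun s hs => ?_) (fun s hs => ?_)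
      (fun s hs => ?_) (fun s hs => ?_) (fun s hs => ?_) (fun s hs => ?_) hκ₁ hκ₂'
      (by linarith) hD0 hCf (by positivity) hη hκ0
    · intro t ht
      have h := hmain (-t) ⟨by linarith [ht.2], by linarith [ht.1]⟩
      simp only [neg_neg, neg_zero, sub_zero] at h
      have e1 : -μ * -t = μ * t := by ring
      have e2 : -μ - -lamp - κ = lamp - μ - κ := by ring
      rw [e1, e2] at h
      have e3 : Real.exp ((-lamp + κ) * -t) ≤ Real.exp (μ * t) := by
        rw [Real.exp_le_exp]; nlinarith [ht.2]
      exact h.trans (le_of_le_of_eq (add_le_add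
        (mul_le_mul_of_nonneg_left e3 (by positivity)) le_rfl) (by ring))
    · refine (hasDerivWithinAt_comp_neg
        (HasDerivWithinAt.prod_fst (h₁.hasDerivWithinAt _ (hneg s hs)))).congr_deriv ?_
      simp [velocity]; abel
    · refine (hasDerivWithinAt_comp_neg
        (HasDerivWithinAt.prod_fst (h₂.hasDerivWithinAt _ (hneg s hs)))).congr_deriv ?_
      simp [velocity]; abel
    · rw [neg_mul_comm]; exact (norm_fst_le _).trans (hy₁ _ (hneg s hs))
    · rw [neg_mul_comm]; exact (norm_fst_le _).trans (hy₂ _ (hneg s hs))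
    · exact (norm_fst_le _).trans (hY _ (hneg s hs))
    · rw [neg_mul_comm]; exact (norm_fst_le _).trans (hn₁ _ (hneg s hs))
    · rw [neg_mul_comm]; exact (norm_fst_le _).trans (hn₂ _ (hneg s hs))
    · rw [neg_mul_comm]; exact hD _ (hneg s hs)
    · rw [neg_mul_comm, neg_sub_neg, norm_sub_rev, mul_assoc]
      refine (S.lipschitz_plus _ (mem_ball_zero_iff.2 (hu₁ _ (hneg s hs))) _
        (mem_ball_zero_iff.2 (hu₂ _ (hneg s hs)))).trans ?_
      gcongr
      exact hD _ (hneg s hs)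
  · have hmain := S.minus.norm_sub_le (a := -T) (e := 0) (μ := μ)
      (N := 2 * c ^ 2 * C ^ 2 * M) (Y₀ := 2 * c ^ 2 * C ^ 2 * M) (η := η) (D := D) (Cf := Cf)
      (κ := κ) (U := speedConst c C Cf * M)
      (u₁ := fun s => ιp.prodMap ιm (u₁ s)) (u₂ := fun s => ιp.prodMap ιm (u₂ s))
      (u₁' := u') (w₁ := fun s => ιm (v₁ s).2) (w₂ := fun s => ιm (v₂ s).2)
      (r₁ := fun s => ιm (fm (u₁ s))) (r₂ := fun s => ιm (fm (u₂ s)))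
      (y₁ := fun s => (y₁ s).2) (y₂ := fun s => (y₂ s).2)
      (fun s hs => S.incl_mem_ball (hu₁ s hs)) (fun s hs => S.incl_mem_ball (hu₂ s hs))
      (fun s hs => (hu' s hs).1) (fun s hs => (hu' s hs).2)
      (fun s hs => ?_) (fun s hs => ?_)
      (fun s hs => (norm_snd_le _).trans (hy₁ s hs))
      (fun s hs => (norm_snd_le _).trans (hy₂ s hs))
      (fun s hs => (norm_snd_le _).trans (hY s hs))
      (fun s hs => (norm_snd_le _).trans (hn₁ s hs))
      (fun s hs => (norm_snd_le _).trans (hn₂ s hs)) hD (fun s hs => ?_) hκ₁ hκ₂'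
      hμm hD0 hCf (by positivity) hη hκ0
    · intro t ht
      refine (hmain t ht).trans (le_of_eq ?_)
      rw [sub_neg_eq_add]
    · exact (HasDerivWithinAt.prod_snd (h₁.hasDerivWithinAt s hs)).congr_deriv (by simp [velocity])
    · exact (HasDerivWithinAt.prod_snd (h₂.hasDerivWithinAt s hs)).congr_deriv (by simp [velocity])
    · rw [mul_assoc]
      refine (S.lipschitz_minus _ (mem_ball_zero_iff.2 (hu₁ s hs)) _
        (mem_ball_zero_iff.2 (hu₂ s hs))).trans ?_
      gcongr
      exact hD s hs

end CoupledSystem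

end Coupled

/-! ### Approximate solutions -/

section

section Family

variable {E X Y : Type*} [NormedAddCommGroup E] [NormedSpace ℝ E]
  [NormedAddCommGroup X] [NormedSpace ℝ X] [NormedAddCommGroup Y] [NormedSpace ℝ Y]

/-- Solution of the Yosida approximation with a slowly varying coefficient, together with its
bounds; `y = (1 - h A(u))⁻¹ w`. -/
theorem KatoFamily.exists_yosida_bounds [CompleteSpace X] [CompleteSpace Y] {ι : Y →L[ℝ] X}
    {R ω c C K : ℝ} {b : E → X →L[ℝ] X →L[ℝ] ℝ} {A : E → Y →L[ℝ] X}
    (k : KatoFamily ι R ω c C K b A) {h κ U g μ a e : ℝ} (hh : 0 < h) (hω : h * |ω| ≤ 1 / 2)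
    (hh' : h ≤ 1 / 2) (hωκ : 4 * h * ω ^ 2 ≤ κ) (hκ : 2 * (c ^ 4 * C ^ 2 + K * c ^ 2 / 2) * U ≤ κ)
    (hae : a ≤ e) {u u' : ℝ → E} {r : ℝ → Y}
    (hu : ∀ t ∈ Icc a e, u t ∈ ball (0 : E) R)
    (hud : ∀ t ∈ Icc a e, HasDerivWithinAt u (u' t) (Icc a e) t)
    (hU : ∀ t ∈ Icc a e, ‖u' t‖ ≤ U) (hrc : ContinuousOn r (Icc a e))
    (hr : ∀ t ∈ Icc a e, ‖r t‖ ≤ g * Real.exp (μ * t)) (hμ : ω + κ < μ) (hg : 0 ≤ g) (w₀ : Y) :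
    ∃ w y : ℝ → Y, w a = w₀ ∧ ContinuousOn w (Icc a e) ∧ ContinuousOn y (Icc a e) ∧
      ∀ t ∈ Icc a e,
        ‖w t‖ ≤ (c * C) ^ 2 * (‖w₀‖ * Real.exp ((ω + κ) * (t - a))
          + g / (μ - (ω + κ)) * Real.exp (μ * t)) ∧
        ‖y t‖ ≤ 2 * c ^ 2 * C ^ 2 * ‖w t‖ ∧
        ‖ι (w t) - ι (y t)‖ ≤ h * (2 * c ^ 2 * C ^ 3 * ‖w t‖) ∧
        HasDerivWithinAt (fun t => ι (w t)) (A (u t) (y t) + ι (r t)) (Icc a e) t := by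
  have huc : ContinuousOn u (Icc a e) := fun t ht => (hud t ht).continuousWithinAt
  obtain ⟨w, hwa, hw⟩ := k.exists_yosida hh hω hh' hae hu huc hrc w₀
  have hwc : ContinuousOn w (Icc a e) := fun t ht => (hw t ht).continuousWithinAt
  have hJ : ContinuousOn (fun t => resolvent ι h (A (u t))) (Icc a e) :=
    (k.contDiffOn_resolvent hh hω hh').continuousOn.comp huc hu
  refine ⟨w, fun t => resolvent ι h (A (u t)) (ι (w t)), hwa, hwc,
    hJ.clm_apply (ι.continuous.comp_continuousOn hwc), fun t ht => ⟨?_,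
    k.norm_resolvent_incl_le (hu t ht) hh hω hh' _,
    k.norm_incl_resolvent_incl_sub_le (hu t ht) hh hω hh' _, ?_⟩⟩
  · rw [← hwa]
    exact k.norm_le_of_yosida hh hω hh' hu hud hU hw hr (by nlinarith) hμ hg t ht
  · rw [k.op_resolvent (hu t ht) hh hω hh', ← map_sub, ← map_smul, ← map_add]
    exact ι.hasFDerivAt.comp_hasDerivWithinAt t (hw t ht)

end Family

variable {Xp Xm Yp Ym : Type*}
  [NormedAddCommGroup Xp] [NormedSpace ℝ Xp] [NormedAddCommGroup Xm] [NormedSpace ℝ Xm]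
  [NormedAddCommGroup Yp] [NormedSpace ℝ Yp] [NormedAddCommGroup Ym] [NormedSpace ℝ Ym]
  {ιp : Yp →L[ℝ] Xp} {ιm : Ym →L[ℝ] Xm} {R c C K Cf lamp lamm : ℝ}
  {bp : Xp × Xm → Xp →L[ℝ] Xp →L[ℝ] ℝ} {bm : Xp × Xm → Xm →L[ℝ] Xm →L[ℝ] ℝ}
  {Ap : Xp × Xm → Yp →L[ℝ] Xp} {Am : Xp × Xm → Ym →L[ℝ] Xm}
  {fp : Yp × Ym → Yp} {fm : Yp × Ym → Ym}

namespace CoupledSystem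

variable (S : CoupledSystem ιp ιm R c C K Cf lamp lamm bp bm Ap Am fp fm)

include S

theorem norm_velocity_le {u y : Yp × Ym} (hu : ‖u‖ < R) :
    ‖velocity ιp ιm Ap Am fp fm u y‖ ≤ C * ‖y‖ + Cf * ‖u‖ := by
  have hu' := mem_ball_zero_iff.2 hu
  have hb := S.incl_mem_ball hu
  refine (norm_add_le _ _).trans (add_le_add (max_le ?_ ?_) (max_le ?_ ?_))
  · have h1 := (Ap (ιp.prodMap ιm u)).le_of_opNorm_le
      ((norm_neg _).symm.trans_le (S.plus.norm_le _ hb)) y.1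
    exact h1.trans (mul_le_mul_of_nonneg_left (norm_fst_le y) S.plus.C_pos.le)
  · exact ((Am (ιp.prodMap ιm u)).le_of_opNorm_le (S.minus.norm_le _ hb) y.2).trans
      (mul_le_mul_of_nonneg_left (norm_snd_le y) S.plus.C_pos.le)
  · exact (S.plus.norm_incl_le _).trans (S.norm_plus_le u hu')
  · exact (S.minus.norm_incl_le _).trans (S.norm_minus_le u hu')

theorem gap_terms_nonneg {κ M lam : ℝ} (hs : SmallSize R c C K Cf lamp lamm κ M lam) {a : ℝ}
    (ha : 0 ≤ a) : 0 ≤ κ ∧ 0 ≤ a * (Cf + κ) / (lamp - lam - κ) ∧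
      0 ≤ a * (Cf + κ) / (lam - lamm - κ) := by
  have hc := S.plus.c_pos
  have hC := S.plus.C_pos
  have hCf := S.zero_le_Cf
  have hκ : 0 ≤ κ := le_trans (by have := hs.nonneg; positivity) (S.slack_le hs.nonneg hs.slack).1
  have h1 := hs.gap_minus
  have h2 := hs.gap_plus
  exact ⟨hκ, div_nonneg (by positivity) (by linarith), div_nonneg (by positivity) (by linarith)⟩

/-- One step of the approximation scheme: the Yosida approximation of the linear equation with
coefficients at a path `u`, with `v_+(0) = v₀` and `v_-(-T) = 0`. -/
theorem exists_step [CompleteSpace Xp] [CompleteSpace Xm] [CompleteSpace Yp] [CompleteSpace Ym]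
    {T M lam κ h : ℝ} {u : ℝ → Yp × Ym} (hs : SmallSize R c C K Cf lamp lamm κ M lam)
    (hT : 0 ≤ T) (hh : 0 < h) (hp : h * |lamp| ≤ 1 / 2) (hm : h * |lamm| ≤ 1 / 2) (hh' : h ≤ 1 / 2)
    (hp' : 4 * h * lamp ^ 2 ≤ κ) (hm' : 4 * h * lamm ^ 2 ≤ κ)
    (hu : IsCoefficientPath ιp ιm c C Cf T M lam u) {v₀ : Yp}
    (hv₀ : (c * C) ^ 2 * ‖v₀‖ + gapSum ((c * C) ^ 2) Cf lamp lamm κ lam * M ≤ M) :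
    ∃ v y, IsApproxSolution ιp ιm c C Cf Ap Am fp fm T M (h * (2 * c ^ 2 * C ^ 3 * M)) lam u v y ∧
      (v 0).1 = v₀ ∧ (v (-T)).2 = 0 ∧ ∀ t ∈ Icc (-T) 0,
        ‖(v t).2‖ ≤ gapSum ((c * C) ^ 2) Cf lamp lamm κ lam * M * Real.exp (lam * t) := by
  have hc := S.plus.c_pos
  have hC := S.plus.C_pos
  have hCf := S.zero_le_Cf
  have hM := hs.nonneg
  obtain ⟨hκ, hθp, hθm⟩ := S.gap_terms_nonneg hs (a := (c * C) ^ 2) (by positivity)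
  obtain ⟨hκ₁, hκ₂⟩ := S.slack_le hs.nonneg hs.slack
  have hgm := hs.gap_minus
  have hgp := hs.gap_plus
  have hneg : ∀ s ∈ Icc 0 T, -s ∈ Icc (-T) 0 := fun s hs =>
    ⟨by linarith [hs.2], by linarith [hs.1]⟩
  have hneg' : ∀ s ∈ Icc (-T) 0, -s ∈ Icc 0 T := fun s hs =>
    ⟨by linarith [hs.2], by linarith [hs.1]⟩
  have hnegc : ContinuousOn (fun s : ℝ => -s) (Icc 0 T) := continuous_neg.continuousOn
  have hnegc' : ContinuousOn (fun s : ℝ => -s) (Icc (-T) 0) := continuous_neg.continuousOn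
  have huR : ∀ t ∈ Icc (-T) 0, ‖u t‖ < R := fun t ht => hs.norm_lt ht.2 (hu.norm_le t ht)
  have huR' : ∀ t ∈ Icc (-T) 0, u t ∈ ball 0 R := fun t ht => mem_ball_zero_iff.2 (huR t ht)
  obtain ⟨u', hu'⟩ := hu.hasDerivWithinAt
  have hfp : ContinuousOn (fun t => fp (u t)) (Icc (-T) 0) :=
    S.continuousOn_plus.comp hu.continuousOn huR'
  have hfm : ContinuousOn (fun t => fm (u t)) (Icc (-T) 0) :=
    S.continuousOn_minus.comp hu.continuousOn huR'
  -- the `+` component is solved backwards from `0`, in the time `s = -t`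
  obtain ⟨wp, yp, hwp0, hwpc, hypc, hwp⟩ := S.plus.exists_yosida_bounds (a := 0) (e := T)
    (μ := -lam) (g := Cf * M) (r := fun s => -fp (u (-s))) (u := fun s => ιp.prodMap ιm (u (-s)))
    (u' := fun s => -u' (-s)) hh (by rwa [abs_neg]) hh' (by rwa [neg_sq]) hκ₂ hT
    (fun s hs => S.incl_mem_ball (huR _ (hneg s hs)))
    (fun s hs => hasDerivWithinAt_comp_neg (hu' _ (hneg s hs)).1)
    (fun s hs => by rw [norm_neg]; exact (hu' _ (hneg s hs)).2)
    (hfp.comp hnegc hneg).neg (fun s hs => by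
      rw [norm_neg, neg_mul_comm, mul_assoc]
      exact (S.norm_plus_le _ (huR' _ (hneg s hs))).trans
        (mul_le_mul_of_nonneg_left (hu.norm_le _ (hneg s hs)) hCf))
    (by linarith) (by positivity) v₀
  obtain ⟨wm, ym, hwm0, hwmc, hymc, hwm⟩ := S.minus.exists_yosida_bounds (a := -T) (e := 0)
    (μ := lam) (g := Cf * M) (r := fun s => fm (u s)) (u := fun s => ιp.prodMap ιm (u s))
    (u' := u') hh hm hh' hm' hκ₂ (by linarith)
    (fun s hs => S.incl_mem_ball (huR _ hs))
    (fun s hs => (hu' _ hs).1) (fun s hs => (hu' _ hs).2)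
    hfm (fun s hs => by
      rw [mul_assoc]
      exact (S.norm_minus_le _ (huR' _ hs)).trans
        (mul_le_mul_of_nonneg_left (hu.norm_le _ hs) hCf))
    (by linarith) (by positivity) 0
  have hterm : ∀ {d : ℝ}, 0 < d → (c * C) ^ 2 * (Cf * M / d) ≤ (c * C) ^ 2 * (Cf + κ) / d * M := by
    intro d hd
    rw [← mul_div_assoc, div_mul_eq_mul_div, div_le_div_iff_of_pos_right hd]
    have : 0 ≤ (c * C) ^ 2 * κ * M := by positivity
    linarith
  have hwpM : ∀ t ∈ Icc (-T) 0, ‖wp (-t)‖ ≤ M * Real.exp (lam * t) := fun t ht => by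
    refine (hwp _ (hneg' t ht)).1.trans ?_
    have e1 : Real.exp ((-lamp + κ) * (-t - 0)) ≤ Real.exp (lam * t) := by
      rw [Real.exp_le_exp]; nlinarith [ht.2]
    rw [neg_mul_neg, show -lam - (-lamp + κ) = lamp - lam - κ by ring]
    have e2 := hterm (d := lamp - lam - κ) (by linarith)
    calc _ ≤ (c * C) ^ 2 * (‖v₀‖ * Real.exp (lam * t)
          + Cf * M / (lamp - lam - κ) * Real.exp (lam * t)) := by gcongr
      _ = ((c * C) ^ 2 * ‖v₀‖ + (c * C) ^ 2 * (Cf * M / (lamp - lam - κ)))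
          * Real.exp (lam * t) := by ring
      _ ≤ M * Real.exp (lam * t) := by
        gcongr
        rw [gapSum] at hv₀
        nlinarith [mul_nonneg hθm hM]
  have hwmM : ∀ t ∈ Icc (-T) 0,
      ‖wm t‖ ≤ gapSum ((c * C) ^ 2) Cf lamp lamm κ lam * M * Real.exp (lam * t) := fun t ht => by
    refine (hwm t ht).1.trans ?_
    rw [norm_zero, zero_mul, zero_add, ← sub_sub, ← mul_assoc]
    have e2 := hterm (d := lam - lamm - κ) (by linarith)
    rw [gapSum]
    refine mul_le_mul_of_nonneg_right ?_ (Real.exp_pos _).le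
    nlinarith [mul_nonneg hθp hM]
  have hwmM' : ∀ t ∈ Icc (-T) 0, ‖wm t‖ ≤ M * Real.exp (lam * t) := fun t ht =>
    (hwmM t ht).trans (mul_le_mul_of_nonneg_right
      (by nlinarith [mul_nonneg (sq_nonneg (c * C)) (norm_nonneg v₀)]) (Real.exp_pos _).le)
  have hyM : ∀ t ∈ Icc (-T) 0,
      ‖(yp (-t), ym t)‖ ≤ 2 * c ^ 2 * C ^ 2 * M * Real.exp (lam * t) := fun t ht => by
    refine max_le ?_ ?_
    · refine (hwp _ (hneg' t ht)).2.1.trans ?_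
      rw [mul_assoc _ M]
      exact mul_le_mul_of_nonneg_left (hwpM t ht) (by positivity)
    · refine (hwm t ht).2.1.trans ?_
      rw [mul_assoc _ M]
      exact mul_le_mul_of_nonneg_left (hwmM' t ht) (by positivity)
  have hderiv : ∀ t ∈ Icc (-T) 0, HasDerivWithinAt (fun t => ιp.prodMap ιm (wp (-t), wm t))
      (velocity ιp ιm Ap Am fp fm (u t) (yp (-t), ym t)) (Icc (-T) 0) t := fun t ht => by
    have h1 : HasDerivWithinAt (fun t => ιp (wp (-t)))
        (Ap (ιp.prodMap ιm (u t)) (yp (-t)) + ιp (fp (u t))) (Icc (-T) 0) t := by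
      have h2 := (hwp _ (hneg' t ht)).2.2.2
      have h3 := HasDerivWithinAt.scomp t h2 (hasDerivAt_neg t).hasDerivWithinAt hneg'
      refine h3.congr_deriv ?_
      simp
    exact (h1.prodMk (hwm t ht).2.2.2).congr_deriv (by simp [velocity])
  refine ⟨fun t => (wp (-t), wm t), fun t => (yp (-t), ym t), ⟨hu,
    ⟨(hwpc.comp hnegc' hneg').prodMk hwmc, fun t ht => max_le (hwpM t ht) (hwmM' t ht),
    ⟨_, fun t ht => ⟨hderiv t ht, ?_⟩⟩⟩, (hypc.comp hnegc' hneg').prodMk hymc, hyM, ?_, hderiv⟩,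
    by simpa using hwp0, hwm0, hwmM⟩
  · have hexp : Real.exp (lam * t) ≤ 1 := Real.exp_le_one_iff.2
      (mul_nonpos_of_nonneg_of_nonpos hs.zero_le_rate ht.2)
    refine (S.norm_velocity_le (huR t ht)).trans ?_
    calc _ ≤ C * (2 * c ^ 2 * C ^ 2 * M * 1) + Cf * (M * 1) := by
          gcongr
          · exact (hyM t ht).trans (by gcongr)
          · exact (hu.norm_le t ht).trans (by gcongr)
      _ = _ := by rw [speedConst]; ring
  · intro t ht
    refine max_le ?_ ?_
    · refine (hwp _ (hneg' t ht)).2.2.1.trans ?_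
      rw [mul_assoc h, mul_assoc _ M]
      exact mul_le_mul_of_nonneg_left (mul_le_mul_of_nonneg_left (hwpM t ht) (by positivity)) hh.le
    · refine (hwm t ht).2.2.1.trans ?_
      rw [mul_assoc h, mul_assoc _ M]
      exact mul_le_mul_of_nonneg_left (mul_le_mul_of_nonneg_left (hwmM' t ht) (by positivity)) hh.le

end CoupledSystem

end

section

theorem energyError_nonneg {c C ω N η gap : ℝ} (hc : 0 ≤ c) (hgap : 0 ≤ gap) :
    0 ≤ energyError c C ω N η gap := by
  unfold energyError; positivity

/-- The error of both components in the difference of two approximate solutions. -/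
noncomputable def pairError (c C lamp lamm κ N η μ : ℝ) : ℝ :=
  energyError c C (-lamp) N η (lamp - μ - κ) + energyError c C lamm N η (μ - lamm - κ)

theorem tendsto_pairError (c C lamp lamm κ N μ : ℝ) :
    Tendsto (fun η => pairError c C lamp lamm κ N η μ) (𝓝 0) (𝓝 0) := by
  have h := ((continuous_energyError c C (-lamp) N (lamp - μ - κ)).add
    (continuous_energyError c C lamm N (μ - lamm - κ))).tendsto 0
  simpa [pairError, energyError_zero, Pi.add_def] using h

variable {Xp Xm Yp Ym : Type*}
  [NormedAddCommGroup Xp] [NormedSpace ℝ Xp] [NormedAddCommGroup Xm] [NormedSpace ℝ Xm]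
  [NormedAddCommGroup Yp] [NormedSpace ℝ Yp] [NormedAddCommGroup Ym] [NormedSpace ℝ Ym]
  {ιp : Yp →L[ℝ] Xp} {ιm : Ym →L[ℝ] Xm} {R c C K Cf lamp lamm : ℝ}
  {bp : Xp × Xm → Xp →L[ℝ] Xp →L[ℝ] ℝ} {bm : Xp × Xm → Xm →L[ℝ] Xm →L[ℝ] ℝ}
  {Ap : Xp × Xm → Yp →L[ℝ] Xp} {Am : Xp × Xm → Ym →L[ℝ] Xm}
  {fp : Yp × Ym → Yp} {fm : Yp × Ym → Ym}

theorem isCoefficientPath_zero {T M lam : ℝ} (hC : 0 ≤ C) (hCf : 0 ≤ Cf)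
    (hM : 0 ≤ M) : IsCoefficientPath ιp ιm c C Cf T M lam 0 :=
  ⟨continuousOn_const, fun t _ => by simp; positivity, ⟨0, fun t _ => ⟨by
    simp only [Pi.zero_apply, map_zero]
    exact hasDerivWithinAt_const _ _ _, by
    simp only [Pi.zero_apply, norm_zero, speedConst]; positivity⟩⟩⟩

namespace CoupledSystem

variable (S : CoupledSystem ιp ιm R c C K Cf lamp lamm bp bm Ap Am fp fm)

include S

/-- Difference of two approximate solutions in the maximum norm of both components. The bound `β`
covers the boundary values: those of the `+` component at `0`, those of the `-` component at `-T`.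
-/
theorem norm_pair_sub_le {T M η lam μ κ D β : ℝ} {u₁ v₁ y₁ u₂ v₂ y₂ : ℝ → Yp × Ym}
    (h₁ : IsApproxSolution ιp ιm c C Cf Ap Am fp fm T M η lam u₁ v₁ y₁)
    (h₂ : IsApproxSolution ιp ιm c C Cf Ap Am fp fm T M η lam u₂ v₂ y₂)
    (hs : SmallSize R c C K Cf lamp lamm κ M lam) (hμlam : μ ≤ lam) (hη : 0 ≤ η)
    (hμm : lamm + κ < μ) (hμp : μ < lamp - κ) (hD0 : 0 ≤ D)
    (hD : ∀ t ∈ Icc (-T) 0,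
      ‖ιp.prodMap ιm (u₁ t) - ιp.prodMap ιm (u₂ t)‖ ≤ D * Real.exp (μ * t))
    (hβp : c ^ 2 * ‖ιp (v₁ 0).1 - ιp (v₂ 0).1‖ ≤ β)
    (hβm : c ^ 2 * ‖ιm (v₁ (-T)).2 - ιm (v₂ (-T)).2‖ * Real.exp (μ * T) ≤ β) :
    ∀ t ∈ Icc (-T) 0, ‖ιp.prodMap ιm (v₁ t) - ιp.prodMap ιm (v₂ t)‖ ≤
      (β + gapSum ((c * C) ^ 2) Cf lamp lamm κ μ * D
        + pairError c C lamp lamm κ (2 * c ^ 2 * C ^ 2 * M) η μ) * Real.exp (μ * t) := by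
  intro t ht
  have hc := S.plus.c_pos
  have hCf := S.zero_le_Cf
  obtain ⟨hκ, -, -⟩ := S.gap_terms_nonneg hs (a := (c * C) ^ 2) (by positivity)
  obtain ⟨hp, hm⟩ := S.norm_sub_le h₁ h₂ hs hμlam hη hμm hμp hD0 hD
  have ep : 0 ≤ energyError c C (-lamp) (2 * c ^ 2 * C ^ 2 * M) η (lamp - μ - κ) :=
    energyError_nonneg hc.le (by linarith)
  have em : 0 ≤ energyError c C lamm (2 * c ^ 2 * C ^ 2 * M) η (μ - lamm - κ) :=
    energyError_nonneg hc.le (by linarith)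
  have hcC : c ^ 2 ≤ (c * C) ^ 2 := by
    rw [mul_pow]
    exact le_mul_of_one_le_right (by positivity) (one_le_pow₀ S.plus.one_le_C)
  have hdiv : ∀ {d : ℝ}, 0 < d →
      c ^ 2 * (Cf + κ) / d * D ≤ (c * C) ^ 2 * (Cf + κ) / d * D ∧
        0 ≤ (c * C) ^ 2 * (Cf + κ) / d * D := fun hd => ⟨by gcongr, by positivity⟩
  obtain ⟨dp, dp0⟩ := hdiv (d := lamp - μ - κ) (by linarith)
  obtain ⟨dm, dm0⟩ := hdiv (d := μ - lamm - κ) (by linarith)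
  rw [pairError, gapSum]
  refine max_le ?_ ?_
  · refine (hp t ht).trans (mul_le_mul_of_nonneg_right ?_ (Real.exp_pos _).le)
    linarith
  · have e1 : Real.exp ((lamm + κ) * (t + T)) ≤ Real.exp (μ * T) * Real.exp (μ * t) := by
      rw [← Real.exp_add, Real.exp_le_exp]; nlinarith [ht.1]
    have e2 : c ^ 2 * ‖ιm (v₁ (-T)).2 - ιm (v₂ (-T)).2‖ * Real.exp ((lamm + κ) * (t + T))
        ≤ β * Real.exp (μ * t) :=
      (mul_le_mul_of_nonneg_left e1 (by positivity)).trans (by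
        rw [← mul_assoc]; exact mul_le_mul_of_nonneg_right hβm (Real.exp_pos _).le)
    refine (hm t ht).trans ((add_le_add_left e2 _).trans ?_)
    rw [← add_mul]
    refine mul_le_mul_of_nonneg_right ?_ (Real.exp_pos _).le
    linarith

/-- Approximate solutions of any accuracy: iterate the approximation scheme, a contraction in the
norm of `X` up to an error which is small with the step `h`. -/
theorem exists_approxSolution [CompleteSpace Xp] [CompleteSpace Xm] [CompleteSpace Yp]
    [CompleteSpace Ym] {T M lam κ e : ℝ} (hs : SmallSize R c C K Cf lamp lamm κ M lam)
    (hκ : 0 < κ) (hT : 0 ≤ T) (he : 0 < e)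
    (hθ : gapSum ((c * C) ^ 2) Cf lamp lamm κ lam < 1) {v₀ : Yp}
    (hv₀ : (c * C) ^ 2 * ‖v₀‖ + gapSum ((c * C) ^ 2) Cf lamp lamm κ lam * M ≤ M) :
    ∃ u v y, IsApproxSolution ιp ιm c C Cf Ap Am fp fm T M e lam u v y ∧
      (∀ t ∈ Icc (-T) 0,
        ‖ιp.prodMap ιm (u t) - ιp.prodMap ιm (v t)‖ ≤ e * Real.exp (lam * t)) ∧
      (v 0).1 = v₀ ∧ ∀ t ∈ Icc (-T) 0,
        ‖(v t).2‖ ≤ gapSum ((c * C) ^ 2) Cf lamp lamm κ lam * M * Real.exp (lam * t) := by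
  set θ := gapSum ((c * C) ^ 2) Cf lamp lamm κ lam with hθdef
  have hc := S.plus.c_pos
  have hC := S.plus.C_pos
  have hCf := S.zero_le_Cf
  have hM := hs.nonneg
  have hθ0 : 0 ≤ θ := by
    obtain ⟨-, h1, h2⟩ := S.gap_terms_nonneg hs (a := (c * C) ^ 2) (by positivity)
    exact add_nonneg h1 h2
  -- choose the step
  have hev : ∀ᶠ h in 𝓝[>] (0 : ℝ), h * |lamp| ≤ 1 / 2 ∧ h * |lamm| ≤ 1 / 2 ∧ h ≤ 1 / 2 ∧
      4 * h * lamp ^ 2 ≤ κ ∧ 4 * h * lamm ^ 2 ≤ κ ∧ h * (2 * c ^ 2 * C ^ 3 * M) ≤ e ∧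
      pairError c C lamp lamm κ (2 * c ^ 2 * C ^ 2 * M) (h * (2 * c ^ 2 * C ^ 3 * M)) lam
        ≤ (1 - θ) * (e / 2) := by
    have key : ∀ {f : ℝ → ℝ} {x : ℝ}, Tendsto f (𝓝 0) (𝓝 0) → 0 < x →
        ∀ᶠ h in 𝓝[>] (0 : ℝ), f h ≤ x := fun hf hx =>
      ((hf.mono_left nhdsWithin_le_nhds).eventually (gt_mem_nhds hx)).mono fun _ h => h.le
    have hlin : ∀ {f : ℝ → ℝ}, Continuous f → f 0 = 0 → Tendsto f (𝓝 0) (𝓝 0) := fun hf h0 => by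
      simpa [h0] using hf.tendsto 0
    have hx : 0 < (1 - θ) * (e / 2) := mul_pos (by linarith) (by linarith)
    filter_upwards [key (hlin (f := fun h => h * |lamp|) (by fun_prop) (by simp)) one_half_pos,
      key (hlin (f := fun h => h * |lamm|) (by fun_prop) (by simp)) one_half_pos,
      key (hlin (f := fun h => h) (by fun_prop) rfl) one_half_pos,
      key (hlin (f := fun h => 4 * h * lamp ^ 2) (by fun_prop) (by simp)) hκ,
      key (hlin (f := fun h => 4 * h * lamm ^ 2) (by fun_prop) (by simp)) hκ,
      key (hlin (f := fun h => h * (2 * c ^ 2 * C ^ 3 * M)) (by fun_prop) (by simp)) he,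
      key ((tendsto_pairError c C lamp lamm κ (2 * c ^ 2 * C ^ 2 * M) lam).comp
        (hlin (f := fun h => h * (2 * c ^ 2 * C ^ 3 * M)) (by fun_prop) (by simp))) hx]
      with h h1 h2 h3 h4 h5 h6 h7 using ⟨h1, h2, h3, h4, h5, h6, h7⟩
  obtain ⟨h, ⟨h1, h2, h3, h4, h5, h6, h7⟩, hh⟩ := (hev.and self_mem_nhdsWithin).exists
  have hstep := fun u (hu : IsCoefficientPath ιp ιm c C Cf T M lam u) =>
    S.exists_step hs hT hh h1 h2 h3 h4 h5 hu hv₀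
  -- the successive differences
  have hiter : ∀ n : ℕ, ∃ u v y, IsApproxSolution ιp ιm c C Cf Ap Am fp fm T M
      (h * (2 * c ^ 2 * C ^ 3 * M)) lam u v y ∧
      (∀ t ∈ Icc (-T) 0, ‖ιp.prodMap ιm (u t) - ιp.prodMap ιm (v t)‖
        ≤ (θ ^ n * (2 * M) + e / 2) * Real.exp (lam * t)) ∧
      (v 0).1 = v₀ ∧ (v (-T)).2 = 0 ∧ ∀ t ∈ Icc (-T) 0,
        ‖(v t).2‖ ≤ θ * M * Real.exp (lam * t) := by
    intro n
    induction n with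
    | zero =>
      have hz := isCoefficientPath_zero (c := c) (ιp := ιp) (ιm := ιm) (T := T) (lam := lam)
        hC.le hCf hM
      obtain ⟨v, y, ha, hv⟩ := hstep _ hz
      refine ⟨_, v, y, ha, fun t ht => ?_, hv⟩
      rw [← map_sub]
      calc _ ≤ ‖(0 : ℝ → Yp × Ym) t - v t‖ := S.norm_incl_le _
        _ ≤ M * Real.exp (lam * t) + M * Real.exp (lam * t) :=
          (_root_.norm_sub_le _ _).trans (add_le_add (hz.norm_le t ht) (ha.path.norm_le t ht))
        _ ≤ _ := by
          rw [pow_zero, ← add_mul]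
          exact mul_le_mul_of_nonneg_right (by linarith) (Real.exp_pos _).le
    | succ n ih =>
      obtain ⟨u, v, y, ha, hd, hv0, hvT, -⟩ := ih
      obtain ⟨w, z, hb, hw0, hwT, hw⟩ := hstep v ha.path
      refine ⟨v, w, z, hb, fun t ht => ?_, hw0, hwT, hw⟩
      refine (S.norm_pair_sub_le ha hb hs le_rfl (by positivity) hs.gap_minus hs.gap_plus
        (D := θ ^ n * (2 * M) + e / 2) (by positivity) hd (β := 0) (by simp [hv0, hw0])
        (by simp [hvT, hwT]) t ht).trans ?_
      refine mul_le_mul_of_nonneg_right ?_ (Real.exp_pos _).le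
      rw [← hθdef, pow_succ θ n]
      linarith
  have hlim : Tendsto (fun n => θ ^ n * (2 * M)) atTop (𝓝 0) := by
    simpa using (tendsto_pow_atTop_nhds_zero_of_lt_one hθ0 hθ).mul_const (2 * M)
  obtain ⟨n, hn⟩ := (hlim.eventually (gt_mem_nhds (half_pos he))).exists
  obtain ⟨u, v, y, ha, hd, hv0, -, hv⟩ := hiter n
  exact ⟨u, v, y, ha.mono le_rfl h6, fun t ht => (hd t ht).trans
    (mul_le_mul_of_nonneg_right (by linarith) (Real.exp_pos _).le), hv0, hv⟩

end CoupledSystem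

end

/-! ### The limit of the approximate solutions -/

section

theorem HasWeaklyClosedBalls.prodMap {Xp Xm Yp Ym : Type*}
    [NormedAddCommGroup Xp] [NormedSpace ℝ Xp] [NormedAddCommGroup Xm] [NormedSpace ℝ Xm]
    [NormedAddCommGroup Yp] [NormedSpace ℝ Yp] [NormedAddCommGroup Ym] [NormedSpace ℝ Ym]
    {ιp : Yp →L[ℝ] Xp} {ιm : Ym →L[ℝ] Xm} (hp : HasWeaklyClosedBalls ιp)
    (hm : HasWeaklyClosedBalls ιm) : HasWeaklyClosedBalls (ιp.prodMap ιm) := by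
  intro y x M hM hx
  obtain ⟨yp, hyp, hypM, hypf⟩ := hp (fun n => (y n).1) x.1 M
    (fun n => (norm_fst_le _).trans (hM n)) ((continuous_fst.tendsto _).comp hx)
  obtain ⟨ym, hym, hymM, hymf⟩ := hm (fun n => (y n).2) x.2 M
    (fun n => (norm_snd_le _).trans (hM n)) ((continuous_snd.tendsto _).comp hx)
  refine ⟨(yp, ym), Prod.ext hyp hym, max_le hypM hymM, fun f => ?_⟩
  have h := (hypf (f ∘L ContinuousLinearMap.inl ℝ Yp Ym)).add
    (hymf (f ∘L ContinuousLinearMap.inr ℝ Yp Ym))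
  simpa [← map_add] using h

/-- A bound which improves itself by a contraction holds with the fixed point of the contraction. -/
theorem le_of_contraction {α : Type*} {s : Set α} {f g : α → ℝ} {θ β D₀ : ℝ} (hθ0 : 0 ≤ θ)
    (hθ1 : θ < 1) (hβ : 0 ≤ β) (hD₀ : 0 ≤ D₀) (hg : ∀ x ∈ s, 0 ≤ g x)
    (h0 : ∀ x ∈ s, f x ≤ D₀ * g x)
    (hstep : ∀ D ≥ 0, (∀ x ∈ s, f x ≤ D * g x) → ∀ x ∈ s, f x ≤ (β + θ * D) * g x) :
    ∀ x ∈ s, f x ≤ β / (1 - θ) * g x := by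
  have h1 : 0 < 1 - θ := by linarith
  have hq : 0 ≤ β / (1 - θ) := by positivity
  have hn : ∀ n : ℕ, ∀ x ∈ s, f x ≤ (β / (1 - θ) + θ ^ n * D₀) * g x := by
    intro n
    induction n with
    | zero =>
      intro x hx
      refine (h0 x hx).trans (mul_le_mul_of_nonneg_right ?_ (hg x hx))
      rw [pow_zero]; linarith
    | succ n ih =>
      intro x hx
      refine (hstep _ (by positivity) ih x hx).trans (le_of_eq ?_)
      field_simp
      ring
  intro x hx
  refine ge_of_tendsto' (x := atTop) ?_ fun n => hn n x hx
  have h2 := (((tendsto_pow_atTop_nhds_zero_of_lt_one hθ0 hθ1).mul_const D₀).const_add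
    (β / (1 - θ))).mul_const (g x)
  simpa using h2

variable {Xp Xm Yp Ym : Type*}
  [NormedAddCommGroup Xp] [NormedSpace ℝ Xp] [NormedAddCommGroup Xm] [NormedSpace ℝ Xm]
  [NormedAddCommGroup Yp] [NormedSpace ℝ Yp] [NormedAddCommGroup Ym] [NormedSpace ℝ Ym]
  {ιp : Yp →L[ℝ] Xp} {ιm : Ym →L[ℝ] Xm} {R c C K Cf lamp lamm : ℝ}
  {bp : Xp × Xm → Xp →L[ℝ] Xp →L[ℝ] ℝ} {bm : Xp × Xm → Xm →L[ℝ] Xm →L[ℝ] ℝ}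
  {Ap : Xp × Xm → Yp →L[ℝ] Xp} {Am : Xp × Xm → Ym →L[ℝ] Xm}
  {fp : Yp × Ym → Yp} {fm : Yp × Ym → Ym}

namespace CoupledSystem

variable (S : CoupledSystem ιp ιm R c C K Cf lamp lamm bp bm Ap Am fp fm)

include S

/-- Two approximate solutions with the same `+` component at `0` are close at a rate `μ < lam`:
the boundary values at `-T` contribute a term of order `e^{-(lam - μ) T}`. -/
theorem norm_approx_sub_le {T M e lam μ κ : ℝ} {u₁ v₁ y₁ u₂ v₂ y₂ : ℝ → Yp × Ym}
    (h₁ : IsApproxSolution ιp ιm c C Cf Ap Am fp fm T M e lam u₁ v₁ y₁)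
    (h₂ : IsApproxSolution ιp ιm c C Cf Ap Am fp fm T M e lam u₂ v₂ y₂)
    (hd₁ : ∀ t ∈ Icc (-T) 0,
        ‖ιp.prodMap ιm (u₁ t) - ιp.prodMap ιm (v₁ t)‖ ≤ e * Real.exp (lam * t))
    (hd₂ : ∀ t ∈ Icc (-T) 0,
        ‖ιp.prodMap ιm (u₂ t) - ιp.prodMap ιm (v₂ t)‖ ≤ e * Real.exp (lam * t))
    (hs : SmallSize R c C K Cf lamp lamm κ M lam) (hμlam : μ ≤ lam) (he : 0 ≤ e) (hT : 0 ≤ T)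
    (hμm : lamm + κ < μ) (hθ : gapSum ((c * C) ^ 2) Cf lamp lamm κ μ < 1)
    (h0 : (v₁ 0).1 = (v₂ 0).1) :
    ∀ t ∈ Icc (-T) 0, ‖ιp.prodMap ιm (v₁ t) - ιp.prodMap ιm (v₂ t)‖ ≤
      (c ^ 2 * (2 * M) * Real.exp ((μ - lam) * T)
        + gapSum ((c * C) ^ 2) Cf lamp lamm κ μ * (2 * e)
        + pairError c C lamp lamm κ (2 * c ^ 2 * C ^ 2 * M) e μ)
        / (1 - gapSum ((c * C) ^ 2) Cf lamp lamm κ μ) * Real.exp (μ * t) := by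
  set θ := gapSum ((c * C) ^ 2) Cf lamp lamm κ μ with hθdef
  have hc := S.plus.c_pos
  have hCf := S.zero_le_Cf
  have hM := hs.nonneg
  have hμp : μ < lamp - κ := hμlam.trans_lt hs.gap_plus
  obtain ⟨hκ, -, -⟩ := S.gap_terms_nonneg hs (a := (c * C) ^ 2) (by positivity)
  have hθ0 : 0 ≤ θ := add_nonneg (div_nonneg (by positivity) (by linarith))
    (div_nonneg (by positivity) (by linarith))
  have herr : 0 ≤ pairError c C lamp lamm κ (2 * c ^ 2 * C ^ 2 * M) e μ :=
    add_nonneg (energyError_nonneg hc.le (by linarith)) (energyError_nonneg hc.le (by linarith))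
  have hexp : ∀ t ∈ Icc (-T) 0, Real.exp (lam * t) ≤ Real.exp (μ * t) := fun t ht => by
    rw [Real.exp_le_exp]; nlinarith [ht.2]
  have hsize : ∀ t ∈ Icc (-T) 0, ‖ιp.prodMap ιm (v₁ t) - ιp.prodMap ιm (v₂ t)‖
      ≤ 2 * M * Real.exp (lam * t) := fun t ht => by
    rw [← map_sub]
    calc _ ≤ ‖v₁ t - v₂ t‖ := S.norm_incl_le _
      _ ≤ M * Real.exp (lam * t) + M * Real.exp (lam * t) :=
        (_root_.norm_sub_le _ _).trans (add_le_add (h₁.path.norm_le t ht) (h₂.path.norm_le t ht))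
      _ = _ := by ring
  refine le_of_contraction hθ0 hθ (by positivity) (D₀ := 2 * M) (by positivity)
    (fun t _ => (Real.exp_pos _).le)
    (fun t ht => (hsize t ht).trans (mul_le_mul_of_nonneg_left (hexp t ht) (by positivity)))
    fun D hD hDv t ht => ?_
  have hDu : ∀ t ∈ Icc (-T) 0, ‖ιp.prodMap ιm (u₁ t) - ιp.prodMap ιm (u₂ t)‖
      ≤ (D + 2 * e) * Real.exp (μ * t) := fun t ht => by
    have e1 : ιp.prodMap ιm (u₁ t) - ιp.prodMap ιm (u₂ t)
        = (ιp.prodMap ιm (v₁ t) - ιp.prodMap ιm (v₂ t))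
          + ((ιp.prodMap ιm (u₁ t) - ιp.prodMap ιm (v₁ t))
          - (ιp.prodMap ιm (u₂ t) - ιp.prodMap ιm (v₂ t))) := by abel
    rw [e1]
    have e2 := mul_le_mul_of_nonneg_left (hexp t ht) he
    calc _ ≤ D * Real.exp (μ * t) + (e * Real.exp (μ * t) + e * Real.exp (μ * t)) :=
          (norm_add_le _ _).trans (add_le_add (hDv t ht) ((_root_.norm_sub_le _ _).trans
            (add_le_add ((hd₁ t ht).trans e2) ((hd₂ t ht).trans e2))))
      _ = _ := by ring
  refine (S.norm_pair_sub_le h₁ h₂ hs hμlam he hμm hμp (D := D + 2 * e) (by positivity) hDu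
    (β := c ^ 2 * (2 * M) * Real.exp ((μ - lam) * T)) (by rw [h0]; simp; positivity) ?_ t ht).trans
    (le_of_eq ?_)
  · have e3 : ‖ιm (v₁ (-T)).2 - ιm (v₂ (-T)).2‖ ≤ 2 * M * Real.exp (lam * -T) :=
      (norm_snd_le (ιp.prodMap ιm (v₁ (-T)) - ιp.prodMap ιm (v₂ (-T)))).trans
        (hsize (-T) ⟨le_rfl, by linarith⟩)
    calc _ ≤ c ^ 2 * (2 * M * Real.exp (lam * -T)) * Real.exp (μ * T) := by gcongr
      _ = c ^ 2 * (2 * M) * (Real.exp (lam * -T) * Real.exp (μ * T)) := by ring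
      _ = _ := by rw [← Real.exp_add]; ring_nf
  · rw [← hθdef]; ring

/-- A sequence of approximate solutions on growing intervals, with errors tending to `0`, converges
pointwise in `X`; the limit inherits the bounds in `Y` since balls of `Y` are weakly closed. -/
theorem exists_limit [CompleteSpace Xp] [CompleteSpace Xm] [CompleteSpace Yp] [CompleteSpace Ym]
    {M lam κ μ : ℝ} (hs : SmallSize R c C K Cf lamp lamm κ M lam) (hκ : 0 < κ)
    (hθ : gapSum ((c * C) ^ 2) Cf lamp lamm κ lam < 1) (hμlam : μ < lam) (hμm : lamm + κ < μ)
    (hθμ : gapSum ((c * C) ^ 2) Cf lamp lamm κ μ < 1) {v₀ : Yp}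
    (hv₀ : (c * C) ^ 2 * ‖v₀‖ + gapSum ((c * C) ^ 2) Cf lamp lamm κ lam * M ≤ M) :
    ∃ (u v y : ℕ → ℝ → Yp × Ym) (w : ℝ → Yp × Ym),
      (∀ n : ℕ, IsApproxSolution ιp ιm c C Cf Ap Am fp fm n M (1 / (n + 1)) lam
        (u n) (v n) (y n)) ∧
      (∀ t ≤ 0, Tendsto (fun n => ιp.prodMap ιm (u n t)) atTop (𝓝 (ιp.prodMap ιm (w t))) ∧
        Tendsto (fun n => ιp.prodMap ιm (v n t)) atTop (𝓝 (ιp.prodMap ιm (w t))) ∧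
        Tendsto (fun n => ιp.prodMap ιm (y n t)) atTop (𝓝 (ιp.prodMap ιm (w t)))) ∧
      (w 0).1 = v₀ ∧ (∀ t ≤ 0, ‖w t‖ ≤ M * Real.exp (lam * t)) ∧
      ∀ t ≤ 0, ‖(w t).2‖ ≤ gapSum ((c * C) ^ 2) Cf lamp lamm κ lam * M * Real.exp (lam * t) := by
  choose u v y ha hd hv0 hv2 using fun n : ℕ => S.exists_approxSolution hs hκ (T := n)
    (Nat.cast_nonneg n) (e := 1 / (n + 1)) (by positivity) hθ hv₀
  set θ := gapSum ((c * C) ^ 2) Cf lamp lamm κ μ with hθdef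
  have he : Tendsto (fun n : ℕ => (1 : ℝ) / (n + 1)) atTop (𝓝 0) :=
    tendsto_one_div_add_atTop_nhds_zero_nat
  set B : ℕ → ℝ := fun n => (c ^ 2 * (2 * M) * Real.exp ((μ - lam) * n)
        + θ * (2 * (1 / (n + 1)))
        + pairError c C lamp lamm κ (2 * c ^ 2 * C ^ 2 * M) (1 / (n + 1)) μ) / (1 - θ) with hB
  have hBlim : Tendsto B atTop (𝓝 0) := by
    have h1 : Tendsto (fun n : ℕ => Real.exp ((μ - lam) * n)) atTop (𝓝 0) :=
      Real.tendsto_exp_atBot.comp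
        (tendsto_natCast_atTop_atTop.const_mul_atTop_of_neg (by linarith))
    have h2 := (tendsto_pairError c C lamp lamm κ (2 * c ^ 2 * C ^ 2 * M) μ).comp he
    have h3 := (((h1.const_mul (c ^ 2 * (2 * M))).add ((he.const_mul 2).const_mul θ)).add
      h2).div_const (1 - θ)
    simpa [hB] using h3
  have hcauchy : ∀ n m : ℕ, n ≤ m → ∀ t ∈ Icc (-(n : ℝ)) 0,
      ‖ιp.prodMap ιm (v n t) - ιp.prodMap ιm (v m t)‖ ≤ B n * Real.exp (μ * t) := by
    intro n m hnm
    have hnm' : (n : ℝ) ≤ m := Nat.cast_le.2 hnm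
    have he' : (1 : ℝ) / (m + 1) ≤ 1 / (n + 1) := by gcongr
    exact S.norm_approx_sub_le (ha n) ((ha m).mono hnm' he') (hd n) (fun t ht =>
      (hd m t ⟨by linarith [ht.1], ht.2⟩).trans
        (mul_le_mul_of_nonneg_right he' (Real.exp_pos _).le)) hs hμlam.le (by positivity)
      (Nat.cast_nonneg n) hμm hθμ ((hv0 n).trans (hv0 m).symm)
  have hpt : ∀ t : ℝ, t ≤ 0 → ∃ w : Yp × Ym,
      Tendsto (fun n => ιp.prodMap ιm (v n t)) atTop (𝓝 (ιp.prodMap ιm w)) ∧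
      ‖w‖ ≤ M * Real.exp (lam * t) ∧
      ‖w.2‖ ≤ gapSum ((c * C) ^ 2) Cf lamp lamm κ lam * M * Real.exp (lam * t) := by
    intro t ht
    obtain ⟨N, hN⟩ := exists_nat_ge (-t)
    have hmem : ∀ n : ℕ, t ∈ Icc (-((n + N : ℕ) : ℝ)) 0 := fun n => ⟨by
      push_cast; have := Nat.cast_nonneg (α := ℝ) n; linarith, ht⟩
    have hc : CauchySeq fun n => ιp.prodMap ιm (v (n + N) t) := by
      refine cauchySeq_of_le_tendsto_0' (fun n => B (n + N) * Real.exp (μ * t))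
        (fun n m hnm => ?_) ?_
      · rw [dist_eq_norm]
        exact hcauchy (n + N) (m + N) (by omega) t (hmem n)
      · simpa using ((tendsto_add_atTop_iff_nat N).2 hBlim).mul_const (Real.exp (μ * t))
    obtain ⟨x, hx⟩ := cauchySeq_tendsto_of_complete hc
    obtain ⟨w, rfl, hw, -⟩ := S.weak_plus.prodMap S.weak_minus (fun n => v (n + N) t) x _
      (fun n => (ha (n + N)).path.norm_le t (hmem n)) hx
    obtain ⟨w₂, hw₂, hw₂', -⟩ := S.weak_minus (fun n => (v (n + N) t).2) _ _
      (fun n => hv2 (n + N) t (hmem n)) ((continuous_snd.tendsto _).comp hx)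
    refine ⟨w, (tendsto_add_atTop_iff_nat N).1 hx, hw, ?_⟩
    rwa [← S.injective_minus (show ιm w₂ = ιm w.2 from hw₂)]
  choose! w hw hwM hw2 using hpt
  refine ⟨u, v, y, w, ha, fun t ht => ⟨?_, hw t ht, ?_⟩, ?_, hwM, hw2⟩
  · refine (tendsto_iff_of_dist ?_).2 (hw t ht)
    refine squeeze_zero' (g := fun n : ℕ => 1 / ((n : ℝ) + 1) * Real.exp (lam * t))
      (Eventually.of_forall fun _ => dist_nonneg) ?_ (by simpa using he.mul_const _)
    obtain ⟨N, hN⟩ := exists_nat_ge (-t)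
    filter_upwards [eventually_ge_atTop N] with n hn
    rw [dist_eq_norm]
    exact hd n t ⟨by have := Nat.cast_le (α := ℝ).2 hn; linarith, ht⟩
  · refine (tendsto_iff_of_dist ?_).1 (hw t ht)
    refine squeeze_zero' (g := fun n : ℕ => 1 / ((n : ℝ) + 1) * Real.exp (lam * t))
      (Eventually.of_forall fun _ => dist_nonneg) ?_ (by simpa using he.mul_const _)
    obtain ⟨N, hN⟩ := exists_nat_ge (-t)
    filter_upwards [eventually_ge_atTop N] with n hn
    rw [dist_eq_norm]
    exact (ha n).norm_sub_le t ⟨by have := Nat.cast_le (α := ℝ).2 hn; linarith, ht⟩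
  · refine S.injective_plus (tendsto_nhds_unique ((continuous_fst.tendsto _).comp (hw 0 le_rfl)) ?_)
    refine tendsto_const_nhds.congr fun n => ?_
    simp [hv0]

end CoupledSystem

end

/-! ### Regularity of the limit -/

section

variable {Xp Xm Yp Ym : Type*}
  [NormedAddCommGroup Xp] [NormedSpace ℝ Xp] [NormedAddCommGroup Xm] [NormedSpace ℝ Xm]
  [NormedAddCommGroup Yp] [NormedSpace ℝ Yp] [NormedAddCommGroup Ym] [NormedSpace ℝ Ym]
  {ιp : Yp →L[ℝ] Xp} {ιm : Ym →L[ℝ] Xm} {R c C K Cf lamp lamm : ℝ}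
  {bp : Xp × Xm → Xp →L[ℝ] Xp →L[ℝ] ℝ} {bm : Xp × Xm → Xm →L[ℝ] Xm →L[ℝ] ℝ}
  {Ap : Xp × Xm → Yp →L[ℝ] Xp} {Am : Xp × Xm → Ym →L[ℝ] Xm}
  {fp : Yp × Ym → Yp} {fm : Yp × Ym → Ym}

theorem continuous_velocity_right (u : Yp × Ym) :
    Continuous fun y => velocity ιp ιm Ap Am fp fm u y :=
  (ContinuousLinearMap.continuous _).add continuous_const

namespace CoupledSystem

variable (S : CoupledSystem ιp ιm R c C K Cf lamp lamm bp bm Ap Am fp fm)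

include S

theorem norm_velocity_sub_le {u u' : Yp × Ym} (hu : ‖u‖ < R) (hu' : ‖u'‖ < R) (y : Yp × Ym) :
    ‖velocity ιp ιm Ap Am fp fm u y - velocity ιp ιm Ap Am fp fm u' y‖
      ≤ (C * ‖y‖ + Cf) * ‖ιp.prodMap ιm u - ιp.prodMap ιm u'‖ := by
  have hb := S.incl_mem_ball hu
  have hb' := S.incl_mem_ball hu'
  have hC := S.plus.C_pos
  have hv := mem_ball_zero_iff.2 hu
  have hv' := mem_ball_zero_iff.2 hu'
  have e : velocity ιp ιm Ap Am fp fm u y - velocity ιp ιm Ap Am fp fm u' y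
      = ((Ap (ιp.prodMap ιm u) - Ap (ιp.prodMap ιm u')) y.1,
        (Am (ιp.prodMap ιm u) - Am (ιp.prodMap ιm u')) y.2)
        + (ιp (fp u) - ιp (fp u'), ιm (fm u) - ιm (fm u')) := by
    ext <;> simp [velocity] <;> abel
  rw [e, add_mul]
  refine (norm_add_le _ _).trans (add_le_add (max_le ?_ ?_)
    (max_le (S.lipschitz_plus u hv u' hv') (S.lipschitz_minus u hv u' hv')))
  · have h1 : ‖Ap (ιp.prodMap ιm u) - Ap (ιp.prodMap ιm u')‖
        ≤ C * ‖ιp.prodMap ιm u - ιp.prodMap ιm u'‖ := by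
      have := S.plus.norm_op_sub_le hb hb'
      rwa [neg_sub_neg, norm_sub_rev] at this
    calc _ ≤ C * ‖ιp.prodMap ιm u - ιp.prodMap ιm u'‖ * ‖y.1‖ :=
          ContinuousLinearMap.le_of_opNorm_le _ h1 _
      _ ≤ C * ‖ιp.prodMap ιm u - ιp.prodMap ιm u'‖ * ‖y‖ := by
          gcongr; exact norm_fst_le y
      _ = _ := by ring
  · calc _ ≤ C * ‖ιp.prodMap ιm u - ιp.prodMap ιm u'‖ * ‖y.2‖ :=
          ContinuousLinearMap.le_of_opNorm_le _ (S.minus.norm_op_sub_le hb hb') _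
      _ ≤ C * ‖ιp.prodMap ιm u - ιp.prodMap ιm u'‖ * ‖y‖ := by
          gcongr; exact norm_snd_le y
      _ = _ := by ring

theorem continuousOn_velocity {u y : ℝ → Yp × Ym} {s : Set ℝ} (hu : ∀ t ∈ s, ‖u t‖ < R)
    (huc : ContinuousOn (fun t => ιp.prodMap ιm (u t)) s) (hy : ContinuousOn y s) :
    ContinuousOn (fun t => velocity ιp ιm Ap Am fp fm (u t) (y t)) s := by
  intro t ht
  have h1 : Tendsto (fun r => velocity ιp ιm Ap Am fp fm (u r) (y r)
      - velocity ιp ιm Ap Am fp fm (u t) (y r)) (𝓝[s] t) (𝓝 0) := by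
    refine squeeze_zero_norm' (a := fun r => (C * ‖y r‖ + Cf)
      * ‖ιp.prodMap ιm (u r) - ιp.prodMap ιm (u t)‖) ?_ ?_
    · filter_upwards [self_mem_nhdsWithin] with r hr
      exact S.norm_velocity_sub_le (hu r hr) (hu t ht) _
    · have hyt : Tendsto y (𝓝[s] t) (𝓝 (y t)) := hy t ht
      have h2 := (((hyt.norm).const_mul C).add_const Cf).mul
        (tendsto_iff_norm_sub_tendsto_zero.1 (huc t ht))
      simpa using h2
  have h2 : Tendsto (fun r => velocity ιp ιm Ap Am fp fm (u t) (y r)) (𝓝[s] t)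
      (𝓝 (velocity ιp ιm Ap Am fp fm (u t) (y t))) :=
    ((continuous_velocity_right (u t)).tendsto _).comp (hy t ht)
  simpa [ContinuousWithinAt] using h1.add h2

/-- Weak continuity of the right side of the equation, for strong convergence in `X` and
boundedness in `Y`. -/
theorem tendsto_velocity {u y : ℕ → Yp × Ym} {w : Yp × Ym} {N : ℝ} (hu : ∀ n, ‖u n‖ < R)
    (hw : ‖w‖ < R) (hy : ∀ n, ‖y n‖ ≤ N)
    (hul : Tendsto (fun n => ιp.prodMap ιm (u n)) atTop (𝓝 (ιp.prodMap ιm w)))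
    (hyl : Tendsto (fun n => ιp.prodMap ιm (y n)) atTop (𝓝 (ιp.prodMap ιm w)))
    (f : Xp × Xm →L[ℝ] ℝ) :
    Tendsto (fun n => f (velocity ιp ιm Ap Am fp fm (u n) (y n))) atTop
      (𝓝 (f (velocity ιp ιm Ap Am fp fm w w))) := by
  have hC := S.plus.C_pos
  have h1 : Tendsto (fun n => velocity ιp ιm Ap Am fp fm (u n) (y n)
      - velocity ιp ιm Ap Am fp fm w (y n)) atTop (𝓝 0) := by
    refine squeeze_zero_norm (a := fun n => (C * N + Cf)
      * ‖ιp.prodMap ιm (u n) - ιp.prodMap ιm w‖) (fun n => ?_) ?_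
    · exact (S.norm_velocity_sub_le (hu n) hw _).trans (by gcongr; exact hy n)
    · simpa using (tendsto_iff_norm_sub_tendsto_zero.1 hul).const_mul (C * N + Cf)
  obtain ⟨w', hw', -, hweak⟩ := S.weak_plus.prodMap S.weak_minus y _ N hy hyl
  have hww' : w' = w := (S.injective_plus.prodMap S.injective_minus) hw'
  have h2 := (hweak (f ∘L (Ap (ιp.prodMap ιm w)).prodMap (Am (ιp.prodMap ιm w)))).add_const
    (f (ιp.prodMap ιm (fp w, fm w)))
  rw [hww'] at h2
  have h3 := ((f.continuous.tendsto 0).comp h1).add h2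
  rw [map_zero, zero_add] at h3
  refine (h3.congr fun n => ?_).trans (le_of_eq ?_)
  · rw [Function.comp_apply, ContinuousLinearMap.comp_apply, ← map_add, ← map_add]
    congr 1
    simp only [velocity]
    abel
  · rw [velocity, map_add]; rfl

/-- A path which is continuous in `X` is a pointwise limit of paths which are continuous in `Y`
(its images under the resolvents), hence so is the velocity. -/
theorem aestronglyMeasurable_velocity [CompleteSpace Xp] [CompleteSpace Xm] {w : ℝ → Yp × Ym}
    {a b : ℝ} (hw : ∀ t ∈ Icc a b, ‖w t‖ < R)
    (hwc : ContinuousOn (fun t => ιp.prodMap ιm (w t)) (Icc a b)) :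
    AEStronglyMeasurable (fun t => velocity ιp ιm Ap Am fp fm (w t) (w t))
      (volume.restrict (Icc a b)) := by
  rcases (Icc a b).eq_empty_or_nonempty with h | ⟨t₀, ht₀⟩
  · simp [h]
  have h0 : (0 : Xp × Xm) ∈ ball (0 : Xp × Xm) R :=
    mem_ball_self ((norm_nonneg _).trans_lt (hw t₀ ht₀))
  set d : ℝ := 1 / (2 * (1 + |lamp| + |lamm|)) with hd
  have hd0 : 0 < d := by positivity
  have hs : Tendsto (fun n : ℕ => d * (1 / ((n : ℝ) + 1))) atTop (𝓝[>] 0) := by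
    refine tendsto_nhdsWithin_iff.2 ⟨?_, Eventually.of_forall fun n => ?_⟩
    · simpa using (tendsto_one_div_add_atTop_nhds_zero_nat (𝕜 := ℝ)).const_mul d
    · rw [mem_Ioi]; positivity
  have hbound : ∀ x : ℝ, 0 ≤ x → x ≤ 1 + |lamp| + |lamm| → ∀ n : ℕ,
      d * (1 / ((n : ℝ) + 1)) * x ≤ 1 / 2 := fun x hx hx' n => by
    have h1 : 1 / ((n : ℝ) + 1) ≤ 1 := by
      rw [div_le_one (by positivity)]
      linarith [Nat.cast_nonneg (α := ℝ) n]
    calc _ ≤ d * 1 * (1 + |lamp| + |lamm|) := by gcongr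
      _ = 1 / 2 := by rw [hd]; field_simp
  have hlp := abs_nonneg lamp
  have hlm := abs_nonneg lamm
  have hb1 : ∀ n : ℕ, d * (1 / ((n : ℝ) + 1)) ≤ 1 / 2 := fun n => by
    simpa using hbound 1 zero_le_one (by linarith) n
  have hpos : ∀ n : ℕ, 0 < d * (1 / ((n : ℝ) + 1)) := fun n => by positivity
  refine aestronglyMeasurable_of_tendsto_ae atTop
    (f := fun (n : ℕ) t => velocity ιp ιm Ap Am fp fm (w t)
      (resolvent ιp (d * (1 / ((n : ℝ) + 1))) (-Ap 0) (ιp (w t).1),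
        resolvent ιm (d * (1 / ((n : ℝ) + 1))) (Am 0) (ιm (w t).2)))
    (fun n => (S.continuousOn_velocity hw hwc ?_).aestronglyMeasurable measurableSet_Icc)
    (Eventually.of_forall fun t => ?_)
  · exact ((ContinuousLinearMap.continuous _).comp_continuousOn hwc.fst).prodMk
      ((ContinuousLinearMap.continuous _).comp_continuousOn hwc.snd)
  · refine ((continuous_velocity_right (w t)).tendsto (w t)).comp (Tendsto.prodMk_nhds ?_ ?_)
    · exact S.plus.tendsto_resolvent_incl S.dense_plus h0 hs
        (fun n => ⟨hbound _ (abs_nonneg _) (by rw [abs_neg]; linarith) n, hb1 n, hpos n⟩) _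
    · exact S.minus.tendsto_resolvent_incl S.dense_minus h0 hs
        (fun n => ⟨hbound _ (abs_nonneg _) (by linarith) n, hb1 n, hpos n⟩) _

/-- A path `w`, bounded in `Y`, with `(ι w)(b) - (ι w)(a) = ∫ (A(w) w + f(w))`, is continuous in `Y`
and hence a solution. -/
theorem continuousOn_of_integral_eq [CompleteSpace Xp] [CompleteSpace Xm] [CompleteSpace Yp]
    [CompleteSpace Ym] {w : ℝ → Yp × Ym} {T M U : ℝ} (hT : 0 ≤ T) (hMR : M < R)
    (hU : C * M + Cf * M ≤ U)
    (hw : ∀ t ∈ Icc (-T) 0, ‖w t‖ ≤ M)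
    (hint : ∀ t ∈ Icc (-T) 0, ιp.prodMap ιm (w t) = ιp.prodMap ιm (w (-T))
      + ∫ s in (-T)..t, velocity ιp ιm Ap Am fp fm (w s) (w s))
    (hwL : ∀ s ∈ Icc (-T) 0, ∀ t ∈ Icc (-T) 0,
      ‖ιp.prodMap ιm (w s) - ιp.prodMap ιm (w t)‖ ≤ U * |s - t|) :
    ContinuousOn w (Icc (-T) 0) := by
  have hC := S.plus.C_pos
  have hCf := S.zero_le_Cf
  have hT0 : -T ≤ 0 := by linarith
  have hwR : ∀ t ∈ Icc (-T) 0, ‖w t‖ < R := fun t ht => (hw t ht).trans_lt hMR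
  have hwR' : ∀ t ∈ Icc (-T) 0, w t ∈ ball 0 R := fun t ht => mem_ball_zero_iff.2 (hwR t ht)
  have hwc := continuousOn_of_norm_sub_le hwL
  set Z := fun t => velocity ιp ιm Ap Am fp fm (w t) (w t) with hZ
  have hZm : AEStronglyMeasurable Z (volume.restrict (Icc (-T) 0)) :=
    S.aestronglyMeasurable_velocity hwR hwc
  have hZb : ∀ t ∈ Icc (-T) 0, ‖Z t‖ ≤ U := fun t ht =>
    ((S.norm_velocity_le (hwR t ht)).trans (by gcongr <;> exact hw t ht)).trans hU
  have hZi : IntervalIntegrable Z volume (-T) 0 := by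
    rw [intervalIntegrable_iff_integrableOn_Icc_of_le hT0]
    exact Integrable.of_bound hZm U
      ((ae_restrict_iff' measurableSet_Icc).2 (Eventually.of_forall hZb))
  have hd : ∀ᵐ t, t ∈ Ioo (-T) 0 → HasDerivAt (fun t => ιp.prodMap ιm (w t)) (Z t) t := by
    filter_upwards [hZi.ae_hasDerivAt_integral] with t ht hmem
    have h1 := (ht (by rw [uIcc_of_le hT0]; exact Ioo_subset_Icc_self hmem) (-T)
      (by rw [uIcc_of_le hT0]; exact left_mem_Icc.2 hT0)).const_add (ιp.prodMap ιm (w (-T)))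
    refine h1.congr_of_eventuallyEq ?_
    filter_upwards [Ioo_mem_nhds hmem.1 hmem.2] with s hs
    exact hint s (Ioo_subset_Icc_self hs)
  have hfpc : ContinuousOn (fun t => ιp (fp (w t))) (Icc (-T) 0) :=
    continuousOn_of_norm_sub_le (L := Cf * U) fun s hs t ht => by
      rw [mul_assoc]
      exact (S.lipschitz_plus _ (hwR' s hs) _ (hwR' t ht)).trans
        (mul_le_mul_of_nonneg_left (hwL s hs t ht) hCf)
  have hfmc : ContinuousOn (fun t => ιm (fm (w t))) (Icc (-T) 0) :=
    continuousOn_of_norm_sub_le (L := Cf * U) fun s hs t ht => by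
      rw [mul_assoc]
      exact (S.lipschitz_minus _ (hwR' s hs) _ (hwR' t ht)).trans
        (mul_le_mul_of_nonneg_left (hwL s hs t ht) hCf)
  have hneg : ∀ s ∈ Icc 0 T, -s ∈ Icc (-T) 0 := fun s hs =>
    ⟨by linarith [hs.2], by linarith [hs.1]⟩
  have hneg' : ∀ s ∈ Icc (-T) 0, -s ∈ Icc 0 T := fun s hs =>
    ⟨by linarith [hs.2], by linarith [hs.1]⟩
  have hm : ContinuousOn (fun t => (w t).2) (Icc (-T) 0) := by
    refine S.minus.continuousOn_of_ae_hasDerivAt S.dense_minus (u := fun t => ιp.prodMap ιm (w t))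
      (u' := Z) (φ := fun t => fm (w t)) (F := Cf * M) hT0
      (fun t ht => S.incl_mem_ball (hwR t ht)) hwL hd hZb hZm
      (fun s hs t ht => (norm_snd_le (ιp.prodMap ιm (w s) - ιp.prodMap ιm (w t))).trans
        (hwL s hs t ht)) (fun t ht => (norm_snd_le _).trans (hw t ht)) ?_
      (fun t ht => (S.norm_minus_le _ (hwR' t ht)).trans
        (mul_le_mul_of_nonneg_left (hw t ht) hCf)) hfmc
    filter_upwards [hd] with t ht hmem
    exact ((ContinuousLinearMap.snd ℝ Xp Xm).hasFDerivAt.comp_hasDerivAt t (ht hmem)).congr_deriv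
      (by simp [hZ, velocity])
  have hp : ContinuousOn (fun s => (w (-s)).1) (Icc 0 T) := by
    have hd' : ∀ᵐ s, s ∈ Ioo 0 T →
        HasDerivAt (fun s => ιp.prodMap ιm (w (-s))) (-Z (-s)) s := by
      filter_upwards [(Measure.measurePreserving_neg (volume : Measure ℝ)).quasiMeasurePreserving.ae
        hd] with s hs hmem
      have h1 := (hs ⟨by linarith [hmem.2], by linarith [hmem.1]⟩).scomp s (hasDerivAt_neg s)
      simpa [Function.comp_def] using h1
    have hZm' : AEStronglyMeasurable (fun s => -Z (-s)) (volume.restrict (Icc 0 T)) := by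
      have h1 := (Measure.measurePreserving_neg (volume : Measure ℝ)).restrict_preimage
        (s := Icc (-T) 0) measurableSet_Icc
      have h2 : Neg.neg ⁻¹' Icc (-T) 0 = Icc 0 T := by ext; simp [and_comm]
      rw [h2] at h1
      exact (hZm.comp_measurePreserving h1).neg
    refine S.plus.continuousOn_of_ae_hasDerivAt S.dense_plus
      (u := fun s => ιp.prodMap ιm (w (-s))) (U := U) (V := U)
      (u' := fun s => -Z (-s)) (φ := fun t => -fp (w (-t))) (F := Cf * M) (M := M) hT
      (fun s hs => S.incl_mem_ball (hwR _ (hneg s hs))) ?_ hd'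
      (fun s hs => by rw [norm_neg]; exact hZb _ (hneg s hs)) hZm' ?_
      (fun s hs => (norm_fst_le _).trans (hw _ (hneg s hs))) ?_
      (fun s hs => by
        rw [norm_neg]
        exact (S.norm_plus_le _ (hwR' _ (hneg s hs))).trans
          (mul_le_mul_of_nonneg_left (hw _ (hneg s hs)) hCf)) ?_
    · intro s hs t ht
      have := hwL _ (hneg s hs) _ (hneg t ht)
      rwa [neg_sub_neg, abs_sub_comm] at this
    · intro s hs t ht
      have := hwL _ (hneg s hs) _ (hneg t ht)
      rw [neg_sub_neg, abs_sub_comm] at this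
      exact (norm_fst_le (ιp.prodMap ιm (w (-s)) - ιp.prodMap ιm (w (-t)))).trans this
    · filter_upwards [hd'] with s hs hmem
      exact ((ContinuousLinearMap.fst ℝ Xp Xm).hasFDerivAt.comp_hasDerivAt s (hs hmem)).congr_deriv
        (by simp [hZ, velocity]; abel)
    · simp only [map_neg]
      exact (hfpc.comp continuous_neg.continuousOn hneg).neg
  have hp' : ContinuousOn (fun t => (w t).1) (Icc (-T) 0) := by
    simpa [Function.comp_def] using hp.comp continuous_neg.continuousOn hneg'
  exact hp'.prodMk hm

end CoupledSystem

end

/-! ### Existence of decaying solutions -/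

section

variable {Xp Xm Yp Ym : Type*}
  [NormedAddCommGroup Xp] [NormedSpace ℝ Xp] [NormedAddCommGroup Xm] [NormedSpace ℝ Xm]
  [NormedAddCommGroup Yp] [NormedSpace ℝ Yp] [NormedAddCommGroup Ym] [NormedSpace ℝ Ym]
  {ιp : Yp →L[ℝ] Xp} {ιm : Ym →L[ℝ] Xm} {R c C K Cf lamp lamm : ℝ}
  {bp : Xp × Xm → Xp →L[ℝ] Xp →L[ℝ] ℝ} {bm : Xp × Xm → Xm →L[ℝ] Xm →L[ℝ] ℝ}
  {Ap : Xp × Xm → Yp →L[ℝ] Xp} {Am : Xp × Xm → Ym →L[ℝ] Xm}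
  {fp : Yp × Ym → Yp} {fm : Yp × Ym → Ym}

/-- Solutions of `v' = A(v) v + f(v)` in `X` on a time interval `I`, continuous in `Y`. -/
structure IsSolution (ιp : Yp →L[ℝ] Xp) (ιm : Ym →L[ℝ] Xm) (R : ℝ)
    (Ap : Xp × Xm → Yp →L[ℝ] Xp) (Am : Xp × Xm → Ym →L[ℝ] Xm)
    (fp : Yp × Ym → Yp) (fm : Yp × Ym → Ym) (I : Set ℝ) (v : ℝ → Yp × Ym) : Prop where
  continuousOn : ContinuousOn v I
  norm_lt : ∀ t ∈ I, ‖v t‖ < R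
  hasDerivWithinAt : ∀ t ∈ I, HasDerivWithinAt (fun t => ιp.prodMap ιm (v t))
    (velocity ιp ιm Ap Am fp fm (v t) (v t)) I t

theorem IsCoefficientPath.norm_sub_le {T M lam : ℝ} {u : ℝ → Yp × Ym}
    (h : IsCoefficientPath ιp ιm c C Cf T M lam u) {s t : ℝ} (hs : s ∈ Icc (-T) 0)
    (ht : t ∈ Icc (-T) 0) :
    ‖ιp.prodMap ιm (u s) - ιp.prodMap ιm (u t)‖ ≤ speedConst c C Cf * M * |s - t| := by
  obtain ⟨u', hu'⟩ := h.hasDerivWithinAt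
  exact (convex_Icc (-T) 0).norm_image_sub_le_of_norm_hasDerivWithin_le
    (fun x hx => (hu' x hx).1) (fun x hx => (hu' x hx).2) ht hs

namespace CoupledSystem

variable (S : CoupledSystem ιp ιm R c C K Cf lamp lamm bp bm Ap Am fp fm)

include S

theorem mul_add_mul_le_speedConst {M : ℝ} (hM : 0 ≤ M) : C * M + Cf * M ≤ speedConst c C Cf * M := by
  have h1 : 1 ≤ c ^ 2 := one_le_pow₀ S.plus.one_le_c
  have h2 : C ≤ C ^ 3 := le_self_pow₀ S.plus.one_le_C (by norm_num)
  have hC := S.plus.C_pos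
  rw [speedConst, ← add_mul]
  refine mul_le_mul_of_nonneg_right ?_ hM
  nlinarith

/-- The limit of approximate solutions satisfies the equation in integrated form: test with a
functional and pass to the limit under the integral. -/
theorem incl_eq_add_integral [CompleteSpace Xp] [CompleteSpace Xm] {T M lam : ℝ} {e : ℕ → ℝ}
    {u v y : ℕ → ℝ → Yp × Ym} {w : ℝ → Yp × Ym} (hM : 0 ≤ M) (hMR : M < R) (hlam : 0 ≤ lam)
    (ha : ∀ n, IsApproxSolution ιp ιm c C Cf Ap Am fp fm T M (e n) lam (u n) (v n) (y n))
    (hu : ∀ t ∈ Icc (-T) 0,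
      Tendsto (fun n => ιp.prodMap ιm (u n t)) atTop (𝓝 (ιp.prodMap ιm (w t))))
    (hv : ∀ t ∈ Icc (-T) 0,
      Tendsto (fun n => ιp.prodMap ιm (v n t)) atTop (𝓝 (ιp.prodMap ιm (w t))))
    (hy : ∀ t ∈ Icc (-T) 0,
      Tendsto (fun n => ιp.prodMap ιm (y n t)) atTop (𝓝 (ιp.prodMap ιm (w t))))
    (hw : ∀ t ∈ Icc (-T) 0, ‖w t‖ ≤ M)
    (hwc : ContinuousOn (fun t => ιp.prodMap ιm (w t)) (Icc (-T) 0)) :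
    ∀ t ∈ Icc (-T) 0, ιp.prodMap ιm (w t) = ιp.prodMap ιm (w (-T))
      + ∫ s in (-T)..t, velocity ιp ιm Ap Am fp fm (w s) (w s) := by
  intro t ht
  have hc := S.plus.c_pos
  have hC := S.plus.C_pos
  have hCf := S.zero_le_Cf
  have hsub : Icc (-T) t ⊆ Icc (-T) 0 := Icc_subset_Icc le_rfl ht.2
  have hmem : -T ∈ Icc (-T) 0 := ⟨le_rfl, ht.1.trans ht.2⟩
  have hexp : ∀ s ∈ Icc (-T) 0, Real.exp (lam * s) ≤ 1 := fun s hs =>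
    Real.exp_le_one_iff.2 (mul_nonpos_of_nonneg_of_nonpos hlam hs.2)
  have huM : ∀ n, ∀ s ∈ Icc (-T) 0, ‖u n s‖ ≤ M := fun n s hs =>
    ((ha n).coeff.norm_le s hs).trans (mul_le_of_le_one_right hM (hexp s hs))
  have hyM : ∀ n, ∀ s ∈ Icc (-T) 0, ‖y n s‖ ≤ 2 * c ^ 2 * C ^ 2 * M := fun n s hs =>
    ((ha n).norm_y_le s hs).trans (mul_le_of_le_one_right (by positivity) (hexp s hs))
  have hwR : ∀ s ∈ Icc (-T) 0, ‖w s‖ < R := fun s hs => (hw s hs).trans_lt hMR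
  have hZi : IntervalIntegrable (fun s => velocity ιp ιm Ap Am fp fm (w s) (w s)) volume (-T) t := by
    rw [intervalIntegrable_iff_integrableOn_Icc_of_le ht.1]
    exact Integrable.of_bound (S.aestronglyMeasurable_velocity (fun s hs => hwR s (hsub hs))
      (hwc.mono hsub)) (C * M + Cf * M) ((ae_restrict_iff' measurableSet_Icc).2
      (Eventually.of_forall fun s hs => (S.norm_velocity_le (hwR s (hsub hs))).trans
        (by gcongr <;> exact hw s (hsub hs))))
  rw [← sub_eq_iff_eq_add', SeparatingDual.eq_iff_forall_dual_eq (R := ℝ)]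
  intro f
  rw [← ContinuousLinearMap.intervalIntegral_comp_comm f hZi, map_sub]
  have hvc : ∀ n, ContinuousOn (fun s => velocity ιp ιm Ap Am fp fm (u n s) (y n s))
      (Icc (-T) t) := fun n =>
    S.continuousOn_velocity (fun s hs => (huM n s (hsub hs)).trans_lt hMR)
      ((ContinuousLinearMap.continuous _).comp_continuousOn ((ha n).coeff.continuousOn.mono hsub))
      ((ha n).continuousOn_y.mono hsub)
  have hfc : ∀ n, ContinuousOn (fun s => f (velocity ιp ιm Ap Am fp fm (u n s) (y n s)))
      (Icc (-T) t) := fun n => f.continuous.comp_continuousOn (hvc n)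
  have hn : ∀ n, ∫ s in (-T)..t, f (velocity ιp ιm Ap Am fp fm (u n s) (y n s))
      = f (ιp.prodMap ιm (v n t)) - f (ιp.prodMap ιm (v n (-T))) := fun n => by
    refine intervalIntegral.integral_eq_sub_of_hasDerivAt_of_le
      (f := fun s => f (ιp.prodMap ιm (v n s))) ht.1 ?_ (fun s hs => ?_) ?_
    · exact f.continuous.comp_continuousOn ((ContinuousLinearMap.continuous _).comp_continuousOn
        ((ha n).path.continuousOn.mono hsub))
    · exact f.hasFDerivAt.comp_hasDerivAt s (((ha n).hasDerivWithinAt s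
        (hsub (Ioo_subset_Icc_self hs))).hasDerivAt
          (Icc_mem_nhds hs.1 (hs.2.trans_le ht.2)))
    · exact ContinuousOn.intervalIntegrable_of_Icc ht.1 (hfc n)
  refine tendsto_nhds_unique (((f.continuous.tendsto _).comp (hv t ht)).sub
    ((f.continuous.tendsto _).comp (hv _ hmem))) ?_
  refine Tendsto.congr hn ?_
  have huIoc : ∀ s ∈ Set.uIoc (-T) t, s ∈ Icc (-T) 0 := fun s hs => by
    rw [uIoc_of_le ht.1] at hs
    exact hsub (Ioc_subset_Icc_self hs)
  refine intervalIntegral.tendsto_integral_filter_of_dominated_convergence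
    (fun _ => ‖f‖ * (C * (2 * c ^ 2 * C ^ 2 * M) + Cf * M))
    (Eventually.of_forall fun n => ?_) (Eventually.of_forall fun n => Eventually.of_forall
      fun s hs => ?_) (by simp) (Eventually.of_forall fun s hs => ?_)
  · rw [uIoc_of_le ht.1]
    exact ((hfc n).mono Ioc_subset_Icc_self).aestronglyMeasurable measurableSet_Ioc
  · refine f.le_of_opNorm_le_of_le le_rfl ?_
    have hs' := huIoc s hs
    refine (S.norm_velocity_le ((huM n s hs').trans_lt hMR)).trans ?_
    gcongr
    · exact hyM n s hs'
    · exact huM n s hs'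
  · have hs' := huIoc s hs
    exact S.tendsto_velocity (fun n => (huM n s hs').trans_lt hMR) (hwR s hs')
      (fun n => hyM n s hs') (hu s hs') (hy s hs') f

/-- Existence of solutions on `(-∞, 0]` which decay like `e^{lam t}`, with given `+` component
at `0`. -/
theorem exists_solution [CompleteSpace Xp] [CompleteSpace Xm] [CompleteSpace Yp] [CompleteSpace Ym]
    {M lam κ μ : ℝ} (hs : SmallSize R c C K Cf lamp lamm κ M lam) (hκ : 0 < κ)
    (hθ : gapSum ((c * C) ^ 2) Cf lamp lamm κ lam < 1) (hμlam : μ < lam) (hμm : lamm + κ < μ)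
    (hθμ : gapSum ((c * C) ^ 2) Cf lamp lamm κ μ < 1) {v₀ : Yp}
    (hv₀ : (c * C) ^ 2 * ‖v₀‖ + gapSum ((c * C) ^ 2) Cf lamp lamm κ lam * M ≤ M) :
    ∃ w, IsSolution ιp ιm R Ap Am fp fm (Iic 0) w ∧ (w 0).1 = v₀ ∧
      (∀ t ≤ 0, ‖w t‖ ≤ M * Real.exp (lam * t)) ∧
      ∀ t ≤ 0, ‖(w t).2‖ ≤ gapSum ((c * C) ^ 2) Cf lamp lamm κ lam * M * Real.exp (lam * t) := by
  obtain ⟨u, v, y, w, ha, hlim, hw0, hwM, hw2⟩ := S.exists_limit hs hκ hθ hμlam hμm hθμ hv₀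
  have hM := hs.nonneg
  have hwM' : ∀ t ≤ 0, ‖w t‖ ≤ M := fun t ht => (hwM t ht).trans (mul_le_of_le_one_right hM
    (Real.exp_le_one_iff.2 (mul_nonpos_of_nonneg_of_nonpos hs.zero_le_rate ht)))
  have hwR : ∀ t ≤ 0, ‖w t‖ < R := fun t ht => (hwM' t ht).trans_lt hs.lt_radius
  have hN : ∀ N : ℕ, ContinuousOn w (Icc (-(N : ℝ)) 0) ∧ ∀ t ∈ Icc (-(N : ℝ)) 0,
      HasDerivWithinAt (fun t => ιp.prodMap ιm (w t)) (velocity ιp ιm Ap Am fp fm (w t) (w t))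
        (Icc (-(N : ℝ)) 0) t := by
    intro N
    have hN0 : -(N : ℝ) ≤ 0 := by simp
    have ha' : ∀ n : ℕ, IsApproxSolution ιp ιm c C Cf Ap Am fp fm N M (1 / ((n + N : ℕ) + 1)) lam
        (u (n + N)) (v (n + N)) (y (n + N)) := fun n =>
      (ha (n + N)).mono (Nat.cast_le.2 (Nat.le_add_left N n)) le_rfl
    have hlim' := fun t (ht : t ∈ Icc (-(N : ℝ)) 0) => hlim t ht.2
    have hwL : ∀ s ∈ Icc (-(N : ℝ)) 0, ∀ t ∈ Icc (-(N : ℝ)) 0,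
        ‖ιp.prodMap ιm (w s) - ιp.prodMap ιm (w t)‖ ≤ speedConst c C Cf * M * |s - t| :=
      fun s hs t ht => le_of_tendsto (((tendsto_add_atTop_iff_nat N).2
        ((hlim' s hs).2.1.sub (hlim' t ht).2.1)).norm)
        (Eventually.of_forall fun n => (ha' n).path.norm_sub_le hs ht)
    have hwc := continuousOn_of_norm_sub_le hwL
    have hint := S.incl_eq_add_integral hM hs.lt_radius hs.zero_le_rate ha'
      (fun t ht => (tendsto_add_atTop_iff_nat N).2 (hlim' t ht).1)
      (fun t ht => (tendsto_add_atTop_iff_nat N).2 (hlim' t ht).2.1)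
      (fun t ht => (tendsto_add_atTop_iff_nat N).2 (hlim' t ht).2.2)
      (fun t ht => hwM' t ht.2) hwc
    have hcont : ContinuousOn w (Icc (-(N : ℝ)) 0) :=
      S.continuousOn_of_integral_eq (Nat.cast_nonneg N) hs.lt_radius
        (S.mul_add_mul_le_speedConst hM) (fun t ht => hwM' t ht.2) hint hwL
    refine ⟨hcont, fun t ht => ?_⟩
    have hZ : ContinuousOn (fun t => velocity ιp ιm Ap Am fp fm (w t) (w t)) (Icc (-(N : ℝ)) 0) :=
      S.continuousOn_velocity (fun t ht => hwR t ht.2) hwc hcont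
    have h1 := ODE.hasDerivWithinAt_picard_Icc
      (f := fun t (_ : Xp × Xm) => velocity ιp ιm Ap Am fp fm (w t) (w t)) (u := univ)
      (α := fun _ => 0) (left_mem_Icc.2 hN0)
      (hZ.comp continuous_fst.continuousOn fun x hx => hx.1) continuousOn_const
      (fun _ _ => mem_univ _) (ιp.prodMap ιm (w (-(N : ℝ)))) ht
    exact h1.congr_of_mem (fun s hs => hint s hs) ht
  have hnhds : ∀ t ≤ (0 : ℝ), ∃ N : ℕ, t ∈ Icc (-(N : ℝ)) 0 ∧ Icc (-(N : ℝ)) 0 ∈ 𝓝[Iic 0] t := by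
    intro t ht
    obtain ⟨N, hN⟩ := exists_nat_gt (-t)
    exact ⟨N, ⟨by linarith, ht⟩, mem_nhdsWithin.2 ⟨Ioi (-(N : ℝ)), isOpen_Ioi,
      by rw [mem_Ioi]; linarith, fun s hs => ⟨hs.1.le, hs.2⟩⟩⟩
  refine ⟨w, ⟨fun t ht => ?_, hwR, fun t ht => ?_⟩, hw0, hwM, hw2⟩
  · obtain ⟨N, hmem, hnb⟩ := hnhds t ht
    exact ((hN N).1 t hmem).mono_of_mem_nhdsWithin hnb
  · obtain ⟨N, hmem, hnb⟩ := hnhds t ht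
    exact ((hN N).2 t hmem).mono_of_mem_nhdsWithin hnb

end CoupledSystem

end

/-! ### Decaying solutions: uniqueness, bounds, continuation -/

section

variable {Xp Xm Yp Ym : Type*}
  [NormedAddCommGroup Xp] [NormedSpace ℝ Xp] [NormedAddCommGroup Xm] [NormedSpace ℝ Xm]
  [NormedAddCommGroup Yp] [NormedSpace ℝ Yp] [NormedAddCommGroup Ym] [NormedSpace ℝ Ym]
  {ιp : Yp →L[ℝ] Xp} {ιm : Ym →L[ℝ] Xm} {R c C K Cf lamp lamm : ℝ}
  {bp : Xp × Xm → Xp →L[ℝ] Xp →L[ℝ] ℝ} {bm : Xp × Xm → Xm →L[ℝ] Xm →L[ℝ] ℝ}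
  {Ap : Xp × Xm → Yp →L[ℝ] Xp} {Am : Xp × Xm → Ym →L[ℝ] Xm}
  {fp : Yp × Ym → Yp} {fm : Yp × Ym → Ym}

theorem IsSolution.comp_add {I : Set ℝ} {v : ℝ → Yp × Ym}
    (h : IsSolution ιp ιm R Ap Am fp fm I v) {s : ℝ} (hs : ∀ t ≤ 0, t + s ∈ I) :
    IsSolution ιp ιm R Ap Am fp fm (Iic 0) fun t => v (t + s) := by
  refine ⟨h.continuousOn.comp (by fun_prop) hs, fun t ht => h.norm_lt _ (hs t ht),
    fun t ht => ?_⟩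
  have hmaps : MapsTo (fun t => t + s) (Iic 0) I := hs
  have h1 := HasDerivWithinAt.scomp t (h.hasDerivWithinAt _ (hs t ht))
    ((hasDerivAt_id t).add_const s).hasDerivWithinAt hmaps
  simpa [Function.comp_def] using h1

namespace CoupledSystem

variable (S : CoupledSystem ιp ιm R c C K Cf lamp lamm bp bm Ap Am fp fm)

include S

/-- A decaying solution is an approximate solution without error on every `[-T, 0]`. -/
theorem isApproxSolution {M lam κ T : ℝ} (hs : SmallSize R c C K Cf lamp lamm κ M lam)
    {v : ℝ → Yp × Ym} (h : IsSolution ιp ιm R Ap Am fp fm (Iic 0) v)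
    (hv : ∀ t ≤ 0, ‖v t‖ ≤ M * Real.exp (lam * t)) :
    IsApproxSolution ιp ιm c C Cf Ap Am fp fm T M 0 lam v v v := by
  have hM := hs.nonneg
  have hCf := S.zero_le_Cf
  have hC := S.plus.C_pos
  have hsub : Icc (-T) 0 ⊆ Iic 0 := fun t ht => ht.2
  have hvM : ∀ t ≤ 0, ‖v t‖ ≤ M := fun t ht => (hv t ht).trans (mul_le_of_le_one_right hM
    (Real.exp_le_one_iff.2 (mul_nonpos_of_nonneg_of_nonpos hs.zero_le_rate ht)))
  have hd : ∀ t ∈ Icc (-T) 0, HasDerivWithinAt (fun t => ιp.prodMap ιm (v t))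
    (velocity ιp ιm Ap Am fp fm (v t) (v t)) (Icc (-T) 0) t := fun t ht =>
    (h.hasDerivWithinAt t ht.2).mono hsub
  have hpath : IsCoefficientPath ιp ιm c C Cf T M lam v :=
    ⟨h.continuousOn.mono hsub, fun t ht => hv t ht.2, _, fun t ht => ⟨hd t ht,
      ((S.norm_velocity_le (h.norm_lt t ht.2)).trans (by gcongr <;> exact hvM t ht.2)).trans
        (S.mul_add_mul_le_speedConst hM)⟩⟩
  refine ⟨hpath, hpath, hpath.continuousOn, fun t ht => (hv t ht.2).trans ?_,
    fun t ht => by simp, hd⟩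
  have h1 : 1 ≤ c ^ 2 := one_le_pow₀ S.plus.one_le_c
  have h2 : 1 ≤ C ^ 2 := one_le_pow₀ S.plus.one_le_C
  have h3 : 1 ≤ 2 * c ^ 2 * C ^ 2 := by nlinarith
  rw [mul_assoc]
  exact le_mul_of_one_le_left (by positivity) h3

/-- Two decaying solutions are as close in `X` as their `+` components at `0`. The boundary term
of the `-` component at `-T` disappears as `T → ∞`. -/
theorem norm_solution_sub_le {M lam κ : ℝ} (hs : SmallSize R c C K Cf lamp lamm κ M lam)
    (hθ : gapSum (c ^ 2) Cf lamp lamm κ lam < 1) {v w : ℝ → Yp × Ym}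
    (hv : IsSolution ιp ιm R Ap Am fp fm (Iic 0) v)
    (hvM : ∀ t ≤ 0, ‖v t‖ ≤ M * Real.exp (lam * t))
    (hw : IsSolution ιp ιm R Ap Am fp fm (Iic 0) w)
    (hwM : ∀ t ≤ 0, ‖w t‖ ≤ M * Real.exp (lam * t)) :
    (∀ t ∈ Iic 0, ‖ιp.prodMap ιm (v t) - ιp.prodMap ιm (w t)‖ ≤
      c ^ 2 * ‖ιp (v 0).1 - ιp (w 0).1‖ / (1 - gapSum (c ^ 2) Cf lamp lamm κ lam)
        * Real.exp (lam * t)) ∧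
    ∀ t ∈ Iic 0, ‖ιm (v t).2 - ιm (w t).2‖ ≤ gapSum (c ^ 2) Cf lamp lamm κ lam *
      (c ^ 2 * ‖ιp (v 0).1 - ιp (w 0).1‖ / (1 - gapSum (c ^ 2) Cf lamp lamm κ lam))
        * Real.exp (lam * t) := by
  obtain ⟨-, hp0, hm0⟩ := S.gap_terms_nonneg hs (a := c ^ 2) (by positivity)
  have hM := hs.nonneg
  have hgm := hs.gap_minus
  have hc := S.plus.c_pos
  set θ := gapSum (c ^ 2) Cf lamp lamm κ lam with hθdef
  have hθ0 : 0 ≤ θ := add_nonneg hp0 hm0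
  set δ := ‖ιp (v 0).1 - ιp (w 0).1‖
  have hsize : ∀ t ≤ 0, ‖ιp.prodMap ιm (v t) - ιp.prodMap ιm (w t)‖
      ≤ 2 * M * Real.exp (lam * t) := fun t ht => by
    rw [← map_sub]
    calc _ ≤ ‖v t - w t‖ := S.norm_incl_le _
      _ ≤ M * Real.exp (lam * t) + M * Real.exp (lam * t) :=
        (_root_.norm_sub_le _ _).trans (add_le_add (hvM t ht) (hwM t ht))
      _ = _ := by ring
  have hstep : ∀ D ≥ 0, (∀ t ∈ Iic (0 : ℝ), ‖ιp.prodMap ιm (v t) - ιp.prodMap ιm (w t)‖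
      ≤ D * Real.exp (lam * t)) → ∀ t ∈ Iic (0 : ℝ),
        ‖ιp (v t).1 - ιp (w t).1‖ ≤ (c ^ 2 * δ + θ * D) * Real.exp (lam * t) ∧
        ‖ιm (v t).2 - ιm (w t).2‖ ≤ θ * D * Real.exp (lam * t) := by
    intro D hD0 hD t ht
    have hmain := fun T : ℝ => S.norm_sub_le (T := T) (S.isApproxSolution hs hv hvM)
      (S.isApproxSolution hs hw hwM) hs le_rfl le_rfl hs.gap_minus hs.gap_plus hD0
      fun t ht => hD t ht.2
    simp only [energyError_zero, add_zero] at hmain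
    constructor
    · refine ((hmain (-t)).1 t ⟨by simp, ht⟩).trans
        (mul_le_mul_of_nonneg_right ?_ (Real.exp_pos _).le)
      rw [hθdef, gapSum, add_mul]
      nlinarith [mul_nonneg hm0 hD0]
    · have hlim : Tendsto (fun T : ℝ => c ^ 2 * (2 * M) * Real.exp ((lamm + κ) * t)
          * Real.exp ((lamm + κ - lam) * T)
          + c ^ 2 * (Cf + κ) / (lam - lamm - κ) * D * Real.exp (lam * t)) atTop
          (𝓝 (c ^ 2 * (Cf + κ) / (lam - lamm - κ) * D * Real.exp (lam * t))) := by
        have h1 : Tendsto (fun T : ℝ => Real.exp ((lamm + κ - lam) * T)) atTop (𝓝 0) :=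
          Real.tendsto_exp_atBot.comp (tendsto_id.const_mul_atTop_of_neg (by linarith))
        simpa using (h1.const_mul (c ^ 2 * (2 * M) * Real.exp ((lamm + κ) * t))).add_const
          (c ^ 2 * (Cf + κ) / (lam - lamm - κ) * D * Real.exp (lam * t))
      refine (ge_of_tendsto hlim ?_).trans (mul_le_mul_of_nonneg_right ?_ (Real.exp_pos _).le)
      · filter_upwards [eventually_ge_atTop (-t)] with T hT
        have hT0 : -T ≤ 0 := by have : t ≤ 0 := ht; linarith
        have h2 : ‖ιm (v (-T)).2 - ιm (w (-T)).2‖ ≤ 2 * M * Real.exp (lam * -T) :=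
          (norm_snd_le (ιp.prodMap ιm (v (-T)) - ιp.prodMap ιm (w (-T)))).trans (hsize _ hT0)
        refine ((hmain T).2 t ⟨by linarith, ht⟩).trans (add_le_add_left ?_ _)
        calc _ ≤ c ^ 2 * (2 * M * Real.exp (lam * -T)) * Real.exp ((lamm + κ) * (t + T)) := by
              gcongr
          _ = c ^ 2 * (2 * M) * (Real.exp (lam * -T) * Real.exp ((lamm + κ) * (t + T))) := by ring
          _ = c ^ 2 * (2 * M) * (Real.exp ((lamm + κ) * t)
              * Real.exp ((lamm + κ - lam) * T)) := by
              rw [← Real.exp_add, ← Real.exp_add]; ring_nf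
          _ = _ := by ring
      · rw [hθdef, gapSum, add_mul]
        linarith [mul_nonneg hp0 hD0]
  have hfin : ∀ t ∈ Iic (0 : ℝ), ‖ιp.prodMap ιm (v t) - ιp.prodMap ιm (w t)‖ ≤
      c ^ 2 * δ / (1 - θ) * Real.exp (lam * t) := by
    refine le_of_contraction hθ0 hθ (by positivity) (D₀ := 2 * M) (by positivity)
      (fun t _ => (Real.exp_pos _).le) hsize fun D hD0 hD t ht => max_le (hstep D hD0 hD t ht).1
        ((hstep D hD0 hD t ht).2.trans (mul_le_mul_of_nonneg_right ?_ (Real.exp_pos _).le))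
    have : 0 ≤ c ^ 2 * δ := by positivity
    linarith
  refine ⟨hfin, fun t ht => (hstep _ ?_ hfin t ht).2⟩
  exact div_nonneg (by positivity) (by linarith)

theorem solution_unique {M lam κ : ℝ} (hs : SmallSize R c C K Cf lamp lamm κ M lam)
    (hθ : gapSum (c ^ 2) Cf lamp lamm κ lam < 1) {v w : ℝ → Yp × Ym}
    (hv : IsSolution ιp ιm R Ap Am fp fm (Iic 0) v)
    (hvM : ∀ t ≤ 0, ‖v t‖ ≤ M * Real.exp (lam * t))
    (hw : IsSolution ιp ιm R Ap Am fp fm (Iic 0) w)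
    (hwM : ∀ t ≤ 0, ‖w t‖ ≤ M * Real.exp (lam * t)) (h0 : (v 0).1 = (w 0).1) :
    ∀ t ≤ 0, v t = w t := by
  intro t ht
  have h := (S.norm_solution_sub_le hs hθ hv hvM hw hwM).1 t ht
  rw [h0] at h
  simp only [sub_self, norm_zero, mul_zero, zero_div, zero_mul] at h
  exact (S.injective_plus.prodMap S.injective_minus) (sub_eq_zero.1 (norm_le_zero_iff.1 h))

end CoupledSystem

/-- The spectral gap at the rate `lam`, with slack `κ`, and at a slightly smaller rate `μ`. The
solution with `+` component `v₀` at `0` has size `q * ‖v₀‖`, which the iteration preserves. -/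
structure SpectralGap (a c Cf lamp lamm κ μ lam q : ℝ) : Prop where
  slack_pos : 0 < κ
  rate_lt : μ < lam
  gap_minus : lamm + κ < μ
  gapSum_lt : gapSum a Cf lamp lamm κ lam < 1
  gapSum_lt' : gapSum a Cf lamp lamm κ μ < 1
  gapSum_base_lt : gapSum (c ^ 2) Cf lamp lamm κ lam < 1
  zero_le_size : 0 ≤ q
  size : a + gapSum a Cf lamp lamm κ lam * q ≤ q

namespace CoupledSystem

variable (S : CoupledSystem ιp ιm R c C K Cf lamp lamm bp bm Ap Am fp fm)
  [CompleteSpace Xp] [CompleteSpace Xm] [CompleteSpace Yp] [CompleteSpace Ym]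
  {M lam κ μ q : ℝ} (hs : SmallSize R c C K Cf lamp lamm κ M lam)
  (hg : SpectralGap ((c * C) ^ 2) c Cf lamp lamm κ μ lam q)

include S hs hg

theorem exists_solution_of_gap {v₀ : Yp} (hv₀ : q * ‖v₀‖ ≤ M) :
    ∃ w, IsSolution ιp ιm R Ap Am fp fm (Iic 0) w ∧ (w 0).1 = v₀ ∧
      (∀ t ≤ 0, ‖w t‖ ≤ q * ‖v₀‖ * Real.exp (lam * t)) ∧
      ‖(w 0).2‖ ≤ gapSum ((c * C) ^ 2) Cf lamp lamm κ lam * (q * ‖v₀‖) := by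
  have hM := hs.nonneg
  have hCf := S.zero_le_Cf
  have hc := S.plus.c_pos
  have hC := S.plus.C_pos
  have hK := S.plus.zero_le_K
  have hs' : SmallSize R c C K Cf lamp lamm κ (q * ‖v₀‖) lam :=
    ⟨mul_nonneg hg.zero_le_size (norm_nonneg _), hv₀.trans_lt hs.lt_radius, hs.zero_le_rate,
      (mul_le_mul_of_nonneg_left hv₀ (by rw [slackConst, speedConst]; positivity)).trans hs.slack,
      hs.gap_minus, hs.gap_plus⟩
  obtain ⟨w, hw, hw0, hwM, hw2⟩ := S.exists_solution hs' hg.slack_pos hg.gapSum_lt hg.rate_lt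
    hg.gap_minus hg.gapSum_lt' (v₀ := v₀) (by
      have := mul_le_mul_of_nonneg_right hg.size (norm_nonneg v₀)
      linarith)
  exact ⟨w, hw, hw0, hwM, by simpa using hw2 0 le_rfl⟩

/-- A decaying solution obeys the sharper bounds of the constructed one, by uniqueness. -/
theorem solution_bounds {v : ℝ → Yp × Ym} (hv : IsSolution ιp ιm R Ap Am fp fm (Iic 0) v)
    (hvM : ∀ t ≤ 0, ‖v t‖ ≤ M * Real.exp (lam * t)) (hv₀ : q * ‖(v 0).1‖ ≤ M) :
    (∀ t ≤ 0, ‖v t‖ ≤ q * ‖(v 0).1‖ * Real.exp (lam * t)) ∧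
      ‖(v 0).2‖ ≤ gapSum ((c * C) ^ 2) Cf lamp lamm κ lam * (q * ‖(v 0).1‖) := by
  obtain ⟨w, hw, hw0, hwM, hw2⟩ := S.exists_solution_of_gap hs hg hv₀
  have huniq := S.solution_unique hs hg.gapSum_base_lt hv hvM hw
    (fun t ht => (hwM t ht).trans (mul_le_mul_of_nonneg_right hv₀ (Real.exp_pos _).le)) hw0.symm
  exact ⟨fun t ht => by rw [huniq t ht]; exact hwM t ht, by rw [congrArg Prod.snd (huniq 0 le_rfl)]; exact hw2⟩

/-- As long as its `+` component stays small, a solution which decays at `-∞` keeps the decay bound,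
relative to the current time: the sharper bound `q * ‖v_+‖` leaves room to continue. -/
theorem norm_le_of_continuation {v : ℝ → Yp × Ym} {T₀ t : ℝ}
    (hv : IsSolution ιp ιm R Ap Am fp fm (Iio T₀) v)
    (hvM : ∀ s ≤ 0, ‖v s‖ ≤ M * Real.exp (lam * s)) (ht : 0 ≤ t) (htT : t < T₀)
    (hsmall : ∀ τ ∈ Icc 0 t, q * ‖(v τ).1‖ < M) :
    ∀ s ≤ 0, ‖v (s + t)‖ ≤ M * Real.exp (lam * s) := by
  have hM := hs.nonneg
  set A : Set ℝ := {τ | ∀ s ≤ 0, ‖v (s + τ)‖ ≤ M * Real.exp (lam * s)}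
  suffices h : Icc 0 t ⊆ A from h (right_mem_Icc.2 ht)
  refine IsClosed.Icc_subset_of_forall_exists_gt ?_ (by simpa [A] using hvM) ?_
  · have hA : A ∩ Icc 0 t = Icc 0 t ∩ ⋂ s ∈ Iic (0 : ℝ),
        (Icc 0 t ∩ (fun τ => ‖v (s + τ)‖) ⁻¹' Iic (M * Real.exp (lam * s))) := by
      ext τ
      simp only [A, mem_inter_iff, mem_ofPred_eq, mem_iInter, mem_preimage, mem_Iic]
      exact ⟨fun h => ⟨h.2, fun s hs => ⟨h.2, h.1 s hs⟩⟩, fun h => ⟨fun s hs => (h.2 s hs).2, h.1⟩⟩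
    rw [hA]
    refine isClosed_Icc.inter (isClosed_biInter fun s hs => ?_)
    refine ContinuousOn.preimage_isClosed_of_isClosed ?_ isClosed_Icc isClosed_Iic
    refine (hv.continuousOn.comp (by fun_prop) fun τ hτ => ?_).norm
    have : s ≤ 0 := hs
    exact lt_of_le_of_lt (by linarith [hτ.2]) htT
  · rintro τ ⟨hτA, hτ0, hτt⟩ r hr
    have hτT : τ < T₀ := hτt.trans htT
    have hqτ := hsmall τ ⟨hτ0, hτt.le⟩
    have hb := (S.solution_bounds hs hg (hv.comp_add (s := τ) fun x hx =>
      (show x + τ < T₀ by linarith)) hτA (by simpa using hqτ.le)).1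
    simp only [zero_add] at hb
    set m := q * ‖(v τ).1‖ with hm
    have hm0 : 0 ≤ m := mul_nonneg hg.zero_le_size (norm_nonneg _)
    obtain ⟨x, hmx, hxM⟩ := exists_between hqτ
    -- on a short time interval after `τ`, the norm of `v` is at most `x < M`
    have hvτ : ‖v τ‖ < x := by
      have := hb 0 le_rfl
      simp only [zero_add, mul_zero, Real.exp_zero, mul_one] at this
      linarith
    have hcont : ContinuousAt (fun y => ‖v y‖) τ :=
      (hv.continuousOn.continuousAt (Iio_mem_nhds hτT)).norm
    obtain ⟨d, hd0, hd⟩ := Metric.eventually_nhds_iff.1 (hcont.eventually (gt_mem_nhds hvτ))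
    have hexp : Tendsto (fun y : ℝ => x * Real.exp (lam * y)) (𝓝 0) (𝓝 x) := by
      have : Continuous fun y : ℝ => x * Real.exp (lam * y) := by fun_prop
      simpa using this.tendsto 0
    obtain ⟨d', hd'0, hd'⟩ := Metric.eventually_nhds_iff.1 (hexp.eventually (gt_mem_nhds hxM))
    set e := min (min (d / 2) (d' / 2)) (r - τ) with he
    have he0 : 0 < e := lt_min (lt_min (half_pos hd0) (half_pos hd'0)) (sub_pos.2 hr)
    have he1 : e < d := ((min_le_left _ _).trans (min_le_left _ _)).trans_lt (half_lt_self hd0)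
    have he2 : e < d' := ((min_le_left _ _).trans (min_le_right _ _)).trans_lt (half_lt_self hd'0)
    have he3 : e ≤ r - τ := min_le_right _ _
    have hxe : x * Real.exp (lam * e) ≤ M :=
      (hd' (by rw [Real.dist_eq, sub_zero, abs_of_pos he0]; exact he2)).le
    refine ⟨τ + e, fun s hs0 => ?_, by linarith, by linarith⟩
    -- `x e^{lam (s + e)} ≤ M e^{lam s}`
    have hxs : x * Real.exp (lam * (s + e)) ≤ M * Real.exp (lam * s) := by
      have : Real.exp (lam * (s + e)) = Real.exp (lam * e) * Real.exp (lam * s) := by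
        rw [← Real.exp_add]; ring_nf
      rw [this, ← mul_assoc]
      exact mul_le_mul_of_nonneg_right hxe (Real.exp_pos _).le
    rcases le_total (s + e) 0 with h | h
    · have h1 := hb (s + e) h
      rw [show s + e + τ = s + (τ + e) by ring] at h1
      exact (h1.trans (mul_le_mul_of_nonneg_right hmx.le (Real.exp_pos _).le)).trans hxs
    · have h1 : ‖v (s + (τ + e))‖ < x := hd (by
        rw [Real.dist_eq, abs_lt]; constructor <;> linarith)
      refine h1.le.trans (le_trans ?_ hxs)
      refine le_mul_of_one_le_right ?_ (Real.one_le_exp (mul_nonneg hs.zero_le_rate h))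
      linarith

/-- A solution with any exponential decay is eventually a small decaying solution, and then its
`-` component is determined by its `+` component: compare at the smaller of the two rates. -/
theorem eventually_snd_eq {κ' M' ν lam' B x : ℝ}
    (hs' : SmallSize R c C K Cf lamp lamm κ' M' ν) (hM' : 0 < M')
    (hθ' : gapSum (c ^ 2) Cf lamp lamm κ' ν < 1) (hν : ν ≤ lam) (hν' : ν ≤ lam') (hlam' : 0 < lam')
    (hM : 0 < M) (hx : 0 < x) {v : ℝ → Yp × Ym}
    (hv : IsSolution ιp ιm R Ap Am fp fm (Iic 0) v)
    (hvB : ∀ t ≤ 0, ‖v t‖ ≤ B * Real.exp (lam' * t)) :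
    ∃ t₀ ≤ 0, ∀ t ≤ t₀, ‖v t‖ < x ∧ ∀ w, IsSolution ιp ιm R Ap Am fp fm (Iic 0) w →
      (∀ s ≤ 0, ‖w s‖ ≤ M * Real.exp (lam * s)) → (w 0).1 = (v t).1 → (v t).2 = (w 0).2 := by
  have hq := hg.zero_le_size
  have hlim : Tendsto (fun t : ℝ => (1 + q) * (B * Real.exp (lam' * t))) atBot (𝓝 0) := by
    have h1 : Tendsto (fun t : ℝ => Real.exp (lam' * t)) atBot (𝓝 0) :=
      Real.tendsto_exp_atBot.comp (tendsto_id.const_mul_atBot hlam')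
    simpa using (h1.const_mul B).const_mul (1 + q)
  obtain ⟨t₁, ht₁⟩ := eventually_atBot.1
    (hlim.eventually (gt_mem_nhds (lt_min (lt_min hM' hM) hx)))
  refine ⟨min t₁ 0, min_le_right _ _, fun t ht => ?_⟩
  have ht0 : t ≤ 0 := ht.trans (min_le_right _ _)
  have hsmall := ht₁ t (ht.trans (min_le_left _ _))
  have hvt := hvB t ht0
  set β := B * Real.exp (lam' * t) with hβ
  have hβ0 : 0 ≤ β := (norm_nonneg _).trans hvt
  have hqβ : 0 ≤ q * β := mul_nonneg hq hβ0
  have h1 : (1 + q) * β < M' := hsmall.trans_le ((min_le_left _ _).trans (min_le_left _ _))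
  have h2 : (1 + q) * β < M := hsmall.trans_le ((min_le_left _ _).trans (min_le_right _ _))
  have h3 : (1 + q) * β < x := hsmall.trans_le (min_le_right _ _)
  have hfst : q * ‖(v t).1‖ ≤ q * β := mul_le_mul_of_nonneg_left ((norm_fst_le _).trans hvt) hq
  refine ⟨by linarith, fun w hw hwM hw0 => ?_⟩
  have hwq := (S.solution_bounds hs hg hw hwM (by rw [hw0]; linarith)).1
  rw [hw0] at hwq
  have huniq := S.solution_unique hs' hθ' (hv.comp_add (s := t) fun s hs => by
    show s + t ≤ 0
    linarith) (fun s hs => ?_) hw (fun s hs => ?_) (by simpa using hw0.symm) 0 le_rfl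
  · simpa using congrArg Prod.snd huniq
  · calc _ ≤ B * Real.exp (lam' * (s + t)) := hvB _ (by linarith)
      _ = β * Real.exp (lam' * s) := by rw [hβ, mul_add, Real.exp_add]; ring
      _ ≤ M' * Real.exp (ν * s) := mul_le_mul (by linarith)
          (Real.exp_le_exp.2 (mul_le_mul_of_nonpos_right hν' hs)) (Real.exp_pos _).le hM'.le
  · exact (hwq s hs).trans (mul_le_mul (by linarith)
      (Real.exp_le_exp.2 (mul_le_mul_of_nonpos_right hν hs)) (Real.exp_pos _).le hM'.le)

end CoupledSystem

end

/-! ### Choice of the parameters -/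

section

/-- The gap condition is open, so that it survives a small slack. -/
theorem eventually_gapSum_lt {a Cf lamp lamm lam θ : ℝ} (hm : lamm < lam) (hp : lam < lamp)
    (h : gapSum a Cf lamp lamm 0 lam < θ) :
    ∀ᶠ κ in 𝓝[>] (0 : ℝ), 0 < κ ∧ lamm + κ < lam ∧ lam < lamp - κ ∧
      gapSum a Cf lamp lamm κ lam < θ := by
  have h1 : ContinuousAt (fun κ => gapSum a Cf lamp lamm κ lam) 0 := by
    unfold gapSum
    refine ContinuousAt.add (ContinuousAt.div (by fun_prop) (by fun_prop) ?_)
      (ContinuousAt.div (by fun_prop) (by fun_prop) ?_) <;> rw [sub_zero] <;> linarith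
  have h2 := (h1.eventually (gt_mem_nhds h)).filter_mono (nhdsWithin_le_nhds (s := Ioi 0))
  filter_upwards [self_mem_nhdsWithin, h2, nhdsWithin_le_nhds (gt_mem_nhds (sub_pos.2 hm)),
    nhdsWithin_le_nhds (gt_mem_nhds (sub_pos.2 hp))] with κ h0 h2 h3 h4
  exact ⟨h0, by linarith, by linarith, h2⟩

/-- The gap condition is open in the rate, so that it holds at some rate `μ < lam`. -/
theorem exists_rate_lt {a Cf lamp lamm κ lam θ : ℝ} (hm : lamm + κ < lam) (hp : lam < lamp - κ)
    (h : gapSum a Cf lamp lamm κ lam < θ) :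
    ∃ μ < lam, lamm + κ < μ ∧ gapSum a Cf lamp lamm κ μ < θ := by
  have h1 : ContinuousAt (fun μ => gapSum a Cf lamp lamm κ μ) lam := by
    unfold gapSum
    refine ContinuousAt.add (ContinuousAt.div (by fun_prop) (by fun_prop) ?_)
      (ContinuousAt.div (by fun_prop) (by fun_prop) ?_) <;> linarith
  have h2 := (h1.eventually (gt_mem_nhds h)).filter_mono (nhdsWithin_le_nhds (s := Iio lam))
  have h3 : ∀ᶠ μ in 𝓝[<] lam, lamm + κ < μ := nhdsWithin_le_nhds (lt_mem_nhds hm)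
  obtain ⟨μ, h3, h4, h5⟩ := (h2.and (h3.and self_mem_nhdsWithin)).exists
  exact ⟨μ, h5, h4, h3⟩

theorem gapSum_mono {a a' Cf lamp lamm κ lam : ℝ} (ha : a ≤ a') (hCf : 0 ≤ Cf) (hκ : 0 ≤ κ)
    (hm : lamm + κ < lam) (hp : lam < lamp - κ) :
    gapSum a Cf lamp lamm κ lam ≤ gapSum a' Cf lamp lamm κ lam := by
  have h1 : 0 < lamp - lam - κ := by linarith
  have h2 : 0 < lam - lamm - κ := by linarith
  unfold gapSum
  gcongr

theorem slackConst_nonneg {c C K Cf : ℝ} (hC : 0 ≤ C) (hK : 0 ≤ K) (hCf : 0 ≤ Cf) :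
    0 ≤ slackConst c C K Cf := by
  unfold slackConst speedConst; positivity

theorem exists_smallSize {R c C K Cf lamp lamm κ lam : ℝ} (hR : 0 < R) (hC : 0 ≤ C)
    (hK : 0 ≤ K) (hCf : 0 ≤ Cf) (hlam : 0 ≤ lam) (hκ : 0 < κ) (hm : lamm + κ < lam)
    (hp : lam < lamp - κ) : ∃ M > 0, SmallSize R c C K Cf lamp lamm κ M lam := by
  have hs := slackConst_nonneg (c := c) hC hK hCf
  refine ⟨min (R / 2) (κ / (slackConst c C K Cf + 1)), by positivity, by positivity,
    (min_le_left _ _).trans_lt (half_lt_self hR), hlam, ?_, hm, hp⟩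
  calc _ ≤ (slackConst c C K Cf + 1) * (κ / (slackConst c C K Cf + 1)) :=
        mul_le_mul (by linarith) (min_le_right _ _) (by positivity) (by positivity)
    _ = κ := by field_simp

theorem gapSum_zero_eq_gapRatio (m : ℕ) (C₀ Cf lamp lamm lam : ℝ) :
    gapSum ((C₀ ^ (m + 1) * C₀) ^ 2) Cf lamp lamm 0 lam = gapRatio (m + 1) C₀ Cf lamp lamm lam := by
  rw [gapSum, gapRatio, add_comm]
  ring_nf

theorem base_sq_le {C₀ : ℝ} (hC₀ : 1 ≤ C₀) (m : ℕ) :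
    (C₀ ^ (m + 1)) ^ 2 ≤ (C₀ ^ (m + 1) * C₀) ^ 2 := by
  rw [mul_pow]
  exact le_mul_of_one_le_right (by positivity) (one_le_pow₀ hC₀)

theorem scaleFormConst_nonneg {C₀ : ℝ} (hC₀ : 0 ≤ C₀) (m : ℕ) : 0 ≤ scaleFormConst m C₀ := by
  unfold scaleFormConst; positivity

/-- The constant `q` of the bound `|v(t)| ≤ q |v₀| e^{lam t}`. -/
noncomputable def sizeConst (k : ℕ) (C₀ Cf lamp lamm lam : ℝ) : ℝ :=
  2 * C₀ ^ (2 * (k + 1)) / (1 - gapRatio k C₀ Cf lamp lamm lam)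

/-- A slack `κ` and an auxiliary rate `μ` for the given constants. The slack is so small that the
contraction constant is at most `l`, and at most `(1 + L₁) / 2`; the latter accounts for the factor
`2` in `sizeConst`. -/
theorem exists_spectralGap {m : ℕ} {C₀ Cf lamp lamm lam l : ℝ} (hC₀ : 1 ≤ C₀) (hCf : 0 < Cf)
    (hlam : lam ∈ sigmaPlus (m + 1) C₀ Cf lamp lamm)
    (hl : l ∈ Ioo (gapRatio (m + 1) C₀ Cf lamp lamm lam) 1) :
    ∃ κ μ, lamm + κ < lam ∧ lam < lamp - κ ∧
      SpectralGap ((C₀ ^ (m + 1) * C₀) ^ 2) (C₀ ^ (m + 1)) Cf lamp lamm κ μ lam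
        (sizeConst (m + 1) C₀ Cf lamp lamm lam) ∧
      gapSum ((C₀ ^ (m + 1) * C₀) ^ 2) Cf lamp lamm κ lam ≤ l ∧
      gapSum ((C₀ ^ (m + 1)) ^ 2) Cf lamp lamm κ lam ≤ l := by
  obtain ⟨-, hm, hp, hL⟩ := hlam
  set L := gapRatio (m + 1) C₀ Cf lamp lamm lam with hLdef
  have h0 : gapSum ((C₀ ^ (m + 1) * C₀) ^ 2) Cf lamp lamm 0 lam < min l ((1 + L) / 2) := by
    rw [gapSum_zero_eq_gapRatio, ← hLdef]
    exact lt_min hl.1 (by linarith)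
  obtain ⟨κ, hκ, hmκ, hpκ, hgκ⟩ := (eventually_gapSum_lt hm hp h0).exists
  have hθl := hgκ.trans_le (min_le_left _ _)
  have hθL := hgκ.trans_le (min_le_right _ _)
  have hθ1 := hθl.trans hl.2
  obtain ⟨μ, hμ, hμm, hμθ⟩ := exists_rate_lt hmκ hpκ hθ1
  have hbase := gapSum_mono (base_sq_le hC₀ m) hCf.le hκ.le hmκ hpκ
  have hL1 : 0 < 1 - L := by linarith
  have ha : 0 < (C₀ ^ (m + 1) * C₀) ^ 2 := by positivity
  have hq : sizeConst (m + 1) C₀ Cf lamp lamm lam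
      = 2 * (C₀ ^ (m + 1) * C₀) ^ 2 / (1 - L) := by
    rw [sizeConst, ← hLdef]; ring_nf
  refine ⟨κ, μ, hmκ, hpκ, ⟨hκ, hμ, hμm, hθ1, hμθ, hbase.trans_lt hθ1, ?_, ?_⟩, hθl.le,
    hbase.trans hθl.le⟩
  · rw [hq]; positivity
  -- `a ≤ (1 - θ) q` since `θ ≤ (1 + L₁) / 2`
  · rw [hq]
    set a := (C₀ ^ (m + 1) * C₀) ^ 2
    have h1 : a = (1 - (1 + L) / 2) * (2 * a / (1 - L)) := by field_simp; ring
    have h2 : 0 < 2 * a / (1 - L) := by positivity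
    nlinarith

/-! ### Systems on scales of spaces -/

variable {Xp Xm : ℕ → Type*}
  [∀ r, NormedAddCommGroup (Xp r)] [∀ r, NormedSpace ℝ (Xp r)]
  [∀ r, NormedAddCommGroup (Xm r)] [∀ r, NormedSpace ℝ (Xm r)]
  {m : ℕ} {D : QLSystem Xp Xm m} {Sp : HilbertScale Xp} {Sm : HilbertScale Xm}
  {R₀ C₀ Cf lamp lamm : ℝ}

/-- The top two levels of the scales carry a coupled system, with constants that depend on
`C₀` and the regularity index only. -/
theorem coupledSystem (hD : D.Admissible Sp Sm R₀ C₀ Cf lamp lamm) (hR₀ : 0 < R₀) (hC₀ : 1 ≤ C₀)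
    (hCf : 0 ≤ Cf) :
    CoupledSystem (Sp.incl m) (Sm.incl m) R₀ (C₀ ^ (m + 1)) C₀ (scaleFormConst m C₀) Cf lamp lamm
      (scaleForm Sp 1 lamp m D.Lp D.Ap) (scaleForm Sm (-1) lamm m D.Lm D.Am) (D.Ap m) (D.Am m)
      D.fp D.fm := by
  have h0 : (0 : Xp m × Xm m) ∈ ball 0 R₀ := mem_ball_self hR₀
  refine ⟨?_, ?_, hCf, denseRange_incl hC₀ hD.op_plus h0 m le_rfl,
    denseRange_incl hC₀ hD.op_minus h0 m le_rfl,
    hasWeaklyClosedBalls_incl hC₀ hD.op_plus h0 m le_rfl,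
    hasWeaklyClosedBalls_incl hC₀ hD.op_minus h0 m le_rfl,
    Sp.incl_injective m, Sm.incl_injective m, hD.nonlin_plus.continuousOn,
    hD.nonlin_minus.continuousOn, hD.nonlin_plus.norm_le, hD.nonlin_minus.norm_le,
    fun v hv w hw => ?_, fun v hv w hw => ?_⟩
  · simpa using DissipativeFamily.katoFamily hC₀ (by norm_num) hD.energy_plus hD.op_plus
  · simpa using DissipativeFamily.katoFamily hC₀ (by norm_num) hD.energy_minus hD.op_minus
  · have h := hD.nonlin_plus.lipschitz v hv w hw
    rw [map_sub, map_sub] at h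
    exact h
  · have h := hD.nonlin_minus.lipschitz v hv w hw
    rw [map_sub, map_sub] at h
    exact h

theorem isSolution_of_isSolutionOn {I : Set ℝ} {v : ℝ → Xp (m + 1) × Xm (m + 1)}
    (h : D.IsSolutionOn Sp Sm R₀ I v) :
    IsSolution (Sp.incl m) (Sm.incl m) R₀ (D.Ap m) (D.Am m) D.fp D.fm I v :=
  ⟨h.continuousOn, fun t ht => mem_ball_zero_iff.1 (h.mem_ball t ht), fun t ht =>
    (h.eq_plus t ht).prodMk (h.eq_minus t ht)⟩

theorem isSolutionOn_of_isSolution {K c C : ℝ} {bp bm} (S : CoupledSystem (Sp.incl m) (Sm.incl m)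
      R₀ c C K Cf lamp lamm bp bm (D.Ap m) (D.Am m) D.fp D.fm)
    {v : ℝ → Xp (m + 1) × Xm (m + 1)}
    (h : IsSolution (Sp.incl m) (Sm.incl m) R₀ (D.Ap m) (D.Am m) D.fp D.fm (Iic 0) v) :
    D.IsSolutionOn Sp Sm R₀ (Iic 0) v := by
  have hd : ∀ t ∈ Iic (0 : ℝ), HasDerivWithinAt (fun t => pairIncl Sp Sm m (v t))
    (velocity (Sp.incl m) (Sm.incl m) (D.Ap m) (D.Am m) D.fp D.fm (v t) (v t)) (Iic 0) t :=
    h.hasDerivWithinAt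
  refine ⟨h.continuousOn, fun t ht => mem_ball_zero_iff.2 (h.norm_lt t ht), ?_,
    fun t ht => HasDerivWithinAt.prod_fst (hd t ht), fun t ht => HasDerivWithinAt.prod_snd (hd t ht)⟩
  refine (contDiffOn_one_iff_derivWithin (uniqueDiffOn_Iic 0)).2
    ⟨fun t ht => (hd t ht).differentiableWithinAt, ?_⟩
  refine (S.continuousOn_velocity h.norm_lt ((ContinuousLinearMap.continuous _).comp_continuousOn
    h.continuousOn) h.continuousOn).congr fun t ht => ?_
  exact (hd t ht).derivWithin (uniqueDiffOn_Iic 0 t ht)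

end

end QuasilinearManifold

/-! ### The invariant graph -/

theorem theoremT
    -- the regularity index is `k = m + 1 ≥ 1`
    (k m : ℕ) (hk : k = m + 1) (R₀ C₀ Cf lamp lamm : ℝ)
    (hR₀ : 0 < R₀) (hC₀ : 1 ≤ C₀) (hCf : 0 < Cf)
    (lam : ℝ) (hlam : lam ∈ sigmaPlus k C₀ Cf lamp lamm)
    (M₀ : ℝ) (hM₀ : 2 * C₀ ^ (2 * (k + 1)) / (1 - gapRatio k C₀ Cf lamp lamm lam) < M₀)
    (l : ℝ) (hl : l ∈ Set.Ioo (gapRatio k C₀ Cf lamp lamm lam) 1) :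
    -- `ε` depends on the constants only, not on the spaces or the system
    ∃ ε : ℝ, 0 < ε ∧ ε < R₀ / M₀ ∧
      ∀ (Xp : ℕ → Type*) (Xm : ℕ → Type*)
        [∀ r, NormedAddCommGroup (Xp r)] [∀ r, NormedSpace ℝ (Xp r)]
        [∀ r, NormedAddCommGroup (Xm r)] [∀ r, NormedSpace ℝ (Xm r)]
        (Sp : HilbertScale Xp) (Sm : HilbertScale Xm) (D : QLSystem Xp Xm m),
        D.Admissible Sp Sm R₀ C₀ Cf lamp lamm →
        ∃ h : Xp (m + 1) → Xm (m + 1),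
          -- (1) existence
          (∀ v₀ ∈ Metric.ball (0 : Xp (m + 1)) ε,
            ∃ v, D.IsDecayingSolution Sp Sm R₀ lam (M₀ * ε) v₀ v) ∧
          -- (1) uniqueness
          (∀ v₀ ∈ Metric.ball (0 : Xp (m + 1)) ε, ∀ v w,
            D.IsDecayingSolution Sp Sm R₀ lam (M₀ * ε) v₀ v →
            D.IsDecayingSolution Sp Sm R₀ lam (M₀ * ε) v₀ w →
            ∀ t ≤ 0, v t = w t) ∧
          -- (1) the graph and the sharper bound, (2) negative invariance
          (∀ v₀ ∈ Metric.ball (0 : Xp (m + 1)) ε, ∀ v,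
            D.IsDecayingSolution Sp Sm R₀ lam (M₀ * ε) v₀ v →
            (v 0).2 = h v₀ ∧
            (∀ t ≤ 0, ‖v t‖ ≤ 2 * C₀ ^ (2 * (k + 1)) / (1 - gapRatio k C₀ Cf lamp lamm lam)
              * ‖v₀‖ * Real.exp (lam * t)) ∧
            (∀ t < 0, (v t).1 ∈ Metric.ball (0 : Xp (m + 1)) ε → h (v t).1 = (v t).2)) ∧
          -- (3) positive local invariance
          (∀ v₀ ∈ Metric.ball (0 : Xp (m + 1)) ε, ∀ v,
            D.IsDecayingSolution Sp Sm R₀ lam (M₀ * ε) v₀ v →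
            ∀ T₀ > 0, D.IsSolutionOn Sp Sm R₀ (Set.Iio T₀) v →
            ∀ T : ℝ, T = sSup {t | 0 < t ∧ t ≤ T₀ ∧
                ∀ τ ∈ Set.Ico 0 t, (v τ).1 ∈ Metric.ball (0 : Xp (m + 1)) ε} →
              0 < T ∧ T ≤ T₀ ∧ ∀ t ∈ Set.Ico 0 T, h (v t).1 = (v t).2) ∧
          -- (4) bounds on `h` and Lipschitz dependence at the level `k - 1 = m`
          h 0 = 0 ∧
          (∀ v₀ ∈ Metric.ball (0 : Xp (m + 1)) ε,
            ‖h v₀‖ ≤ 2 * l * C₀ ^ (2 * (k + 1)) / (1 - gapRatio k C₀ Cf lamp lamm lam)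
              * ‖v₀‖) ∧
          (∀ v₀ ∈ Metric.ball (0 : Xp (m + 1)) ε, ∀ w₀ ∈ Metric.ball (0 : Xp (m + 1)) ε,
            ‖Sm.incl m (h v₀ - h w₀)‖ ≤
              l * C₀ ^ (2 * k) / (1 - l) * ‖Sp.incl m (v₀ - w₀)‖) ∧
          (∀ v₀ ∈ Metric.ball (0 : Xp (m + 1)) ε, ∀ w₀ ∈ Metric.ball (0 : Xp (m + 1)) ε,
            ∀ v w, D.IsDecayingSolution Sp Sm R₀ lam (M₀ * ε) v₀ v →
            D.IsDecayingSolution Sp Sm R₀ lam (M₀ * ε) w₀ w →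
            ∀ t ≤ 0, ‖pairIncl Sp Sm m (v t - w t)‖ ≤
              C₀ ^ (2 * k) / (1 - l) * Real.exp (lam * t) * ‖Sp.incl m (v₀ - w₀)‖) ∧
          -- (5) every exponentially decaying solution is eventually on the graph
          (∀ lam' ∈ sigmaPlus k C₀ Cf lamp lamm, 0 < lam' →
            ∀ v, D.IsSolutionOn Sp Sm R₀ (Set.Iic 0) v →
            (∃ C : ℝ, ∀ t ≤ 0, Real.exp (-lam' * t) * ‖v t‖ ≤ C) →
            ∃ t₀ ≤ 0, ∀ t ≤ t₀,
              (v t).1 ∈ Metric.ball (0 : Xp (m + 1)) ε ∧ (v t).2 = h (v t).1) := by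
  subst hk
  obtain ⟨κ, μ, hmκ, hpκ, hg, hθl, hθl'⟩ :=
    QuasilinearManifold.exists_spectralGap hC₀ hCf hlam hl
  set q := QuasilinearManifold.sizeConst (m + 1) C₀ Cf lamp lamm lam with hq
  have hC₀0 : 0 < C₀ := zero_lt_one.trans_le hC₀
  have hq0 : 0 ≤ q := hg.zero_le_size
  have hqM : q < M₀ := hM₀
  have hM₀0 : 0 < M₀ := hq0.trans_lt hqM
  have hK := QuasilinearManifold.scaleFormConst_nonneg hC₀0.le m
  -- the size `M` of the paths determines the radius `ε = M / M₀`
  obtain ⟨M, hM, hs⟩ := QuasilinearManifold.exists_smallSize (c := C₀ ^ (m + 1)) hR₀ hC₀0.le hK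
    hCf.le hlam.1 hg.slack_pos hmκ hpκ
  have hMε : M₀ * (M / M₀) = M := by field_simp
  refine ⟨M / M₀, by positivity, div_lt_div_of_pos_right hs.lt_radius hM₀0, ?_⟩
  intro Xp Xm _ _ _ _ Sp Sm D hD
  set ε := M / M₀ with hε
  have hε0 : 0 < ε := by positivity
  rw [hMε]
  have h0 : (0 : Xp m × Xm m) ∈ ball 0 R₀ := mem_ball_self hR₀
  have S := QuasilinearManifold.coupledSystem hD hR₀ hC₀ hCf.le
  have := QuasilinearManifold.completeSpace_scale hC₀ hD.op_plus h0 m (by omega)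
  have := QuasilinearManifold.completeSpace_scale hC₀ hD.op_minus h0 m (by omega)
  have := QuasilinearManifold.completeSpace_scale hC₀ hD.op_plus h0 (m + 1) le_rfl
  have := QuasilinearManifold.completeSpace_scale hC₀ hD.op_minus h0 (m + 1) le_rfl
  have hsmall : ∀ v₀ ∈ ball (0 : Xp (m + 1)) ε, q * ‖v₀‖ < M := fun v₀ hv₀ => by
    rw [mem_ball_zero_iff] at hv₀
    calc q * ‖v₀‖ ≤ q * ε := mul_le_mul_of_nonneg_left hv₀.le hq0
      _ < M₀ * ε := mul_lt_mul_of_pos_right hqM hε0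
      _ = M := hMε
  have hex : ∀ v₀ ∈ ball (0 : Xp (m + 1)) ε, ∃ v, D.IsDecayingSolution Sp Sm R₀ lam M v₀ v := by
    intro v₀ hv₀
    obtain ⟨w, hw, hw0, hwM, -⟩ := S.exists_solution_of_gap hs hg (hsmall v₀ hv₀).le
    exact ⟨w, QuasilinearManifold.isSolutionOn_of_isSolution S hw, hw0, fun t ht =>
      (hwM t ht).trans (mul_le_mul_of_nonneg_right (hsmall v₀ hv₀).le (Real.exp_pos _).le)⟩
  have huniq : ∀ v₀, ∀ v w, D.IsDecayingSolution Sp Sm R₀ lam M v₀ v →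
      D.IsDecayingSolution Sp Sm R₀ lam M v₀ w → ∀ t ≤ 0, v t = w t := fun v₀ v w hv hw =>
    S.solution_unique hs hg.gapSum_base_lt (QuasilinearManifold.isSolution_of_isSolutionOn hv.1)
      hv.2.2 (QuasilinearManifold.isSolution_of_isSolutionOn hw.1) hw.2.2
      (hv.2.1.trans hw.2.1.symm)
  choose! sol hsol using hex
  -- the graph: the `-` component at `0` of the decaying solution
  let h : Xp (m + 1) → Xm (m + 1) := fun v₀ => (sol v₀ 0).2
  have hgraph : ∀ v₀ ∈ ball (0 : Xp (m + 1)) ε, ∀ v,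
      D.IsDecayingSolution Sp Sm R₀ lam M v₀ v → (v 0).2 = h v₀ := fun v₀ hv₀ v hv =>
    congrArg Prod.snd (huniq v₀ v (sol v₀) hv (hsol v₀ hv₀) 0 le_rfl)
  have hbounds : ∀ v₀ ∈ ball (0 : Xp (m + 1)) ε, ∀ v,
      D.IsDecayingSolution Sp Sm R₀ lam M v₀ v →
      (∀ t ≤ 0, ‖v t‖ ≤ q * ‖v₀‖ * Real.exp (lam * t)) ∧ ‖(v 0).2‖ ≤ l * (q * ‖v₀‖) := by
    intro v₀ hv₀ v hv
    have hb := S.solution_bounds hs hg (QuasilinearManifold.isSolution_of_isSolutionOn hv.1) hv.2.2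
      (by rw [hv.2.1]; exact (hsmall v₀ hv₀).le)
    rw [hv.2.1] at hb
    exact ⟨hb.1, hb.2.trans (mul_le_mul_of_nonneg_right hθl (by positivity))⟩
  -- translates of solutions are solutions
  have htrans : ∀ v (I : Set ℝ) (t : ℝ), D.IsSolutionOn Sp Sm R₀ I v → (∀ s ≤ 0, s + t ∈ I) →
      (∀ s ≤ 0, ‖v (s + t)‖ ≤ M * Real.exp (lam * s)) →
      D.IsDecayingSolution Sp Sm R₀ lam M (v t).1 (fun s => v (s + t)) := fun v I t hv hI hvt =>
    ⟨QuasilinearManifold.isSolutionOn_of_isSolution S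
      ((QuasilinearManifold.isSolution_of_isSolutionOn hv).comp_add hI), by simp, hvt⟩
  have hbound₄ : ∀ v₀ ∈ ball (0 : Xp (m + 1)) ε, ‖h v₀‖ ≤ l * (q * ‖v₀‖) := fun v₀ hv₀ => by
    rw [← hgraph v₀ hv₀ _ (hsol v₀ hv₀)]
    exact (hbounds v₀ hv₀ _ (hsol v₀ hv₀)).2
  have h0ε : (0 : Xp (m + 1)) ∈ ball (0 : Xp (m + 1)) ε := mem_ball_self hε0
  have hl1 : 0 < 1 - l := by linarith [hl.2]
  have hl0 : 0 ≤ l := (add_nonneg (S.gap_terms_nonneg hs (a := (C₀ ^ (m + 1)) ^ 2)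
    (by positivity)).2.1 (S.gap_terms_nonneg hs (a := (C₀ ^ (m + 1)) ^ 2)
    (by positivity)).2.2).trans hθl'
  have hpow : C₀ ^ (2 * (m + 1)) = (C₀ ^ (m + 1)) ^ 2 := by ring
  have hlip : ∀ v₀ w₀ v w, D.IsDecayingSolution Sp Sm R₀ lam M v₀ v →
      D.IsDecayingSolution Sp Sm R₀ lam M w₀ w →
      (∀ t ≤ 0, ‖pairIncl Sp Sm m (v t - w t)‖ ≤
        C₀ ^ (2 * (m + 1)) / (1 - l) * Real.exp (lam * t) * ‖Sp.incl m (v₀ - w₀)‖) ∧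
      ‖Sm.incl m ((v 0).2 - (w 0).2)‖ ≤
        l * C₀ ^ (2 * (m + 1)) / (1 - l) * ‖Sp.incl m (v₀ - w₀)‖ := by
    intro v₀ w₀ v w hv hw
    obtain ⟨h1, h2⟩ := S.norm_solution_sub_le hs hg.gapSum_base_lt
      (QuasilinearManifold.isSolution_of_isSolutionOn hv.1) hv.2.2
      (QuasilinearManifold.isSolution_of_isSolutionOn hw.1) hw.2.2
    rw [hv.2.1, hw.2.1, ← map_sub] at h1 h2
    set δ := ‖Sp.incl m (v₀ - w₀)‖
    have hδ : 0 ≤ δ := norm_nonneg _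
    have hdiv : (C₀ ^ (m + 1)) ^ 2 * δ
        / (1 - QuasilinearManifold.gapSum ((C₀ ^ (m + 1)) ^ 2) Cf lamp lamm κ lam)
        ≤ (C₀ ^ (m + 1)) ^ 2 * δ / (1 - l) :=
      div_le_div_of_nonneg_left (by positivity) hl1 (by linarith)
    constructor
    · intro t ht
      rw [map_sub]
      calc _ ≤ (C₀ ^ (m + 1)) ^ 2 * δ / (1 - l) * Real.exp (lam * t) :=
            (h1 t ht).trans (mul_le_mul_of_nonneg_right hdiv (Real.exp_pos _).le)
        _ = _ := by rw [hpow]; ring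
    · rw [map_sub]
      have h3 := h2 0 (mem_Iic.2 le_rfl)
      rw [mul_zero, Real.exp_zero, mul_one] at h3
      calc _ ≤ l * ((C₀ ^ (m + 1)) ^ 2 * δ / (1 - l)) :=
            h3.trans ((mul_le_mul_of_nonneg_right hθl' (div_nonneg (by positivity)
              (by linarith))).trans (mul_le_mul_of_nonneg_left hdiv hl0))
        _ = _ := by rw [hpow]; ring
  refine ⟨h, fun v₀ hv₀ => ⟨_, hsol v₀ hv₀⟩, fun v₀ _ v w => huniq v₀ v w, ?_, ?_, ?_, ?_, ?_, ?_, ?_⟩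
  · intro v₀ hv₀ v hv
    refine ⟨hgraph v₀ hv₀ v hv, (hbounds v₀ hv₀ v hv).1, fun t ht hvt => ?_⟩
    have h1 := htrans v (Iic 0) t hv.1 (fun s hs' => by rw [mem_Iic]; linarith) fun s hs' =>
      (hv.2.2 _ (by linarith)).trans (mul_le_mul_of_nonneg_left
        (Real.exp_le_exp.2 (mul_le_mul_of_nonneg_left (by linarith) hlam.1)) hM.le)
    simpa using (hgraph _ hvt _ h1).symm
  · intro v₀ hv₀ v hv T₀ hT₀ hvT T hT
    set A := {t | 0 < t ∧ t ≤ T₀ ∧ ∀ τ ∈ Set.Ico 0 t, (v τ).1 ∈ ball (0 : Xp (m + 1)) ε}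
    have hbdd : BddAbove A := ⟨T₀, fun t ht => ht.2.1⟩
    -- the `+` component stays in the ball for a short time, by continuity
    obtain ⟨t₁, ht₁⟩ : ∃ t₁, t₁ ∈ A := by
      have hc : ContinuousAt (fun t => (v t).1) 0 :=
        (hvT.continuousOn.continuousAt (Iio_mem_nhds hT₀)).fst
      have h1 : (v 0).1 ∈ ball (0 : Xp (m + 1)) ε := by rw [hv.2.1]; exact hv₀
      obtain ⟨d, hd0, hd⟩ := Metric.eventually_nhds_iff.1 (hc.eventually (isOpen_ball.mem_nhds h1))
      refine ⟨min d T₀, lt_min hd0 hT₀, min_le_right _ _, fun τ hτ => hd ?_⟩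
      rw [Real.dist_eq, sub_zero, abs_of_nonneg hτ.1]
      exact hτ.2.trans_le (min_le_left _ _)
    refine ⟨?_, ?_, fun t ht => ?_⟩
    · rw [hT]; exact ht₁.1.trans_le (le_csSup hbdd ht₁)
    · rw [hT]; exact csSup_le ⟨t₁, ht₁⟩ fun t ht => ht.2.1
    · obtain ⟨t', ht', htt'⟩ := exists_lt_of_lt_csSup ⟨t₁, ht₁⟩ (hT ▸ ht.2)
      have hball : ∀ τ ∈ Icc 0 t, (v τ).1 ∈ ball (0 : Xp (m + 1)) ε := fun τ hτ =>
        ht'.2.2 τ ⟨hτ.1, hτ.2.trans_lt htt'⟩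
      have htT : t < T₀ := htt'.trans_le ht'.2.1
      have h1 := htrans v (Iio T₀) t hvT (fun s hs' => by rw [mem_Iio]; linarith)
        (S.norm_le_of_continuation hs hg (QuasilinearManifold.isSolution_of_isSolutionOn hvT)
          hv.2.2 ht.1 htT fun τ hτ => hsmall _ (hball τ hτ))
      simpa using (hgraph _ (hball t ⟨ht.1, le_rfl⟩) _ h1).symm
  · simpa using hbound₄ 0 h0ε
  · intro v₀ hv₀
    refine (hbound₄ v₀ hv₀).trans (le_of_eq ?_)
    rw [hq, QuasilinearManifold.sizeConst]
    ring
  · intro v₀ hv₀ w₀ hw₀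
    exact (hlip v₀ w₀ _ _ (hsol v₀ hv₀) (hsol w₀ hw₀)).2
  · intro v₀ _ w₀ _ v w hv hw
    exact (hlip v₀ w₀ v w hv hw).1
  · rintro lam' ⟨-, hm', hp', hL'⟩ hlam' v hv ⟨B, hB⟩
    -- compare at the smaller of the two rates
    have hν : min lam lam' ∈ sigmaPlus (m + 1) C₀ Cf lamp lamm := by
      rcases min_choice lam lam' with h1 | h1 <;> rw [h1]
      exacts [hlam, ⟨hlam'.le, hm', hp', hL'⟩]
    obtain ⟨hν0, hνm, hνp, hνL⟩ := hν
    rw [← QuasilinearManifold.gapSum_zero_eq_gapRatio] at hνL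
    obtain ⟨κ', hκ', hmκ', hpκ', hgκ'⟩ :=
      (QuasilinearManifold.eventually_gapSum_lt hνm hνp hνL).exists
    obtain ⟨M', hM', hs'⟩ := QuasilinearManifold.exists_smallSize (c := C₀ ^ (m + 1)) hR₀ hC₀0.le hK
      hCf.le hν0 hκ' hmκ' hpκ'
    obtain ⟨t₀, ht₀, hfin⟩ := S.eventually_snd_eq hs hg hs' hM'
      ((QuasilinearManifold.gapSum_mono (QuasilinearManifold.base_sq_le hC₀ m) hCf.le hκ'.le hmκ'
        hpκ').trans_lt hgκ') (min_le_left _ _) (min_le_right _ _) hlam' hM hε0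
      (QuasilinearManifold.isSolution_of_isSolutionOn hv) (B := B) fun t ht => by
        have h1 := mul_le_mul_of_nonneg_right (hB t ht) (Real.exp_pos (lam' * t)).le
        rwa [mul_right_comm, ← Real.exp_add, neg_mul, neg_add_cancel, Real.exp_zero, one_mul] at h1
    refine ⟨t₀, ht₀, fun t ht => ?_⟩
    obtain ⟨hvε, hsnd⟩ := hfin t ht
    have hmem : (v t).1 ∈ ball (0 : Xp (m + 1)) ε :=
      mem_ball_zero_iff.2 ((norm_fst_le _).trans_lt hvε)
    have hsol' := hsol _ hmem
    exact ⟨hmem, hsnd _ (QuasilinearManifold.isSolution_of_isSolutionOn hsol'.1) hsol'.2.2 hsol'.2.1⟩
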